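/- **Setting.** Let $n\ge 1$, let $H^1=H^1(\mathbb R^n;\mathbb R)$, let $V:[0,\infty)\to\mathbb R$ be $C^1$ with $V(r)\to0$ as $r\to\infty$, and let $f(r,t)$ ($r>0$, $t\in\mathbb R$) be $C^1$ in $t$ and $C^1$ in $r$, with $f(r,0)=f_t(r,0)=0$, $f(r,-t)=-f(r,t)$ and, for some $C$ and some finite $q\ge0$ with $q\le\frac4{n-2}$ if $n\ge3$, $|f_t(r,t)|\le C(1+|t|^q)$ for all $r>0$, $t\in\mathbb R$. Put $F(r,t)=\int_0^tf(r,s)\,ds$ and, for $u\in H^1$, $$E(u)=\int_{\mathbb R^n}\tfrac12|\nabla u|^2+\tfrac12V(|x|)u^2-F(|x|,u),\qquad Q(u)=\tfrac12\int_{\mathbb R^n}u^2,$$ $$m(c)=\inf\{E(u):u\in H^1,\ Q(u)=c\},\qquad S_c=\{u\in H^1: Q(u)=c,\ E(u)=m(c)\},$$ $$\mathrm{Eq}_\lambda(u)=-\Delta u+V(|x|)u-\lambda u-f(|x|,u),\qquad \mathcal T_c=\{\lambda\in\mathbb R:\exists u\in S_c,\ \mathrm{Eq}_\lambda(u)=0\},$$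 the equation being understood in the weak sense. Let $\Lambda_0=\inf\sigma(-\Delta+V)$ on $L^2(\mathbb R^n)$, and for a solution $u$ of $\mathrm{Eq}_\lambda(u)=0$ let $L_u\varphi=-\Delta\varphi+V\varphi-\lambda\varphi-f_t(|x|,u)\varphi$. The problem is called autonomous if $V=0$ and $f$ does not depend on $r$. Let $]c_*,c^*[$ be an open interval with $-\infty\le c_*$ and $c^*\le\infty$, on which the following two properties hold. * **(A1)** $m$ is finite and continuous on $]c_*,c^*[$, and for every $c$ in it $S_c\neq\emptyset$; every $u\in S_c$ is, up to sign (and up to translation in the autonomous case), positive, radial and decreasing, and satisfies $\mathrm{Eq}_\lambda(u)=0$ for some $\lambda<\Lambda_0\le0$; moreover $L_u$ has exactly one negative eigenvalue, and it is simple. * **(A3)** For every $c\in\,]c_*,c^*[$, every sequence $(v_k)$ in $H^1$ with $Q(v_k)\to c$ and $E(v_k)\to m(c)$ converges strongly in $H^1$, up to a subsequence (and up to translations in the autonomous case), to an element of $S_c$. **Proposition.** Under these assumptions: 1. For every $c\in\,]c_*,c^*[$ the set $\mathcal T_c$ has a minimum $\lambda_{\min}(c)$ and a maximum $\lambda_{\max}(c)$,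 the one-sided derivatives of $m$ at $c$ exist, and $m'_+(c)=\lambda_{\min}(c)$, $m'_-(c)=\lambda_{\max}(c)$. For every $\tilde c\in\,]c_*,c^*[$, $$\lim_{c\to\tilde c^+}\lambda_{\min}(c)=\lim_{c\to\tilde c^+}\lambda_{\max}(c)=\lambda_{\min}(\tilde c),\qquad \lim_{c\to\tilde c^-}\lambda_{\min}(c)=\lim_{c\to\tilde c^-}\lambda_{\max}(c)=\lambda_{\max}(\tilde c).$$ The function $m$ is strictly decreasing on $]c_*,c^*[$, Lipschitz continuous on every compact subinterval of $]c_*,c^*[$, and differentiable at almost every $c\in\,]c_*,c^*[$. 2. The function $m$ is strictly concave on $]c_*,c^*[$, and it is twice differentiable at almost every $c\in\,]c_*,c^*[$; that is, for almost every $c$, $m$ is differentiable at $c$ and, for some $b\in\mathbb R$, $m'$, restricted to the set where $m$ is differentiable, has derivative $b$ at $c$, and $m(c+t)=m(c)+m'(c)t+\frac b2t^2+o(t^2)$ as $t\to0$. If $c_1>c_2$ are in $]c_*,c^*[$, then $$\lambda_{\min}(c_1)\le\lambda_{\max}(c_1)<\lambda_{\min}(c_2)\le\lambda_{\max}(c_2).$$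 3. Let $c\in\,]c_*,c^*[$. * Suppose that **(D1)** holds at $c$: for all $\epsilon_k\to0^+$ with $c+\epsilon_k\in\,]c_*,c^*[$ and all positive radial decreasing $u_k\in S_{c+\epsilon_k}$ with $\mathrm{Eq}_{\lambda_{\min}(c+\epsilon_k)}(u_k)=0$ there is $u_c\in S_c$ with $\mathrm{Eq}_{\lambda_{\min}(c)}(u_c)=0$ such that, up to a subsequence, $u_k\to u_c$ in $H^1$ and $\limsup_k\|(u_k-u_c)/\epsilon_k\|_{H^1}<\infty$. Then $$\liminf_{\tilde c\to c^+}\frac{\lambda_{\min}(\tilde c)-\lambda_{\min}(c)}{\tilde c-c}>-\infty.$$ * Suppose that **(D2)** holds at $c$: for all $\epsilon_k\to0^+$ with $c-\epsilon_k\in\,]c_*,c^*[$ and all positive radial decreasing $u_k\in S_{c-\epsilon_k}$ with $\mathrm{Eq}_{\lambda_{\max}(c-\epsilon_k)}(u_k)=0$ there is $u_c\in S_c$ with $\mathrm{Eq}_{\lambda_{\max}(c)}(u_c)=0$ such that, up to a subsequence, $u_k\to u_c$ in $H^1$ and $\limsup_k\|(u_k-u_c)/\epsilon_k\|_{H^1}<\infty$.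 Then $$\liminf_{\tilde c\to c^-}\frac{\lambda_{\max}(\tilde c)-\lambda_{\max}(c)}{\tilde c-c}>-\infty.$$ -/

import Mathlib

open MeasureTheory Filter Topology Set
open scoped ContDiff

noncomputable section

namespace NGSS

/-- Euclidean space `ℝⁿ`. -/
abbrev Eu (n : ℕ) : Type := EuclideanSpace ℝ (Fin n)

/-- Test functions: smooth with compact support. -/
def IsTest {n : ℕ} (φ : Eu n → ℝ) : Prop := ContDiff ℝ ∞ φ ∧ HasCompactSupport φ

/-- `g` is the weak gradient of `u`. -/
def IsWeakGrad {n : ℕ} (u : Eu n → ℝ) (g : Eu n → Eu n) : Prop :=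
  ∀ φ : Eu n → ℝ, IsTest φ → ∫ x, u x • gradient φ x = - ∫ x, φ x • g x

/-- The ambient Hilbert space `L²(ℝⁿ; ℝ) × L²(ℝⁿ; ℝⁿ)`, with norm `(‖u‖² + ‖g‖²)^(1/2)`. -/
abbrev L2Pair (n : ℕ) : Type :=
  WithLp 2 (Lp ℝ 2 (volume : Measure (Eu n)) × Lp (Eu n) 2 (volume : Measure (Eu n)))

lemma IsTest.continuous_gradient {n : ℕ} {φ : Eu n → ℝ} (h : IsTest φ) :
    Continuous (gradient φ) :=
  (InnerProductSpace.toDual ℝ (Eu n)).symm.continuous.comp (h.1.continuous_fderiv (by simp))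

lemma IsTest.memLp {n : ℕ} {φ : Eu n → ℝ} (h : IsTest φ) :
    MemLp φ 2 (volume : Measure (Eu n)) :=
  h.1.continuous.memLp_of_hasCompactSupport h.2

lemma IsTest.memLp_gradient {n : ℕ} {φ : Eu n → ℝ} (h : IsTest φ) :
    MemLp (gradient φ) 2 (volume : Measure (Eu n)) := by
  refine h.continuous_gradient.memLp_of_hasCompactSupport ?_
  exact (h.2.fderiv (𝕜 := ℝ)).comp_left
    (g := (InnerProductSpace.toDual ℝ (Eu n)).symm) (map_zero _)

lemma IsTest.integrable_left {n : ℕ} {φ : Eu n → ℝ} (h : IsTest φ)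
    (u : Lp ℝ 2 (volume : Measure (Eu n))) : Integrable (fun x => u x • gradient φ x) :=
  memLp_one_iff_integrable.mp (h.memLp_gradient.smul (Lp.memLp u))

lemma IsTest.integrable_right {n : ℕ} {φ : Eu n → ℝ} (h : IsTest φ)
    (g : Lp (Eu n) 2 (volume : Measure (Eu n))) : Integrable (fun x => φ x • g x) :=
  memLp_one_iff_integrable.mp ((Lp.memLp g).smul h.memLp)

/-- The Sobolev space `H¹(ℝⁿ; ℝ)`: pairs `(u, ∇u)` of an `L²` function and its `L²` weak gradient,
with the norm `(‖u‖² + ‖∇u‖²)^(1/2)`. -/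
def H1 (n : ℕ) : Submodule ℝ (L2Pair n) where
  carrier := {p | IsWeakGrad p.fst p.snd}
  zero_mem' := by
    intro φ hφ
    have h1 : (fun x => ((0 : L2Pair n).fst : Eu n → ℝ) x • gradient φ x)
        =ᵐ[volume] fun _ => 0 := by
      filter_upwards [Lp.coeFn_zero ℝ 2 (volume : Measure (Eu n))] with x hx
      simp
    have h2 : (fun x => φ x • ((0 : L2Pair n).snd : Eu n → Eu n) x)
        =ᵐ[volume] fun _ => 0 := by
      filter_upwards [Lp.coeFn_zero (Eu n) 2 (volume : Measure (Eu n))] with x hx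
      simp
    rw [integral_congr_ae h1, integral_congr_ae h2]
    simp
  add_mem' := by
    intro a b ha hb φ hφ
    have h1 : (fun x => ((a + b).fst : Eu n → ℝ) x • gradient φ x)
        =ᵐ[volume] fun x => a.fst x • gradient φ x + b.fst x • gradient φ x := by
      filter_upwards [Lp.coeFn_add a.fst b.fst] with x hx
      rw [WithLp.add_fst, hx, Pi.add_apply, add_smul]
    have h2 : (fun x => φ x • ((a + b).snd : Eu n → Eu n) x)
        =ᵐ[volume] fun x => φ x • a.snd x + φ x • b.snd x := by
      filter_upwards [Lp.coeFn_add a.snd b.snd] with x hx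
      rw [WithLp.add_snd, hx, Pi.add_apply, smul_add]
    rw [integral_congr_ae h1, integral_congr_ae h2,
      integral_add (hφ.integrable_left _) (hφ.integrable_left _),
      integral_add (hφ.integrable_right _) (hφ.integrable_right _), ha φ hφ, hb φ hφ]
    abel
  smul_mem' := by
    intro k a ha φ hφ
    have h1 : (fun x => ((k • a).fst : Eu n → ℝ) x • gradient φ x)
        =ᵐ[volume] fun x => k • (a.fst x • gradient φ x) := by
      filter_upwards [Lp.coeFn_smul k a.fst] with x hx
      simp [hx, mul_smul]
    have h2 : (fun x => φ x • ((k • a).snd : Eu n → Eu n) x)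
        =ᵐ[volume] fun x => k • (φ x • a.snd x) := by
      filter_upwards [Lp.coeFn_smul k a.snd] with x hx
      simp [hx, smul_comm k (φ x)]
    rw [integral_congr_ae h1, integral_congr_ae h2, integral_smul, integral_smul, ha φ hφ, smul_neg]

/-- The function underlying an element of `H¹`. -/
def fn {n : ℕ} (u : H1 n) : Eu n → ℝ := u.1.fst

/-- The weak gradient of an element of `H¹`. -/
def grad {n : ℕ} (u : H1 n) : Eu n → Eu n := u.1.snd

section Problem

/-- `f` is `C¹` in `t ∈ ℝ` and `C¹` in `r > 0`, odd in `t`, with `f (r, 0) = f_t (r, 0) = 0`. -/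
structure CondF1 (f : ℝ → ℝ → ℝ) : Prop where
  contDiff_t : ∀ r > 0, ContDiff ℝ 1 (f r)
  contDiff_r : ∀ t, ContDiffOn ℝ 1 (fun r => f r t) (Ioi 0)
  zero : ∀ r > 0, f r 0 = 0
  deriv_zero : ∀ r > 0, deriv (f r) 0 = 0
  odd : ∀ r > 0, ∀ t, f r (-t) = - f r t

/-- `V` is `C¹` on `[0, ∞)` and tends to `0` at infinity. -/
structure CondF2 (V : ℝ → ℝ) : Prop where
  contDiff : ContDiffOn ℝ 1 V (Ici 0)
  tendsto : Tendsto V atTop (𝓝 0)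

/-- Sobolev (sub)critical growth of `f_t`, uniformly in `r`: `|f_t (r, t)| ≤ C (1 + |t|^q)` with
`q` finite, and `q ≤ 4 / (n - 2)` if `n ≥ 3`. -/
def Growth (n : ℕ) (f : ℝ → ℝ → ℝ) : Prop :=
  ∃ C q : ℝ, 0 ≤ q ∧ (3 ≤ n → q ≤ 4 / ((n : ℝ) - 2)) ∧
    ∀ r > 0, ∀ t, |deriv (f r) t| ≤ C * (1 + |t| ^ q)

/-- `V = 0` and `f` does not depend on its first variable. -/
def Autonomous (V : ℝ → ℝ) (f : ℝ → ℝ → ℝ) : Prop :=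
  (∀ r > 0, V r = 0) ∧ ∀ r > 0, ∀ s > 0, ∀ t, f r t = f s t

/-- The primitive `F (r, t)` of `f (r, ·)` that vanishes at `t = 0`. -/
def Fprim (f : ℝ → ℝ → ℝ) (r t : ℝ) : ℝ := ∫ s in (0 : ℝ)..t, f r s

variable {n : ℕ} (V : ℝ → ℝ) (f : ℝ → ℝ → ℝ)

/-- The energy. -/
def energy (u : H1 n) : ℝ :=
  ∫ x, ((1 / 2) * ‖grad u x‖ ^ 2 + (1 / 2) * V ‖x‖ * fn u x ^ 2 - Fprim f ‖x‖ (fn u x))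

/-- The mass. -/
def mass (u : H1 n) : ℝ := (1 / 2) * ∫ x, fn u x ^ 2

variable (n) in
/-- The constraint set `X_c`. -/
def X (c : ℝ) : Set (H1 n) := {u | mass u = c}

variable (n) in
/-- The minimal energy `m(c)` at mass `c`. -/
def m (c : ℝ) : ℝ := sInf (energy V f '' X n c)

variable (n) in
/-- The set `S_c` of normalized ground states of mass `c`. -/
def S (c : ℝ) : Set (H1 n) := {u | u ∈ X n c ∧ energy V f u = m n V f c}

/-- `Eq_λ(u) = - Δ u + V u - λ u - f (|x|, u) = 0`, in the weak sense. -/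
def SolvesEq (lam : ℝ) (u : H1 n) : Prop :=
  ∀ φ : Eu n → ℝ, IsTest φ →
    ∫ x, (inner ℝ (grad u x) (gradient φ x) + V ‖x‖ * fn u x * φ x - lam * fn u x * φ x
      - f ‖x‖ (fn u x) * φ x) = 0

variable (n) in
/-- The set `𝒯_c` of Lagrange multipliers. -/
def T (c : ℝ) : Set ℝ := {lam | ∃ u ∈ S n V f c, SolvesEq V f lam u}

variable (n) in
/-- `λ_min(c)`. -/
def lamMin (c : ℝ) : ℝ := sInf (T n V f c)

variable (n) in
/-- `λ_max(c)`. -/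
def lamMax (c : ℝ) : ℝ := sSup (T n V f c)

variable (n) in
/-- The spectrum of the self-adjoint operator `- Δ + V` on `L²(ℝⁿ)`: `μ` is in the resolvent set
if `(- Δ + V - μ) u = g` has exactly one solution `u` for every `g ∈ L²` (`V` is bounded, so the
domain of the operator is `{u ∈ H¹ : - Δ u + V u ∈ L²}`). -/
def schrodingerSpectrum : Set ℝ :=
  {μ | ¬ ∀ g : Lp ℝ 2 (volume : Measure (Eu n)), ∃! u : H1 n,
    ∀ φ : Eu n → ℝ, IsTest φ →
      ∫ x, (inner ℝ (grad u x) (gradient φ x) + V ‖x‖ * fn u x * φ x - μ * fn u x * φ x)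
        = ∫ x, g x * φ x}

variable (n) in
/-- `Λ₀`, the infimum of the spectrum of `- Δ + V`. -/
def Lam0 : ℝ := sInf (schrodingerSpectrum n V)

/-- `L_u ψ = μ ψ` in the weak sense, where
`L_u ψ = - Δ ψ + V ψ - λ ψ - f_t (|x|, u) ψ`. -/
def LinEigen (lam : ℝ) (u : H1 n) (μ : ℝ) (ψ : H1 n) : Prop :=
  ∀ φ : Eu n → ℝ, IsTest φ →
    ∫ x, (inner ℝ (grad ψ x) (gradient φ x) + V ‖x‖ * fn ψ x * φ x - lam * fn ψ x * φ x
      - deriv (f ‖x‖) (fn u x) * fn ψ x * φ x) = ∫ x, μ * fn ψ x * φ x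

/-- `L_u` has exactly one negative eigenvalue, and it is simple. -/
def OneSimpleNegEigen (lam : ℝ) (u : H1 n) : Prop :=
  ∃ μ < 0, ∃ ψ : H1 n, ψ ≠ 0 ∧ LinEigen V f lam u μ ψ ∧
    ∀ ν < 0, ∀ χ : H1 n, χ ≠ 0 → LinEigen V f lam u ν χ → ν = μ ∧ ∃ a : ℝ, χ = a • ψ

/-- `u` is (a.e. equal to) a positive radial decreasing function. -/
def PosRadDecr (u : H1 n) : Prop :=
  ∃ g : ℝ → ℝ, (∀ r > 0, 0 < g r) ∧ AntitoneOn g (Ioi 0) ∧ ∀ᵐ x : Eu n, fn u x = g ‖x‖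

/-- `w = u (· + y)`. -/
def IsTranslate (u w : H1 n) (y : Eu n) : Prop := ∀ᵐ x : Eu n, fn w x = fn u (x + y)

/-- `w` is obtained from `u` by a translation which is trivial in non-autonomous cases. -/
def TransEquiv (u w : H1 n) : Prop :=
  ∃ y : Eu n, (y ≠ 0 → Autonomous V f) ∧ IsTranslate u w y

/-- The open interval `]c_*, c^*[`, with possibly infinite ends. -/
def massInterval (cl cu : EReal) : Set ℝ := {c : ℝ | cl < (c : EReal) ∧ (c : EReal) < cu}

variable (n) in
/-- On the set of masses `I`: `m` is finite and continuous, `S_c` is non-empty, and every element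
of `S_c` is, up to sign (and translation in autonomous cases), positive radial decreasing, solves
`Eq_λ(u) = 0` for some `λ < Λ₀ ≤ 0`, and has a linearized operator with exactly one negative
eigenvalue, which is simple. -/
structure CondA1 (I : Set ℝ) : Prop where
  bddBelow : ∀ c ∈ I, BddBelow (energy V f '' X n c)
  continuousOn : ContinuousOn (m n V f) I
  nonempty : ∀ c ∈ I, (S n V f c).Nonempty
  posRadDecr : ∀ c ∈ I, ∀ u ∈ S n V f c, ∃ w : H1 n, PosRadDecr w ∧
    (TransEquiv V f u w ∨ TransEquiv V f (-u) w)
  multiplier : ∀ c ∈ I, ∀ u ∈ S n V f c, ∃ lam : ℝ, lam < Lam0 n V ∧ Lam0 n V ≤ 0 ∧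
    SolvesEq V f lam u ∧ OneSimpleNegEigen V f lam u

variable (n) in
/-- For `c ∈ I`, any sequence with `Q (v_k) → c` and `E (v_k) → m(c)` has a subsequence that
converges in `H¹` (after translations in autonomous cases) to an element of `S_c`. -/
def CondA3 (I : Set ℝ) : Prop :=
  ∀ c ∈ I, ∀ v : ℕ → H1 n, Tendsto (fun k => mass (v k)) atTop (𝓝 c) →
    Tendsto (fun k => energy V f (v k)) atTop (𝓝 (m n V f c)) →
    ∃ σ : ℕ → ℕ, StrictMono σ ∧ ∃ w : ℕ → H1 n, (∀ k, TransEquiv V f (v (σ k)) (w k)) ∧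
      ∃ v₀ ∈ S n V f c, Tendsto w atTop (𝓝 v₀)

variable (n) in
/-- Property `(D1)` at the mass `c`. -/
def CondD1 (I : Set ℝ) (c : ℝ) : Prop :=
  ∀ (ε : ℕ → ℝ) (u : ℕ → H1 n), (∀ k, 0 < ε k) → Tendsto ε atTop (𝓝 0) →
    (∀ k, c + ε k ∈ I ∧ u k ∈ S n V f (c + ε k) ∧ PosRadDecr (u k) ∧
      SolvesEq V f (lamMin n V f (c + ε k)) (u k)) →
    ∃ σ : ℕ → ℕ, StrictMono σ ∧ ∃ uc ∈ S n V f c, SolvesEq V f (lamMin n V f c) uc ∧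
      Tendsto (fun k => u (σ k)) atTop (𝓝 uc) ∧
      limsup (fun k => ((‖(ε (σ k))⁻¹ • (u (σ k) - uc)‖ : ℝ) : EReal)) atTop < ⊤

variable (n) in
/-- Property `(D2)` at the mass `c`. -/
def CondD2 (I : Set ℝ) (c : ℝ) : Prop :=
  ∀ (ε : ℕ → ℝ) (u : ℕ → H1 n), (∀ k, 0 < ε k) → Tendsto ε atTop (𝓝 0) →
    (∀ k, c - ε k ∈ I ∧ u k ∈ S n V f (c - ε k) ∧ PosRadDecr (u k) ∧
      SolvesEq V f (lamMax n V f (c - ε k)) (u k)) →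
    ∃ σ : ℕ → ℕ, StrictMono σ ∧ ∃ uc ∈ S n V f c, SolvesEq V f (lamMax n V f c) uc ∧
      Tendsto (fun k => u (σ k)) atTop (𝓝 uc) ∧
      limsup (fun k => ((‖(ε (σ k))⁻¹ • (u (σ k) - uc)‖ : ℝ) : EReal)) atTop < ⊤

end Problem

/-- `h` is twice differentiable at `c`, in the sense used for concave functions: `h` is
differentiable at `c`, the derivative of `h`, as a function on the set of points where `h` is
differentiable, has a derivative `b` at `c`, and `h` has the second-order Taylor expansion
with coefficient `b` at `c`. -/
def TwiceDiffAt (h : ℝ → ℝ) (c : ℝ) : Prop :=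
  DifferentiableAt ℝ h c ∧ ∃ b : ℝ,
    HasDerivWithinAt (deriv h) b {x | DifferentiableAt ℝ h x} c ∧
    (fun t => h (c + t) - h c - deriv h c * t - b / 2 * t ^ 2) =o[𝓝 0] fun t => t ^ 2

end NGSS

end

open NGSS

/-! The function `m` is compared with test energies along two families of competitors.

Dilations. If `u` is a ground state of mass `c` with multiplier `λ`, then `√(t/c) u` has mass `t`,
and a first-order expansion of the energy gives `m(t) ≤ m(c) + λ (t - c) + D (t - c)²`
(`Bounds.m_le_of_mem_S`). The constant `D` depends only on bounds for `‖u‖`, `|λ|` and `1/c`, so the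
parabola can be used at `c` and, with the roles exchanged, at masses `t` near `c`. Together the two
parabolas trap the slope of `m` between a multiplier at `t` and any multiplier at `c`. By (A3)
multipliers at `t` converge, along subsequences, to a multiplier at `c` (`Bounds.exists_subseq`).
From the right this limit must be at most every element of `T`, hence the minimum, and the slope is
squeezed to it; from the left it is the maximum. This yields the extremal multipliers, the one-sided
derivatives and the one-sided limits together.

The negative eigenfunction. Let `u` have the multiplier `λ = λ_min(c)` and let `L_u ψ = μ ψ` with `μ
< 0`. Then `E(u + tψ) - m(c) - λ (Q(u + tψ) - c) = μ Q(ψ) t² + o(t²) < 0`. If `∫ u ψ ≠ 0`, the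
masses `Q(u + tψ)` fill a neighbourhood of `c`, and `m` lies strictly below a line through its graph
near `c`. If `∫ u ψ = 0`, the mass only increases, and the right derivative of `m` would be at most
`λ + μ`, although it equals `λ` (`Bounds.eventually_m_lt`). A continuous function with this local
property at every point is strictly concave (`strictConcaveOn_of_eventually_lt`).

The rest is real analysis. Strict concavity orders the multipliers strictly, so `λ_min` is
decreasing, hence differentiable almost everywhere, and at its points of differentiability `m` is
twice differentiable. Negative multipliers make `m` strictly decreasing. For the Dini derivatives, a
multiplier depends on its ground state in a Lipschitz way, and (D1), (D2) bound the ground states'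
difference quotients.

The analytic groundwork is the density of test functions in `H¹`, which allows weak equations to be
tested with `u` and `ψ`, and the Sobolev inequality, which enters through the single estimate
`Bounds.weight_le`. -/

namespace NGSS

/-! ### Elementary structure of `H¹`. -/

section Basic

variable {n : ℕ}

lemma fn_memLp (u : H1 n) : MemLp (fn u) 2 volume := Lp.memLp u.1.fst

lemma grad_memLp (u : H1 n) : MemLp (grad u) 2 volume := Lp.memLp u.1.snd

lemma isWeakGrad (u : H1 n) : IsWeakGrad (fn u) (grad u) := u.2

lemma fn_add (u v : H1 n) : fn (u + v) =ᵐ[volume] fun x => fn u x + fn v x :=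
  Lp.coeFn_add u.1.fst v.1.fst

lemma grad_add (u v : H1 n) : grad (u + v) =ᵐ[volume] fun x => grad u x + grad v x :=
  Lp.coeFn_add u.1.snd v.1.snd

lemma fn_sub (u v : H1 n) : fn (u - v) =ᵐ[volume] fun x => fn u x - fn v x :=
  Lp.coeFn_sub u.1.fst v.1.fst

lemma grad_sub (u v : H1 n) : grad (u - v) =ᵐ[volume] fun x => grad u x - grad v x :=
  Lp.coeFn_sub u.1.snd v.1.snd

lemma fn_smul (a : ℝ) (u : H1 n) : fn (a • u) =ᵐ[volume] fun x => a * fn u x :=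
  Lp.coeFn_smul a u.1.fst

lemma grad_smul (a : ℝ) (u : H1 n) : grad (a • u) =ᵐ[volume] fun x => a • grad u x :=
  Lp.coeFn_smul a u.1.snd

lemma fn_neg (u : H1 n) : fn (-u) =ᵐ[volume] fun x => - fn u x :=
  Lp.coeFn_neg u.1.fst

lemma grad_neg (u : H1 n) : grad (-u) =ᵐ[volume] fun x => - grad u x :=
  Lp.coeFn_neg u.1.snd

lemma fn_zero : fn (0 : H1 n) =ᵐ[volume] fun _ => 0 :=
  Lp.coeFn_zero ℝ 2 (volume : Measure (Eu n))

lemma integrable_fn_mul (u v : H1 n) : Integrable (fun x => fn u x * fn v x) :=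
  (fn_memLp u).integrable_mul (fn_memLp v)

lemma integrable_fn_sq (u : H1 n) : Integrable (fun x => fn u x ^ 2) :=
  (fn_memLp u).integrable_sq

lemma integrable_inner_grad (u v : H1 n) :
    Integrable (fun x => (inner ℝ (grad u x) (grad v x) : ℝ)) :=
  L2.integrable_inner u.1.snd v.1.snd

lemma integrable_grad_sq (u : H1 n) : Integrable (fun x => ‖grad u x‖ ^ 2) :=
  (grad_memLp u).integrable_norm_pow (by norm_num)

lemma inner_eq (u v : H1 n) :
    (inner ℝ u v : ℝ) = (∫ x, fn u x * fn v x) + ∫ x, (inner ℝ (grad u x) (grad v x) : ℝ) := by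
  have h : (inner ℝ u v : ℝ) = inner ℝ u.1.fst v.1.fst + inner ℝ u.1.snd v.1.snd := rfl
  rw [h, L2.inner_def, L2.inner_def]
  congr 1
  exact integral_congr_ae (Eventually.of_forall fun x => by simp [fn, mul_comm])

lemma norm_sq_eq (u : H1 n) : ‖u‖ ^ 2 = (∫ x, fn u x ^ 2) + ∫ x, ‖grad u x‖ ^ 2 := by
  rw [← real_inner_self_eq_norm_sq, inner_eq]
  simp only [real_inner_self_eq_norm_sq, ← sq]

lemma integral_fn_sq_le (u : H1 n) : ∫ x, fn u x ^ 2 ≤ ‖u‖ ^ 2 := by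
  rw [norm_sq_eq]
  linarith [integral_nonneg (μ := volume) (f := fun x => ‖grad u x‖ ^ 2) fun x => by positivity]

lemma integral_grad_sq_le (u : H1 n) : ∫ x, ‖grad u x‖ ^ 2 ≤ ‖u‖ ^ 2 := by
  rw [norm_sq_eq]
  linarith [integral_nonneg (μ := volume) (f := fun x => fn u x ^ 2) fun x => by positivity]

/-- Weak gradients are unique. -/
lemma IsWeakGrad.unique {u : Eu n → ℝ} {g h : Eu n → Eu n} (hg : IsWeakGrad u g)
    (hh : IsWeakGrad u h) (mg : LocallyIntegrable g) (mh : LocallyIntegrable h) :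
    g =ᵐ[volume] h := by
  refine ae_eq_of_integral_contDiff_smul_eq mg mh fun φ h1 h2 => ?_
  have := (hg φ ⟨h1, h2⟩).symm.trans (hh φ ⟨h1, h2⟩)
  simpa using this

/-- Weak gradients are unique, so the second component carries no further information. -/
lemma H1.ext {u v : H1 n} (h : fn u =ᵐ[volume] fn v) : u = v := by
  have h1 : u.1.fst = v.1.fst := Lp.ext h
  have hw : IsWeakGrad (fn u) (grad v) := by
    intro φ hφ
    rw [← isWeakGrad v φ hφ]
    refine integral_congr_ae ?_
    filter_upwards [h] with x hx
    rw [hx]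
  have h2 : u.1.snd = v.1.snd := Lp.ext <| (isWeakGrad u).unique hw
    ((grad_memLp u).locallyIntegrable (by norm_num)) ((grad_memLp v).locallyIntegrable (by norm_num))
  refine Subtype.ext ?_
  exact WithLp.ofLp_injective 2 (Prod.ext h1 h2)

/-- The element of `H¹` given by an `L²` function and its `L²` weak gradient. -/
noncomputable def H1.mk {v : Eu n → ℝ} {g : Eu n → Eu n} (hv : MemLp v 2 volume)
    (hg : MemLp g 2 volume) (h : IsWeakGrad v g) : H1 n :=
  ⟨WithLp.toLp 2 (hv.toLp v, hg.toLp g), by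
    intro φ hφ
    have h1 := hv.coeFn_toLp
    have h2 := hg.coeFn_toLp
    have e1 : ∫ x, (hv.toLp v) x • gradient φ x = ∫ x, v x • gradient φ x := by
      refine integral_congr_ae ?_
      filter_upwards [h1] with x hx
      rw [hx]
    have e2 : ∫ x, φ x • (hg.toLp g) x = ∫ x, φ x • g x := by
      refine integral_congr_ae ?_
      filter_upwards [h2] with x hx
      rw [hx]
    exact e1.trans ((h φ hφ).trans (congrArg Neg.neg e2.symm))⟩

lemma H1.fn_mk {v : Eu n → ℝ} {g : Eu n → Eu n} (hv : MemLp v 2 volume)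
    (hg : MemLp g 2 volume) (h : IsWeakGrad v g) : fn (H1.mk hv hg h) =ᵐ[volume] v :=
  hv.coeFn_toLp

lemma H1.grad_mk {v : Eu n → ℝ} {g : Eu n → Eu n} (hv : MemLp v 2 volume)
    (hg : MemLp g 2 volume) (h : IsWeakGrad v g) : grad (H1.mk hv hg h) =ᵐ[volume] g :=
  hg.coeFn_toLp

lemma inner_gradient (φ : Eu n → ℝ) (x v : Eu n) : inner ℝ v (gradient φ x) = fderiv ℝ φ x v := by
  rw [real_inner_comm, gradient, InnerProductSpace.toDual_symm_apply]

lemma IsTest.contDiff_one {φ : Eu n → ℝ} (h : IsTest φ) : ContDiff ℝ 1 φ :=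
  h.1.of_le (by exact_mod_cast le_top)

lemma IsTest.differentiable {φ : Eu n → ℝ} (h : IsTest φ) : Differentiable ℝ φ :=
  h.contDiff_one.differentiable (by norm_num)

lemma IsTest.hasCompactSupport_gradient {φ : Eu n → ℝ} (h : IsTest φ) :
    HasCompactSupport (gradient φ) :=
  (h.2.fderiv (𝕜 := ℝ)).comp_left
    (g := (InnerProductSpace.toDual ℝ (Eu n)).symm) (map_zero _)

lemma gradient_mul {φ ψ : Eu n → ℝ} (hφ : Differentiable ℝ φ) (hψ : Differentiable ℝ ψ)
    (x : Eu n) : gradient (fun y => φ y * ψ y) x = φ x • gradient ψ x + ψ x • gradient φ x := by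
  refine ext_inner_left ℝ fun v => ?_
  rw [inner_add_right, inner_smul_right, inner_smul_right, inner_gradient, inner_gradient,
    inner_gradient, fderiv_fun_mul (hφ x) (hψ x)]
  simp

/-- Integration by parts for smooth functions. -/
lemma IsTest.isWeakGrad {φ : Eu n → ℝ} (h : IsTest φ) : IsWeakGrad φ (gradient φ) := by
  intro ψ hψ
  have i1 : Integrable (fun x => φ x • gradient ψ x) :=
    (h.1.continuous.smul hψ.continuous_gradient).integrable_of_hasCompactSupport
      h.2.smul_right
  have i2 : Integrable (fun x => ψ x • gradient φ x) :=
    (hψ.1.continuous.smul h.continuous_gradient).integrable_of_hasCompactSupport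
      hψ.2.smul_right
  refine ext_inner_left ℝ fun v => ?_
  rw [inner_neg_right, ← integral_inner i1, ← integral_inner i2]
  simp only [inner_smul_right, inner_gradient]
  have key := integral_mul_fderiv_eq_neg_fderiv_mul_of_integrable (μ := (volume : Measure (Eu n)))
    (f := φ) (g := ψ) (v := v) ?_ ?_ ?_
    (fun x _ => h.differentiable x) (fun x _ => hψ.differentiable x)
  · rw [key]
    simp only [mul_comm]
  · have := i2.const_inner (𝕜 := ℝ) v
    simpa [inner_smul_right, inner_gradient, mul_comm] using this
  · have := i1.const_inner (𝕜 := ℝ) v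
    simpa [inner_smul_right, inner_gradient] using this
  · exact (h.1.continuous.mul hψ.1.continuous).integrable_of_hasCompactSupport h.2.mul_right

/-- Test functions as elements of `H¹`. -/
noncomputable def IsTest.toH1 {φ : Eu n → ℝ} (h : IsTest φ) : H1 n :=
  H1.mk h.memLp h.memLp_gradient h.isWeakGrad

lemma IsTest.fn_toH1 {φ : Eu n → ℝ} (h : IsTest φ) : fn h.toH1 =ᵐ[volume] φ := H1.fn_mk _ _ _

lemma IsTest.grad_toH1 {φ : Eu n → ℝ} (h : IsTest φ) : grad h.toH1 =ᵐ[volume] gradient φ :=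
  H1.grad_mk _ _ _

end Basic

/-! ### Mollification, truncation and density of test functions in `H¹`. -/

section Density

open scoped Convolution ENNReal
open ContinuousLinearMap (lsmul)

variable {n : ℕ} {G : Type*} [NormedAddCommGroup G]

lemma norm_le_of_eLpNorm_le {u : H1 n} {ε : ℝ} (hε : 0 ≤ ε)
    (h1 : eLpNorm (fn u) 2 volume ≤ ENNReal.ofReal ε)
    (h2 : eLpNorm (grad u) 2 volume ≤ ENNReal.ofReal ε) : ‖u‖ ≤ 2 * ε := by
  have e : ‖u‖ ^ 2 = ‖u.1.fst‖ ^ 2 + ‖u.1.snd‖ ^ 2 := WithLp.prod_norm_sq_eq_of_L2 u.1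
  have n1 : ‖u.1.fst‖ ≤ ε := by
    rw [Lp.norm_def]; exact ENNReal.toReal_le_of_le_ofReal hε h1
  have n2 : ‖u.1.snd‖ ≤ ε := by
    rw [Lp.norm_def]; exact ENNReal.toReal_le_of_le_ofReal hε h2
  refine abs_le_of_sq_le_sq' ?_ (by positivity) |>.2
  nlinarith [norm_nonneg u.1.fst, norm_nonneg u.1.snd]

/-- Continuity of translations in `L²`. -/
lemma exists_eLpNorm_translate_sub_le {v : Eu n → G} (hv : MemLp v 2 volume) {ε : ℝ≥0∞}
    (hε : 0 < ε) : ∃ δ > 0, ∀ y : Eu n, ‖y‖ < δ →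
      eLpNorm (fun x => v (x - y) - v x) 2 volume ≤ ε := by
  have : Fact ((2 : ℝ≥0∞) ≠ ⊤) := ⟨by simp⟩
  have hc : Continuous fun y : Eu n => (DomAddAct.mk y) +ᵥ hv.toLp v :=
    (continuous_id.vadd continuous_const).comp DomAddAct.continuous_mk
  have ht : Tendsto (fun y : Eu n => (DomAddAct.mk (-y)) +ᵥ hv.toLp v) (𝓝 0)
      (𝓝 (hv.toLp v)) := by
    have := (hc.comp continuous_neg).tendsto (0 : Eu n)
    simpa [Function.comp_def] using this
  have h2 := (EMetric.tendsto_nhds.mp ht) ε hε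
  obtain ⟨δ, hδ, h⟩ := Metric.eventually_nhds_iff.mp h2
  refine ⟨δ, hδ, fun y hy => ?_⟩
  have h3 := (h (y := y) (by simpa using hy)).le
  rw [Lp.edist_def] at h3
  refine le_of_eq_of_le (eLpNorm_congr_ae ?_) h3
  have a1 := hv.coeFn_toLp
  have a2 := DomAddAct.vadd_Lp_ae_eq (DomAddAct.mk (-y)) (hv.toLp v)
  have a3 : (fun x => hv.toLp v (-y + x)) =ᵐ[volume] fun x => v (-y + x) :=
    (measurePreserving_add_left volume (-y)).quasiMeasurePreserving.ae_eq_comp a1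
  filter_upwards [a1, a2, a3] with x h1 h2 h3
  simp only [Pi.sub_apply, h2, h1]
  simp only [Equiv.symm_apply_apply, vadd_eq_add, h3]
  rw [neg_add_eq_sub]

/-- Cauchy–Schwarz against the constant `1`. It is applied to the mollifier, viewed as a probability
density. -/
lemma lintegral_sq_le_of_prob {α : Type*} [MeasurableSpace α] {ν : Measure α}
    [IsProbabilityMeasure ν] {F : α → ℝ≥0∞} (hF : AEMeasurable F ν) :
    (∫⁻ x, F x ∂ν) ^ 2 ≤ ∫⁻ x, F x ^ 2 ∂ν := by
  have := ENNReal.lintegral_mul_le_Lp_mul_Lq ν Real.HolderConjugate.two_two hF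
    (aemeasurable_const (b := (1 : ℝ≥0∞)))
  simp only [Pi.mul_apply, mul_one, ENNReal.one_rpow, lintegral_const, measure_univ] at this
  calc _ ≤ ((∫⁻ a, F a ^ (2 : ℝ) ∂ν) ^ (1 / (2 : ℝ))) ^ 2 := by gcongr
    _ = _ := by
      rw [← ENNReal.rpow_natCast, ← ENNReal.rpow_mul]
      norm_num

/-- Mollification converges in `L²`. -/
lemma eLpNorm_normed_convolution_sub_le [NormedSpace ℝ G] [CompleteSpace G] {v : Eu n → G} (hv : MemLp v 2 volume)
    {ε : ℝ≥0∞} (hε : 0 < ε) : ∃ δ > 0, ∀ ρ : ContDiffBump (0 : Eu n), ρ.rOut < δ →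
      eLpNorm (fun x => (ρ.normed volume ⋆[lsmul ℝ ℝ, volume] v) x - v x) 2 volume ≤ ε := by
  obtain ⟨δ, hδ, h⟩ := exists_eLpNorm_translate_sub_le hv hε
  refine ⟨δ, hδ, fun ρ hρ => ?_⟩
  set r : Eu n → ℝ := ρ.normed volume with hr
  have rc : Continuous r := ρ.continuous_normed
  set ν : Measure (Eu n) := volume.withDensity fun t => ‖r t‖ₑ with hν
  have rm : Measurable fun t => ‖r t‖ₑ := rc.measurable.enorm
  have : IsProbabilityMeasure ν := by
    constructor
    rw [hν, withDensity_apply _ MeasurableSet.univ, Measure.restrict_univ]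
    have : ∫⁻ x, ‖r x‖ₑ = ENNReal.ofReal (∫ x, r x) := by
      rw [ofReal_integral_eq_lintegral_ofReal ρ.integrable_normed
        (Eventually.of_forall ρ.nonneg_normed)]
      refine lintegral_congr fun x => ?_
      rw [Real.enorm_of_nonneg (ρ.nonneg_normed x)]
    rw [this, ρ.integral_normed]; simp
  have hli : LocallyIntegrable v volume := hv.locallyIntegrable (by norm_num)
  have hm2 : AEStronglyMeasurable (fun p : Eu n × Eu n => v (p.1 - p.2) - v p.1)
      (volume.prod volume) := by
    refine AEStronglyMeasurable.sub ?_ ?_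
    · exact hv.1.comp_quasiMeasurePreserving (quasiMeasurePreserving_sub_of_right_invariant _ _)
    · exact hv.1.comp_quasiMeasurePreserving Measure.quasiMeasurePreserving_fst
  have hpt : ∀ x, AEStronglyMeasurable (fun t => v (x - t) - v x) volume := fun x =>
    (hv.1.comp_quasiMeasurePreserving
      (quasiMeasurePreserving_sub_left_of_right_invariant _ x)).sub aestronglyMeasurable_const
  -- The error is an average of translation errors, so its square is at most the average of their
  -- squares. After Tonelli only translations `t` in the support of the mollifier occur, and each of
  -- them costs at most `ε` in `L²`.
  have key : ∀ x, ‖(r ⋆[lsmul ℝ ℝ, volume] v) x - v x‖ₑ ^ 2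
      ≤ ∫⁻ t, ‖r t‖ₑ * ‖v (x - t) - v x‖ₑ ^ 2 := by
    intro x
    have e1 : (r ⋆[lsmul ℝ ℝ, volume] v) x - v x = ∫ t, r t • (v (x - t) - v x) := by
      have hce : ConvolutionExistsAt r v x (lsmul ℝ ℝ) volume :=
        ρ.hasCompactSupport_normed.convolutionExists_left _ rc hli x
      have i1 : Integrable (fun t => r t • v (x - t)) := hce
      have i2 : Integrable (fun t => r t • v x) := ρ.integrable_normed.smul_const _
      simp_rw [smul_sub]
      rw [integral_sub i1 i2, hr, ρ.integral_normed_smul volume (v x)]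
      rfl
    have e2 : ‖∫ t, r t • (v (x - t) - v x)‖ₑ ≤ ∫⁻ t, ‖v (x - t) - v x‖ₑ ∂ν := by
      refine (enorm_integral_le_lintegral_enorm _).trans (le_of_eq ?_)
      rw [hν, lintegral_withDensity_eq_lintegral_mul₀ rm.aemeasurable (hpt x).enorm]
      simp only [enorm_smul, Pi.mul_apply]
    rw [e1]
    calc _ ≤ (∫⁻ t, ‖v (x - t) - v x‖ₑ ∂ν) ^ 2 := by gcongr
      _ ≤ ∫⁻ t, ‖v (x - t) - v x‖ₑ ^ 2 ∂ν := lintegral_sq_le_of_prob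
          ((hpt x).enorm.mono_ac (withDensity_absolutelyContinuous _ _))
      _ = _ := by
        rw [hν, lintegral_withDensity_eq_lintegral_mul₀ rm.aemeasurable ((hpt x).enorm.pow_const 2)]
        rfl
  have sqform : ∀ w : Eu n → G, eLpNorm w 2 volume ^ 2 = ∫⁻ x, ‖w x‖ₑ ^ 2 := by
    intro w
    have := eLpNorm_nnreal_pow_eq_lintegral (f := w) (μ := (volume : Measure (Eu n)))
      (p := 2) (by norm_num)
    simpa using this
  have main : eLpNorm (fun x => (r ⋆[lsmul ℝ ℝ, volume] v) x - v x) 2 volume ^ 2 ≤ ε ^ 2 := by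
    rw [sqform]
    calc _ ≤ ∫⁻ x, ∫⁻ t, ‖r t‖ₑ * ‖v (x - t) - v x‖ₑ ^ 2 := lintegral_mono key
      _ = ∫⁻ t, ∫⁻ x, ‖r t‖ₑ * ‖v (x - t) - v x‖ₑ ^ 2 := by
        refine lintegral_lintegral_swap ?_
        exact ((rm.comp measurable_snd).aemeasurable).mul (hm2.enorm.pow_const 2)
      _ ≤ ∫⁻ t, ‖r t‖ₑ * ε ^ 2 := by
        refine lintegral_mono fun t => ?_
        dsimp only
        rw [lintegral_const_mul' _ _ enorm_ne_top]
        by_cases ht : r t = 0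
        · simp [ht]
        · have : t ∈ Metric.ball (0 : Eu n) ρ.rOut := by
            rw [← ρ.support_normed_eq (μ := volume)]; exact ht
          rw [← sqform fun x => v (x - t) - v x]
          gcongr
          exact h t ((mem_ball_zero_iff.mp this).trans hρ)
      _ = ε ^ 2 := by
        rw [lintegral_mul_const _ rm]
        have : ν univ = 1 := measure_univ
        rw [hν, withDensity_apply _ MeasurableSet.univ, Measure.restrict_univ] at this
        rw [this, one_mul]
  exact (ENNReal.pow_le_pow_left_iff two_ne_zero).mp main

lemma IsTest.comp_sub_left {ρ : Eu n → ℝ} (h : IsTest ρ) (x : Eu n) :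
    IsTest fun y => ρ (x - y) :=
  ⟨h.1.comp (contDiff_const.sub contDiff_id),
    h.2.comp_homeomorph (Homeomorph.subLeft x)⟩

/-- The gradient of a mollification is the mollification of the weak gradient. -/
lemma gradient_convolution {v : Eu n → ℝ} {g : Eu n → Eu n} (hv : MemLp v 2 volume)
    (hg : MemLp g 2 volume) (hw : IsWeakGrad v g) {r : Eu n → ℝ} (hr : IsTest r) :
    gradient (r ⋆[lsmul ℝ ℝ, volume] v) = r ⋆[lsmul ℝ ℝ, volume] g := by
  have vli : LocallyIntegrable v volume := hv.locallyIntegrable (by norm_num)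
  have gli : LocallyIntegrable g volume := hg.locallyIntegrable (by norm_num)
  funext x
  refine ext_inner_left ℝ fun e => ?_
  have hx := hr.comp_sub_left x
  have hgr : ∀ y, gradient (fun y => r (x - y)) y = - gradient r (x - y) := by
    intro y
    refine ext_inner_left ℝ fun e => ?_
    rw [inner_neg_right, inner_gradient, inner_gradient]
    have h1 : HasFDerivAt (fun y => r (x - y))
        ((fderiv ℝ r (x - y)).comp (-ContinuousLinearMap.id ℝ (Eu n))) y :=
      (hr.differentiable (x - y)).hasFDerivAt.comp y ((hasFDerivAt_id y).const_sub x)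
    rw [h1.fderiv]; simp
  have i1 : Integrable (fun y => v y • gradient (fun y => r (x - y)) y) :=
    memLp_one_iff_integrable.mp (hx.memLp_gradient.smul hv)
  have i2 : Integrable (fun y => r (x - y) • g y) := memLp_one_iff_integrable.mp (hg.smul hx.memLp)
  rw [inner_gradient,
    (hr.2.hasFDerivAt_convolution_left (lsmul ℝ ℝ) hr.contDiff_one vli x).fderiv]
  have hce := (hr.2.fderiv (𝕜 := ℝ)).convolutionExists_left
    (ContinuousLinearMap.precompL (Eu n) (lsmul ℝ ℝ : ℝ →L[ℝ] ℝ →L[ℝ] ℝ))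
    (hr.contDiff_one.continuous_fderiv (by norm_num)) vli x
  rw [convolution_eq_swap, convolution_eq_swap,
    ContinuousLinearMap.integral_apply (hce.integrable_swap)]
  simp only [ContinuousLinearMap.precompL_apply]
  -- The weak gradient is tested with `y ↦ r (x - y)`; the sign of the integration by parts cancels
  -- the sign in `hgr`.
  have e1 := congrArg (fun z => (inner ℝ e z : ℝ)) (hw _ hx)
  simp only [inner_neg_right] at e1
  rw [← integral_inner i1] at e1
  simp only [ContinuousLinearMap.lsmul_apply]
  rw [← neg_eq_iff_eq_neg] at e1
  rw [← e1, ← integral_neg]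
  refine integral_congr_ae (Eventually.of_forall fun y => ?_)
  simp only [hgr, smul_neg, inner_neg_right, neg_neg, inner_smul_right, inner_gradient, smul_eq_mul]
  ring

/-- Compactly supported elements of `H¹` are limits of test functions. -/
lemma exists_isTest_norm_sub_le_of_hasCompactSupport {u : H1 n} {v : Eu n → ℝ}
    (huv : fn u =ᵐ[volume] v) (hc : HasCompactSupport v) {ε : ℝ} (hε : 0 < ε) :
    ∃ (φ : Eu n → ℝ) (h : IsTest φ), ‖h.toH1 - u‖ ≤ 2 * ε := by
  have hv : MemLp v 2 volume := (memLp_congr_ae huv).mp (fn_memLp u)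
  have hw : IsWeakGrad v (grad u) := by
    intro φ hφ
    rw [← isWeakGrad u φ hφ]
    refine integral_congr_ae ?_
    filter_upwards [huv] with x hx
    rw [hx]
  obtain ⟨δ₁, hδ₁, h1⟩ := eLpNorm_normed_convolution_sub_le hv (ENNReal.ofReal_pos.mpr hε)
  obtain ⟨δ₂, hδ₂, h2⟩ := eLpNorm_normed_convolution_sub_le (grad_memLp u)
    (ENNReal.ofReal_pos.mpr hε)
  have hδ : 0 < min δ₁ δ₂ := lt_min hδ₁ hδ₂
  let ρ : ContDiffBump (0 : Eu n) := ⟨min δ₁ δ₂ / 4, min δ₁ δ₂ / 2, by positivity, by linarith⟩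
  have hρ : ρ.rOut < min δ₁ δ₂ := half_lt_self hδ
  have hr : IsTest (ρ.normed volume) := ⟨ρ.contDiff_normed, ρ.hasCompactSupport_normed⟩
  have ht : IsTest (ρ.normed volume ⋆[lsmul ℝ ℝ, volume] v) :=
    ⟨hr.2.contDiff_convolution_left _ hr.1 (hv.locallyIntegrable (by norm_num)),
      hr.2.convolution _ hc⟩
  refine ⟨_, ht, norm_le_of_eLpNorm_le hε.le ?_ ?_⟩
  · refine le_of_eq_of_le (eLpNorm_congr_ae ?_) (h1 ρ (hρ.trans_le (min_le_left _ _)))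
    filter_upwards [fn_sub ht.toH1 u, ht.fn_toH1, huv] with x a b c
    rw [a, b, c]
  · refine le_of_eq_of_le (eLpNorm_congr_ae ?_) (h2 ρ (hρ.trans_le (min_le_right _ _)))
    filter_upwards [grad_sub ht.toH1 u, ht.grad_toH1] with x a b
    rw [a, b, gradient_convolution hv (grad_memLp u) hw hr]

/-- Product of an element of `H¹` and a test function. -/
lemma isWeakGrad_mul (u : H1 n) {χ : Eu n → ℝ} (hχ : IsTest χ) :
    IsWeakGrad (fun x => χ x * fn u x) (fun x => χ x • grad u x + fn u x • gradient χ x) := by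
  intro φ hφ
  have ht : IsTest fun x => χ x * φ x := ⟨hχ.1.mul hφ.1, hχ.2.mul_right⟩
  have := isWeakGrad u _ ht
  have i1 : Integrable fun x => fn u x • (χ x • gradient φ x) := by
    refine memLp_one_iff_integrable.mp (MemLp.smul (p := 2) (q := 2) ?_ (fn_memLp u))
    exact (hχ.1.continuous.smul hφ.continuous_gradient).memLp_of_hasCompactSupport hχ.2.smul_right
  have i2 : Integrable fun x => fn u x • (φ x • gradient χ x) := by
    refine memLp_one_iff_integrable.mp (MemLp.smul (p := 2) (q := 2) ?_ (fn_memLp u))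
    exact (hφ.1.continuous.smul hχ.continuous_gradient).memLp_of_hasCompactSupport hφ.2.smul_right
  have i3 : Integrable fun x => (χ x * φ x) • grad u x :=
    memLp_one_iff_integrable.mp (MemLp.smul (p := 2) (q := 2) (grad_memLp u) ht.memLp)
  simp only [gradient_mul hχ.differentiable hφ.differentiable, smul_add] at this
  rw [integral_add i1 i2] at this
  have e1 : ∫ x, (χ x * fn u x) • gradient φ x = ∫ x, fn u x • (χ x • gradient φ x) :=
    integral_congr_ae (Eventually.of_forall fun x => by simp only [smul_smul, mul_comm])
  have e2 : ∫ x, φ x • (χ x • grad u x + fn u x • gradient χ x)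
      = (∫ x, (χ x * φ x) • grad u x) + ∫ x, fn u x • (φ x • gradient χ x) := by
    rw [← integral_add i3 i2]
    refine integral_congr_ae (Eventually.of_forall fun x => ?_)
    simp only [smul_add, smul_smul]
    rw [mul_comm (φ x), mul_comm (φ x)]
  rw [e1, e2, eq_sub_of_add_eq this]
  abel

lemma memLp_mul_test (u : H1 n) {χ : Eu n → ℝ} (hχ : IsTest χ) :
    MemLp (fun x => χ x * fn u x) 2 volume := by
  have : MemLp χ ⊤ volume := hχ.1.continuous.memLp_of_hasCompactSupport hχ.2
  exact (fn_memLp u).mul this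

lemma memLp_grad_mul_test (u : H1 n) {χ : Eu n → ℝ} (hχ : IsTest χ) :
    MemLp (fun x => χ x • grad u x + fn u x • gradient χ x) 2 volume := by
  have h1 : MemLp χ ⊤ volume := hχ.1.continuous.memLp_of_hasCompactSupport hχ.2
  have h2 : MemLp (gradient χ) ⊤ volume :=
    hχ.continuous_gradient.memLp_of_hasCompactSupport hχ.hasCompactSupport_gradient
  exact ((grad_memLp u).smul h1).add (h2.smul (fn_memLp u))

/-- Truncation converges in `H¹`. -/
lemma exists_hasCompactSupport_norm_sub_lt (u : H1 n) {ε : ℝ} (hε : 0 < ε) :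
    ∃ (w : H1 n) (v : Eu n → ℝ), fn w =ᵐ[volume] v ∧ HasCompactSupport v ∧ ‖w - u‖ < ε := by
  let χ : ContDiffBump (0 : Eu n) := ⟨1, 2, one_pos, one_lt_two⟩
  have hχ : IsTest (χ : Eu n → ℝ) := ⟨χ.contDiff, χ.hasCompactSupport⟩
  obtain ⟨C, hC⟩ := hχ.continuous_gradient.bounded_above_of_compact_support
    hχ.hasCompactSupport_gradient
  have hC0 : 0 ≤ C := (norm_nonneg _).trans (hC 0)
  let s : ℕ → ℝ := fun k => ((k : ℝ) + 1)⁻¹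
  have s0 : ∀ k, 0 < s k := fun k => by positivity
  have s1 : ∀ k, s k ≤ 1 := fun k => inv_le_one_of_one_le₀ (by simp)
  have st : Tendsto s atTop (𝓝 0) := by
    simpa [s] using tendsto_one_div_add_atTop_nhds_zero_nat (𝕜 := ℝ)
  -- Cutoffs at radius of order `k`. Their gradients carry a factor `s k`, so the extra term of the
  -- product rule disappears in the limit.
  let ψ : ℕ → Eu n → ℝ := fun k x => χ (s k • x)
  have hψ : ∀ k, IsTest (ψ k) := fun k =>
    ⟨χ.contDiff.comp (contDiff_const_smul (s k)),
      χ.hasCompactSupport.comp_homeomorph (Homeomorph.smulOfNeZero (s k) (s0 k).ne')⟩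
  have hgr : ∀ k x, gradient (ψ k) x = s k • gradient χ (s k • x) := by
    intro k x
    refine ext_inner_left ℝ fun e => ?_
    rw [inner_smul_right, inner_gradient, inner_gradient]
    have h1 : HasFDerivAt (ψ k) ((fderiv ℝ χ (s k • x)).comp (s k • ContinuousLinearMap.id ℝ (Eu n)))
        x := (hχ.differentiable (s k • x)).hasFDerivAt.comp x ((hasFDerivAt_id x).const_smul (s k))
    rw [h1.fderiv]; simp
  have hψ1 : ∀ x, Tendsto (fun k => ψ k x) atTop (𝓝 1) := by
    intro x
    have := (χ.continuous.tendsto 0).comp ((st.smul_const x).trans (by simp))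
    simpa [Function.comp_def, ψ, χ.one_of_mem_closedBall
      (Metric.mem_closedBall_self zero_le_one)] using this
  have hgr0 : ∀ x, Tendsto (fun k => gradient (ψ k) x) atTop (𝓝 0) := by
    intro x
    refine squeeze_zero_norm (a := fun k => s k * C) (fun k => ?_) (by simpa using st.mul_const C)
    rw [hgr, norm_smul, Real.norm_of_nonneg (s0 k).le]
    exact mul_le_mul_of_nonneg_left (hC _) (s0 k).le
  have hb : ∀ k x, |ψ k x - 1| ≤ 1 := fun k x => by
    rw [abs_le]; constructor <;> linarith [χ.nonneg (x := s k • x), χ.le_one (x := s k • x)]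
  have hgb : ∀ k x, ‖gradient (ψ k) x‖ ≤ C := fun k x => by
    rw [hgr, norm_smul, Real.norm_of_nonneg (s0 k).le]
    nlinarith [hC (s k • x), s1 k, s0 k, norm_nonneg (gradient χ (s k • x))]
  let w : ℕ → H1 n := fun k =>
    H1.mk (memLp_mul_test u (hψ k)) (memLp_grad_mul_test u (hψ k)) (isWeakGrad_mul u (hψ k))
  have hw1 : ∀ k, fn (w k - u) =ᵐ[volume] fun x => (ψ k x - 1) * fn u x := by
    intro k
    filter_upwards [fn_sub (w k) u, H1.fn_mk (memLp_mul_test u (hψ k))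
      (memLp_grad_mul_test u (hψ k)) (isWeakGrad_mul u (hψ k))] with x a b
    rw [a, b]; ring
  have hw2 : ∀ k, grad (w k - u) =ᵐ[volume]
      fun x => (ψ k x - 1) • grad u x + fn u x • gradient (ψ k) x := by
    intro k
    filter_upwards [grad_sub (w k) u, H1.grad_mk (memLp_mul_test u (hψ k))
      (memLp_grad_mul_test u (hψ k)) (isWeakGrad_mul u (hψ k))] with x a b
    rw [a, b, sub_smul, one_smul]; abel
  have t1 : Tendsto (fun k => ∫ x, fn (w k - u) x ^ 2) atTop (𝓝 (∫ _ : Eu n, (0 : ℝ))) := by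
    refine tendsto_integral_of_dominated_convergence (fun x => fn u x ^ 2)
      (fun k => (integrable_fn_sq _).1) (integrable_fn_sq u) (fun k => ?_) ?_
    · filter_upwards [hw1 k] with x hx
      rw [hx, mul_pow, Real.norm_of_nonneg (by positivity)]
      have := sq_le_one_iff_abs_le_one _ |>.mpr (hb k x)
      nlinarith [sq_nonneg (fn u x)]
    · filter_upwards [ae_all_iff.mpr hw1] with x hx
      simp only [hx]
      have := (((hψ1 x).sub_const 1).mul_const (fn u x)).pow 2
      simpa using this
  have t2 : Tendsto (fun k => ∫ x, ‖grad (w k - u) x‖ ^ 2) atTop (𝓝 (∫ _ : Eu n, (0 : ℝ))) := by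
    refine tendsto_integral_of_dominated_convergence
      (fun x => 2 * ‖grad u x‖ ^ 2 + 2 * C ^ 2 * fn u x ^ 2)
      (fun k => (integrable_grad_sq _).1)
      (((integrable_grad_sq u).const_mul 2).add ((integrable_fn_sq u).const_mul _)) (fun k => ?_) ?_
    · filter_upwards [hw2 k] with x hx
      rw [hx, Real.norm_of_nonneg (by positivity)]
      have h1 : ‖(ψ k x - 1) • grad u x + fn u x • gradient (ψ k) x‖ ≤
          ‖grad u x‖ + C * |fn u x| := by
        refine (norm_add_le _ _).trans ?_
        rw [norm_smul, norm_smul, Real.norm_eq_abs, Real.norm_eq_abs]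
        nlinarith [hb k x, hgb k x, norm_nonneg (grad u x), abs_nonneg (fn u x)]
      have h2 := pow_le_pow_left₀ (norm_nonneg _) h1 2
      nlinarith [sq_nonneg (‖grad u x‖ - C * |fn u x|), sq_abs (fn u x)]
    · filter_upwards [ae_all_iff.mpr hw2] with x hx
      simp only [hx]
      have := ((((hψ1 x).sub_const 1).smul_const (grad u x)).add
        ((hgr0 x).const_smul (fn u x))).norm.pow 2
      simpa using this
  have t3 : Tendsto (fun k => ‖w k - u‖ ^ 2) atTop (𝓝 0) := by
    simp only [norm_sq_eq]
    simpa using t1.add t2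
  obtain ⟨k, hk⟩ := (t3.eventually_lt_const (pow_pos hε 2)).exists
  exact ⟨w k, _, H1.fn_mk _ _ _, (hψ k).2.mul_right, lt_of_pow_lt_pow_left₀ 2 hε.le hk⟩

/-- Test functions are dense in `H¹`. -/
theorem exists_isTest_norm_sub_lt (u : H1 n) {ε : ℝ} (hε : 0 < ε) :
    ∃ (φ : Eu n → ℝ) (h : IsTest φ), ‖h.toH1 - u‖ < ε := by
  obtain ⟨w, v, h1, h2, h3⟩ := exists_hasCompactSupport_norm_sub_lt u (half_pos hε)
  obtain ⟨φ, h, h4⟩ := exists_isTest_norm_sub_le_of_hasCompactSupport h1 h2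
    (show 0 < ε / 4 by positivity)
  refine ⟨φ, h, ?_⟩
  have := norm_sub_le_norm_sub_add_norm_sub h.toH1 w u
  linarith

theorem exists_seq_isTest_tendsto (u : H1 n) :
    ∃ (φ : ℕ → Eu n → ℝ) (h : ∀ k, IsTest (φ k)), Tendsto (fun k => (h k).toH1) atTop (𝓝 u) := by
  choose φ h hφ using fun k : ℕ => exists_isTest_norm_sub_lt u (Nat.one_div_pos_of_nat (α := ℝ) (n := k))
  exact ⟨φ, h, tendsto_iff_norm_sub_tendsto_zero.mpr <| squeeze_zero (fun _ => norm_nonneg _)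
    (fun k => (hφ k).le) tendsto_one_div_add_atTop_nhds_zero_nat⟩

end Density

/-! ### The Sobolev inequality. -/

section Sobolev

open scoped ENNReal NNReal

variable {n : ℕ}

lemma norm_gradient (φ : Eu n → ℝ) (x : Eu n) : ‖gradient φ x‖ = ‖fderiv ℝ φ x‖ :=
  LinearIsometryEquiv.norm_map _ _

lemma enorm_gradient (φ : Eu n → ℝ) (x : Eu n) : ‖gradient φ x‖ₑ = ‖fderiv ℝ φ x‖ₑ := by
  rw [← ofReal_norm, ← ofReal_norm, norm_gradient]

lemma lintegral_enorm_sq_eq {G : Type*} [NormedAddCommGroup G] {w : Eu n → G}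
    (hw : MemLp w 2 volume) : ∫⁻ x, ‖w x‖ₑ ^ 2 = ENNReal.ofReal (∫ x, ‖w x‖ ^ 2) := by
  rw [ofReal_integral_eq_lintegral_ofReal (hw.integrable_norm_pow (by norm_num))
    (Eventually.of_forall fun x => by positivity)]
  refine lintegral_congr fun x => ?_
  rw [ENNReal.ofReal_pow (norm_nonneg _), ofReal_norm]

lemma IsTest.norm_sq_toH1 {φ : Eu n → ℝ} (h : IsTest φ) :
    ‖h.toH1‖ ^ 2 = (∫ x, ‖φ x‖ ^ 2) + ∫ x, ‖gradient φ x‖ ^ 2 := by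
  rw [norm_sq_eq]
  congr 1
  · refine integral_congr_ae ?_
    filter_upwards [h.fn_toH1] with x hx
    rw [hx, Real.norm_eq_abs, sq_abs]
  · refine integral_congr_ae ?_
    filter_upwards [h.grad_toH1] with x hx
    rw [hx]

lemma IsTest.lintegral_sq_add {φ : Eu n → ℝ} (h : IsTest φ) :
    (∫⁻ x, ‖φ x‖ₑ ^ 2) + ∫⁻ x, ‖fderiv ℝ φ x‖ₑ ^ 2 = ENNReal.ofReal (‖h.toH1‖ ^ 2) := by
  simp_rw [← enorm_gradient]
  rw [lintegral_enorm_sq_eq h.memLp, lintegral_enorm_sq_eq h.memLp_gradient, h.norm_sq_toH1,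
    ENNReal.ofReal_add (integral_nonneg fun x => by positivity)
      (integral_nonneg fun x => by positivity)]

lemma fderiv_pow_test {φ : Eu n → ℝ} (h : IsTest φ) (k : ℕ) (x : Eu n) :
    ‖fderiv ℝ (fun y => φ y ^ (k + 1)) x‖ₑ = (k + 1) * (‖φ x‖ₑ ^ k * ‖fderiv ℝ φ x‖ₑ) := by
  have := ((h.differentiable x).hasFDerivAt.pow (k + 1)).fderiv
  rw [this, enorm_smul]
  simp only [nsmul_eq_mul, enorm_mul, enorm_pow, add_tsub_cancel_right]
  have : ‖((k + 1 : ℕ) : ℝ)‖ₑ = (k : ℝ≥0∞) + 1 := by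
    rw [Real.enorm_of_nonneg (by positivity), ENNReal.ofReal_natCast]; simp
  rw [this, mul_assoc]

/-- In the plane, the power `2 (k + 1)` is controlled by the power `2 k`. -/
lemma lintegral_pow_step_two {φ : Eu 2 → ℝ} (h : IsTest φ) (k : ℕ) :
    ∫⁻ x, ‖φ x‖ₑ ^ (2 * (k + 1)) ≤
      (lintegralPowLePowLIntegralFDerivConst (volume : Measure (Eu 2)) 2 * ((k : ℝ≥0∞) + 1) ^ 2) *
        ((∫⁻ x, ‖φ x‖ₑ ^ (2 * k)) * ∫⁻ x, ‖fderiv ℝ φ x‖ₑ ^ 2) := by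
  have mφ : AEMeasurable (fun x => ‖φ x‖ₑ ^ k) volume :=
    (h.1.continuous.measurable.enorm.pow_const k).aemeasurable
  have mD : AEMeasurable (fun x => ‖fderiv ℝ φ x‖ₑ) volume :=
    (h.contDiff_one.continuous_fderiv (by norm_num)).measurable.enorm.aemeasurable
  have hp : Real.HolderConjugate (Module.finrank ℝ (Eu 2)) 2 := by
    simpa using Real.HolderConjugate.two_two
  -- The `W^{1,1}` Sobolev inequality is applied to `φ ^ (k + 1)`; Cauchy–Schwarz then splits its
  -- gradient `(k + 1) φ ^ k ∇φ`.
  have h1 := lintegral_pow_le_pow_lintegral_fderiv (volume : Measure (Eu 2))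
    (u := fun y => φ y ^ (k + 1)) (h.contDiff_one.pow _) (h.2.comp_left (g := fun t => t ^ (k + 1))
      (by simp)) hp
  have h2 : (∫⁻ x, ‖φ x‖ₑ ^ k * ‖fderiv ℝ φ x‖ₑ) ^ 2 ≤
      (∫⁻ x, ‖φ x‖ₑ ^ (2 * k)) * ∫⁻ x, ‖fderiv ℝ φ x‖ₑ ^ 2 := by
    have := ENNReal.lintegral_mul_le_Lp_mul_Lq volume Real.HolderConjugate.two_two mφ mD
    calc _ ≤ _ := pow_le_pow_left' this 2
      _ = _ := by
        rw [mul_pow, ← ENNReal.rpow_natCast, ← ENNReal.rpow_mul, ← ENNReal.rpow_natCast,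
          ← ENNReal.rpow_mul]
        norm_num [← pow_mul, mul_comm k 2]
  calc _ = ∫⁻ x, ‖φ x ^ (k + 1)‖ₑ ^ (2 : ℝ) := by
        refine lintegral_congr fun x => ?_
        rw [enorm_pow, ENNReal.rpow_two, ← pow_mul, mul_comm]
    _ ≤ _ := h1
    _ = (lintegralPowLePowLIntegralFDerivConst (volume : Measure (Eu 2)) 2 *
          ((k : ℝ≥0∞) + 1) ^ 2) * (∫⁻ x, ‖φ x‖ₑ ^ k * ‖fderiv ℝ φ x‖ₑ) ^ 2 := by
        simp_rw [fderiv_pow_test h]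
        rw [lintegral_const_mul' _ _ (by simp), ENNReal.rpow_two, mul_pow, mul_assoc]
    _ ≤ _ := by gcongr

/-- On the line, a function is bounded by its `H¹` norm. -/
lemma enorm_sq_le_one {φ : Eu 1 → ℝ} (h : IsTest φ) (x : Eu 1) :
    ‖φ x‖ₑ ^ 2 ≤ ENNReal.ofReal (‖h.toH1‖ ^ 2) := by
  let e : ℝ ≃ₗᵢ[ℝ] Eu 1 := (OrthonormalBasis.singleton (Fin 1) ℝ).repr
  -- The fundamental theorem of calculus is applied to `φ²`, since `2 |φ| |φ'| ≤ φ² + φ'²` is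
  -- controlled by the `H¹` norm. The exponent is written `1 + 1` to match `fderiv_pow_test`.
  have hv : ContDiff ℝ 1 fun y => φ y ^ (1 + 1) := h.contDiff_one.pow _
  have hc : HasCompactSupport fun y => φ y ^ (1 + 1) :=
    h.2.comp_left (g := fun t => t ^ (1 + 1)) (by simp)
  have h1 := HasCompactSupport.enorm_le_lintegral_Ici_deriv
    (f := (fun y => φ y ^ (1 + 1)) ∘ e) (hv.comp e.contDiff)
    (hc.comp_homeomorph e.toHomeomorph) (e.symm x)
  have h2 : ∀ t, ‖deriv ((fun y => φ y ^ (1 + 1)) ∘ e) t‖ₑ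
      ≤ ‖fderiv ℝ (fun y => φ y ^ (1 + 1)) (e t)‖ₑ := by
    intro t
    have hd : HasDerivAt ((fun y => φ y ^ (1 + 1)) ∘ e)
        (fderiv ℝ (fun y => φ y ^ (1 + 1)) (e t) (e 1)) t := by
      have he : HasDerivAt e (e 1) t := by
        simpa using (e.toContinuousLinearEquiv : ℝ →L[ℝ] Eu 1).hasDerivAt (x := t)
      exact ((hv.differentiable (by norm_num)) (e t)).hasFDerivAt.comp_hasDerivAt t he
    rw [hd.deriv]
    refine (ContinuousLinearMap.le_opENorm _ _).trans ?_
    have : ‖e 1‖ₑ = 1 := by rw [← ofReal_norm, e.norm_map]; simp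
    rw [this, mul_one]
  calc ‖φ x‖ₑ ^ 2 = ‖((fun y => φ y ^ (1 + 1)) ∘ e) (e.symm x)‖ₑ := by simp
    _ ≤ _ := h1
    _ ≤ ∫⁻ t, ‖deriv ((fun y => φ y ^ (1 + 1)) ∘ e) t‖ₑ := setLIntegral_le_lintegral _ _
    _ ≤ ∫⁻ t, ‖fderiv ℝ (fun y => φ y ^ (1 + 1)) (e t)‖ₑ := lintegral_mono h2
    _ = ∫⁻ y, ‖fderiv ℝ (fun y => φ y ^ (1 + 1)) y‖ₑ :=
      e.measurePreserving.lintegral_comp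
        ((hv.continuous_fderiv (by norm_num)).measurable.enorm)
    _ ≤ ∫⁻ y, (‖φ y‖ₑ ^ 2 + ‖fderiv ℝ φ y‖ₑ ^ 2) := by
        refine lintegral_mono fun y => ?_
        dsimp only
        rw [fderiv_pow_test h, ← ofReal_norm, ← ofReal_norm, ← ENNReal.ofReal_pow (norm_nonneg _),
          ← ENNReal.ofReal_pow (norm_nonneg _), ← ENNReal.ofReal_pow (norm_nonneg _),
          ← ENNReal.ofReal_add (by positivity) (by positivity),
          ← ENNReal.ofReal_mul (by positivity)]
        have : ((1 : ℕ) : ℝ≥0∞) + 1 = ENNReal.ofReal 2 := by norm_num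
        rw [this, ← ENNReal.ofReal_mul (by positivity)]
        refine ENNReal.ofReal_le_ofReal ?_
        nlinarith [sq_nonneg (‖φ y‖ - ‖fderiv ℝ φ y‖)]
    _ = _ := by
        rw [lintegral_add_left (h.1.continuous.measurable.enorm.pow_const 2), h.lintegral_sq_add]

/-- Two more powers of `φ` cost one factor `‖φ‖²`: by the sup bound on the line, by
`lintegral_pow_step_two` in the plane. Even powers suffice, because in these dimensions the Sobolev
exponent may be taken as large as desired. -/
lemma lintegral_pow_le_low_dim (hn : 1 ≤ n) (hn2 : n ≤ 2) (k : ℕ) :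
    ∃ C : ℝ≥0, ∀ (φ : Eu n → ℝ) (h : IsTest φ),
      ∫⁻ x, ‖φ x‖ₑ ^ (2 * (k + 1)) ≤ C * ENNReal.ofReal (‖h.toH1‖ ^ 2) ^ (k + 1) := by
  induction k with
  | zero =>
    refine ⟨1, fun φ h => ?_⟩
    rw [← h.lintegral_sq_add]
    simp
  | succ k ih =>
    obtain ⟨C, hC⟩ := ih
    have step : ∃ D : ℝ≥0, ∀ (φ : Eu n → ℝ) (h : IsTest φ),
        ∫⁻ x, ‖φ x‖ₑ ^ (2 * (k + 1 + 1)) ≤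
          D * ((∫⁻ x, ‖φ x‖ₑ ^ (2 * (k + 1))) * ENNReal.ofReal (‖h.toH1‖ ^ 2)) := by
      obtain rfl | rfl : n = 1 ∨ n = 2 := by omega
      · refine ⟨1, fun φ h => ?_⟩
        rw [ENNReal.coe_one, one_mul, ← lintegral_mul_const _
          (h.1.continuous.measurable.enorm.pow_const _)]
        refine lintegral_mono fun x => ?_
        dsimp only
        rw [mul_add, pow_add]
        gcongr
        exact enorm_sq_le_one h x
      · refine ⟨lintegralPowLePowLIntegralFDerivConst (volume : Measure (Eu 2)) 2 *
          (((k + 1 : ℕ) : ℝ≥0) + 1) ^ 2, fun φ h => ?_⟩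
        refine (lintegral_pow_step_two h (k + 1)).trans ?_
        push_cast
        gcongr
        rw [← h.lintegral_sq_add]
        exact le_add_self
    obtain ⟨D, hD⟩ := step
    refine ⟨D * C, fun φ h => (hD φ h).trans ?_⟩
    calc _ ≤ D * ((C * ENNReal.ofReal (‖h.toH1‖ ^ 2) ^ (k + 1)) * ENNReal.ofReal (‖h.toH1‖ ^ 2)) := by
          gcongr
          exact hC φ h
      _ = _ := by push_cast; ring

/-- The Sobolev inequality for test functions. -/
lemma exists_sobolev_test (hn : 1 ≤ n) {q : ℝ}
    (hq3 : 3 ≤ n → q ≤ 4 / ((n : ℝ) - 2)) :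
    ∃ p, q + 2 ≤ p ∧ ∃ C : ℝ, 0 ≤ C ∧ ∀ (φ : Eu n → ℝ) (h : IsTest φ),
      ∫⁻ x, ‖φ x‖ₑ ^ p ≤ ENNReal.ofReal (C * ‖h.toH1‖ ^ p) := by
  rcases le_or_gt n 2 with hn2 | hn2
  · obtain ⟨k, hk⟩ := exists_nat_ge q
    obtain ⟨C, hC⟩ := lintegral_pow_le_low_dim hn hn2 k
    refine ⟨((2 * (k + 1) : ℕ) : ℝ), by push_cast; linarith, C, C.2, fun φ h => ?_⟩
    have := hC φ h
    simp_rw [ENNReal.rpow_natCast, Real.rpow_natCast]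
    refine this.trans (le_of_eq ?_)
    rw [ENNReal.ofReal_mul C.coe_nonneg, ← ENNReal.ofReal_pow (by positivity), ENNReal.ofReal_coe_nnreal,
      ← pow_mul]
  · have hn3 : 3 ≤ n := hn2
    have hnR : (3 : ℝ) ≤ n := by exact_mod_cast hn3
    have hpos : (0 : ℝ) < n - 2 := by linarith
    -- The critical exponent, equal to `4 / (n - 2) + 2`, hence at least `q + 2`.
    let p : ℝ≥0 := ⟨2 * n / (n - 2), by positivity⟩
    have hp : (p : ℝ) = 2 * n / (n - 2) := rfl
    have hp0 : p ≠ 0 := by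
      intro h0
      have : (p : ℝ) = 0 := by rw [h0]; rfl
      rw [hp] at this
      have : (0 : ℝ) < 2 * n / (n - 2) := by positivity
      linarith
    set K : ℝ≥0 := SNormLESNormFDerivOfEqConst ℝ (volume : Measure (Eu n)) ((2 : ℝ≥0) : ℝ)
    refine ⟨p, ?_, (K : ℝ) ^ (p : ℝ), by positivity, fun φ h => ?_⟩
    · have e : (p : ℝ) = 4 / (n - 2) + 2 := by rw [hp]; field_simp; ring
      rw [e]
      linarith [hq3 hn3]
    · have h1 := eLpNorm_le_eLpNorm_fderiv_of_eq (volume : Measure (Eu n)) (u := φ) (p := 2)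
        (p' := p) h.contDiff_one h.2 (by norm_num) (by simp; omega) (by
          simp only [finrank_euclideanSpace, Fintype.card_fin, hp]
          have : (n : ℝ) ≠ 0 := by linarith
          push_cast
          field_simp)
      have h2 : eLpNorm (fderiv ℝ φ) (2 : ℝ≥0) volume ≤ ENNReal.ofReal ‖h.toH1‖ := by
        refine (ENNReal.pow_le_pow_left_iff two_ne_zero).mp ?_
        have e := eLpNorm_nnreal_pow_eq_lintegral (f := fderiv ℝ φ)
          (μ := (volume : Measure (Eu n))) (p := 2) (by norm_num)
        simp only [NNReal.coe_ofNat, ENNReal.rpow_two] at e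
        rw [e, ← ENNReal.ofReal_pow (norm_nonneg _), ← h.lintegral_sq_add]
        exact le_add_self
      rw [← eLpNorm_nnreal_pow_eq_lintegral hp0]
      calc _ ≤ ((K : ℝ≥0∞) * ENNReal.ofReal ‖h.toH1‖) ^ (p : ℝ) := by
            gcongr
            exact h1.trans (by gcongr)
        _ = _ := by
            rw [← ENNReal.ofReal_coe_nnreal, ← ENNReal.ofReal_mul K.coe_nonneg,
              ENNReal.ofReal_rpow_of_nonneg (by positivity) p.coe_nonneg, Real.mul_rpow K.coe_nonneg (norm_nonneg _)]

/-- The Sobolev inequality. -/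
theorem exists_sobolev (hn : 1 ≤ n) {q : ℝ} (hq : 0 ≤ q)
    (hq3 : 3 ≤ n → q ≤ 4 / ((n : ℝ) - 2)) :
    ∃ p, q + 2 ≤ p ∧ ∃ C : ℝ, 0 ≤ C ∧ ∀ u : H1 n,
      Integrable (fun x => |fn u x| ^ p) ∧ ∫ x, |fn u x| ^ p ≤ C * ‖u‖ ^ p := by
  obtain ⟨p, hp, C, hC0, hC⟩ := exists_sobolev_test hn hq3
  have hp0 : 0 ≤ p := by linarith
  refine ⟨p, hp, C, hC0, fun u => ?_⟩
  obtain ⟨φ, hφ, ht⟩ := exists_seq_isTest_tendsto u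
  have tf : Tendsto (fun k => (hφ k).toH1.1.fst) atTop (𝓝 u.1.fst) := by
    have : Continuous fun w : H1 n => w.1.fst := by fun_prop
    exact (this.tendsto u).comp ht
  obtain ⟨σ, hσ, hae⟩ := (tendstoInMeasure_of_tendsto_Lp tf).exists_seq_tendsto_ae
  have hae2 : ∀ᵐ x, Tendsto (fun k => φ (σ k) x) atTop (𝓝 (fn u x)) := by
    filter_upwards [hae, ae_all_iff.mpr fun k => (hφ k).fn_toH1] with x h1 h2
    exact h1.congr fun k => h2 (σ k)
  -- Fatou's lemma along test functions that converge to `u` in `H¹` and almost everywhere.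
  have hle : ∫⁻ x, ‖fn u x‖ₑ ^ p ≤ ENNReal.ofReal (C * ‖u‖ ^ p) := by
    calc _ = ∫⁻ x, liminf (fun k => ‖φ (σ k) x‖ₑ ^ p) atTop := by
          refine lintegral_congr_ae ?_
          filter_upwards [hae2] with x hx
          exact (((ENNReal.continuous_rpow_const (y := p)).tendsto _).comp
            (hx.enorm)).liminf_eq.symm
      _ ≤ liminf (fun k => ∫⁻ x, ‖φ (σ k) x‖ₑ ^ p) atTop :=
          lintegral_liminf_le fun k => ((hφ (σ k)).1.continuous.measurable.enorm.pow_const p)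
      _ ≤ liminf (fun k => ENNReal.ofReal (C * ‖(hφ (σ k)).toH1‖ ^ p)) atTop :=
          liminf_le_liminf (Eventually.of_forall fun k => hC _ (hφ (σ k)))
      _ = _ := by
          refine Tendsto.liminf_eq ?_
          refine (ENNReal.continuous_ofReal.tendsto _).comp (Tendsto.const_mul C ?_)
          exact (ht.comp hσ.tendsto_atTop).norm.rpow_const (Or.inr hp0)
  have hm : AEStronglyMeasurable (fun x => |fn u x| ^ p) volume :=
    ((fn_memLp u).1.aemeasurable.abs.pow_const p).aestronglyMeasurable
  have he : ∀ x, ‖fn u x‖ₑ ^ p = ENNReal.ofReal (|fn u x| ^ p) := fun x => by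
    rw [← ofReal_norm, ENNReal.ofReal_rpow_of_nonneg (norm_nonneg _) hp0, Real.norm_eq_abs]
  simp_rw [he] at hle
  have hnn : 0 ≤ᵐ[volume] fun x => |fn u x| ^ p := Eventually.of_forall fun x => by positivity
  refine ⟨⟨hm, ?_⟩, ?_⟩
  · rw [hasFiniteIntegral_iff_ofReal hnn]
    exact hle.trans_lt ENNReal.ofReal_lt_top
  · rw [integral_eq_lintegral_of_nonneg_ae hnn hm]
    exact ENNReal.toReal_le_of_le_ofReal (by positivity) hle

end Sobolev

/-! ### Measurability and Taylor expansion of the nonlinearity. -/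

section Pointwise

variable {f : ℝ → ℝ → ℝ}

lemma CondF1.hasDerivAt (h : CondF1 f) {r : ℝ} (hr : 0 < r) (t : ℝ) :
    HasDerivAt (f r) (deriv (f r) t) t :=
  ((h.contDiff_t r hr).differentiable (by norm_num) t).hasDerivAt

lemma CondF1.continuous (h : CondF1 f) {r : ℝ} (hr : 0 < r) : Continuous (f r) :=
  (h.contDiff_t r hr).continuous

lemma CondF1.continuous_deriv (h : CondF1 f) {r : ℝ} (hr : 0 < r) : Continuous (deriv (f r)) :=
  (h.contDiff_t r hr).continuous_deriv (by norm_num)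

lemma CondF1.hasDerivAt_Fprim (h : CondF1 f) {r : ℝ} (hr : 0 < r) (t : ℝ) :
    HasDerivAt (Fprim f r) (f r t) t :=
  intervalIntegral.integral_hasDerivAt_right ((h.continuous hr).intervalIntegrable _ _)
    ((h.continuous hr).stronglyMeasurableAtFilter _ _) (h.continuous hr).continuousAt

lemma Fprim_zero (r : ℝ) : Fprim f r 0 = 0 := intervalIntegral.integral_same

lemma CondF1.Fprim_neg (h : CondF1 f) {r : ℝ} (hr : 0 < r) (t : ℝ) :
    Fprim f r (-t) = Fprim f r t := by
  have h1 := intervalIntegral.integral_comp_neg (fun s => f r s) (a := 0) (b := t)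
  simp only [h.odd r hr, neg_zero, intervalIntegral.integral_neg] at h1
  rw [Fprim, Fprim, ← neg_neg (∫ s in (0 : ℝ)..t, f r s), h1, intervalIntegral.integral_symm]

/-- A jointly measurable function that agrees with `g r t` for `r > 0`. -/
lemma exists_measurable_of_caratheodory {g : ℝ → ℝ → ℝ} (h1 : ∀ r > 0, Continuous (g r))
    (h2 : ∀ t, ∃ k : ℝ → ℝ, Measurable k ∧ ∀ r > 0, k r = g r t) :
    ∃ G : ℝ × ℝ → ℝ, Measurable G ∧ ∀ r > 0, ∀ t, G (t, r) = g r t := by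
  refine ⟨Function.uncurry fun t r => (Ioi (0 : ℝ)).indicator (fun r => g r t) r,
    measurable_uncurry_of_continuous_of_measurable (fun r => ?_) (fun t => ?_), fun r hr t => ?_⟩
  · by_cases hr : r ∈ Ioi (0 : ℝ)
    · simpa [indicator_of_mem hr] using h1 r hr
    · simp only [indicator_of_notMem hr]
      exact continuous_const
  · obtain ⟨k, hk, e⟩ := h2 t
    have : ((Ioi (0 : ℝ)).indicator fun r => g r t) = (Ioi (0 : ℝ)).indicator k := by
      refine indicator_congr fun r hr => (e r hr).symm
    rw [this]
    exact hk.indicator measurableSet_Ioi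
  · simp [indicator_of_mem (show r ∈ Ioi (0 : ℝ) from hr)]

lemma CondF1.measurable_section (h : CondF1 f) (t : ℝ) :
    ∃ k : ℝ → ℝ, Measurable k ∧ ∀ r > 0, k r = f r t := by
  classical
  refine ⟨(Ioi (0 : ℝ)).piecewise (fun r => f r t) 0,
    ContinuousOn.measurable_piecewise (h.contDiff_r t).continuousOn continuousOn_const
      measurableSet_Ioi, fun r hr => piecewise_eq_of_mem _ _ _ hr⟩

lemma CondF1.exists_measurable (h : CondF1 f) :
    ∃ G : ℝ × ℝ → ℝ, Measurable G ∧ ∀ r > 0, ∀ t, G (t, r) = f r t :=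
  exists_measurable_of_caratheodory (fun _ hr => h.continuous hr) h.measurable_section

/-- No regularity of `f_t` in `r` is assumed. Measurability in `r` comes from writing `f_t` as a
limit of difference quotients of `f` along `s k → 0`. -/
lemma CondF1.exists_measurable_deriv (h : CondF1 f) :
    ∃ G : ℝ × ℝ → ℝ, Measurable G ∧ ∀ r > 0, ∀ t, G (t, r) = deriv (f r) t := by
  refine exists_measurable_of_caratheodory (fun _ hr => h.continuous_deriv hr) fun t => ?_
  obtain ⟨G, hG, e⟩ := h.exists_measurable
  let s : ℕ → ℝ := fun k => 1 / ((k : ℝ) + 1)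
  have hs0 : ∀ k, s k ≠ 0 := fun k => by positivity
  have hs : Tendsto s atTop (𝓝[≠] 0) := tendsto_nhdsWithin_iff.mpr
    ⟨tendsto_one_div_add_atTop_nhds_zero_nat, Eventually.of_forall hs0⟩
  refine ⟨(Ioi (0 : ℝ)).indicator fun r => deriv (f r) t, ?_, fun r hr => indicator_of_mem hr _⟩
  refine measurable_of_tendsto_metrizable (f := fun k => (Ioi (0 : ℝ)).indicator
    fun r => (s k)⁻¹ * (G (t + s k, r) - G (t, r))) (fun k => ?_) ?_
  · refine Measurable.indicator ?_ measurableSet_Ioi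
    fun_prop
  · rw [tendsto_pi_nhds]
    intro r
    by_cases hr : r ∈ Ioi (0 : ℝ)
    · simp only [indicator_of_mem hr, e r hr]
      exact ((h.hasDerivAt hr t).tendsto_slope_zero).comp hs
    · simp only [indicator_of_notMem hr]
      exact tendsto_const_nhds

lemma CondF1.exists_measurable_Fprim (h : CondF1 f) :
    ∃ G : ℝ × ℝ → ℝ, Measurable G ∧ ∀ r > 0, ∀ t, G (t, r) = Fprim f r t := by
  refine exists_measurable_of_caratheodory (fun r hr =>
    continuous_iff_continuousAt.mpr fun t => (h.hasDerivAt_Fprim hr t).continuousAt) fun t => ?_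
  obtain ⟨G, hG, e⟩ := h.exists_measurable
  refine ⟨fun r => ∫ s in (0 : ℝ)..t, G (s, r), ?_, fun r hr => ?_⟩
  · simp only [intervalIntegral]
    have hm : StronglyMeasurable (Function.uncurry fun r s => G (s, r)) :=
      (hG.comp measurable_swap).stronglyMeasurable
    exact ((hm.integral_prod_right).sub (hm.integral_prod_right)).measurable
  · simp only [Fprim, e r hr]

/-- A function whose derivative is `o(s)` and that vanishes at `0` is `o(s²)`. -/
lemma isLittleO_sq_of_hasDerivAt {g g' : ℝ → ℝ} (h0 : g 0 = 0) (hg : ∀ s, HasDerivAt g (g' s) s)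
    (ho : g' =o[𝓝 0] fun s => s) : g =o[𝓝 0] fun s => s ^ 2 := by
  rw [Asymptotics.isLittleO_iff] at ho ⊢
  intro c hc
  obtain ⟨δ, hδ, h⟩ := Metric.eventually_nhds_iff.mp (ho hc)
  refine Metric.eventually_nhds_iff.mpr ⟨δ, hδ, fun s hs => ?_⟩
  have := Convex.norm_image_sub_le_of_norm_hasDerivWithin_le (f := g) (f' := g')
    (s := Metric.closedBall 0 |s|) (C := c * |s|) (x := 0) (y := s)
    (fun x _ => (hg x).hasDerivWithinAt) (fun x hx => ?_) (convex_closedBall _ _)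
    (by simp) (by simp)
  · rw [h0, sub_zero, sub_zero, Real.norm_eq_abs, Real.norm_eq_abs] at this
    rw [Real.norm_eq_abs, Real.norm_eq_abs, abs_pow]
    nlinarith
  · have hx' : |x| ≤ |s| := by simpa using hx
    have hs' : |s| < δ := by simpa using hs
    have := h (y := x) (by simpa using hx'.trans_lt hs')
    rw [Real.norm_eq_abs x] at this
    exact this.trans (by gcongr)

/-- The second order expansion of the primitive of `f`. -/
lemma CondF1.tendsto_Fprim (h : CondF1 f) {r : ℝ} (hr : 0 < r) (t a : ℝ) :
    Tendsto (fun s => (Fprim f r (t + s * a) - Fprim f r t - s * (f r t * a)) / s ^ 2) (𝓝[≠] 0)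
      (𝓝 (1 / 2 * (deriv (f r) t * a ^ 2))) := by
  -- The second-order Taylor remainder. Its derivative is the first-order remainder of `f r`, which
  -- is `o(s)`.
  let g : ℝ → ℝ := fun s => Fprim f r (t + s * a) - Fprim f r t - s * (f r t * a)
    - s ^ 2 * (1 / 2 * (deriv (f r) t * a ^ 2))
  have hlin : ∀ s, HasDerivAt (fun s => t + s * a) a s := fun s => by
    simpa using ((hasDerivAt_id s).mul_const a).const_add t
  have hg : ∀ s, HasDerivAt g ((f r (t + s * a) - f r t - s * (deriv (f r) t * a)) * a) s := by
    intro s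
    have h1 := (h.hasDerivAt_Fprim hr (t + s * a)).comp s (hlin s)
    have h2 := (((h1.sub_const (Fprim f r t)).sub ((hasDerivAt_id s).mul_const (f r t * a))).sub
      (((hasDerivAt_id s).pow 2).mul_const (1 / 2 * (deriv (f r) t * a ^ 2))))
    refine h2.congr_deriv ?_
    simp
    ring
  have hd : HasDerivAt (fun s => f r (t + s * a)) (deriv (f r) t * a) 0 := by
    have h0 : t = t + 0 * a := by ring
    have h1 := h.hasDerivAt hr (t + 0 * a)
    rw [← h0] at h1
    exact HasDerivAt.comp 0 (by simpa using h1) (hlin 0)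
  have ho : (fun s => (f r (t + s * a) - f r t - s * (deriv (f r) t * a)) * a)
      =o[𝓝 0] fun s => s := by
    have h1 := hasDerivAt_iff_isLittleO_nhds_zero.mp hd
    simp only [zero_add, zero_mul, add_zero, smul_eq_mul] at h1
    simpa [mul_comm] using h1.const_mul_left a
  have key := isLittleO_sq_of_hasDerivAt (g := g) (by simp [g]) hg ho
  have h3 := (key.mono (nhdsWithin_le_nhds (s := {0}ᶜ))).tendsto_div_nhds_zero.add_const
    (1 / 2 * (deriv (f r) t * a ^ 2))
  rw [zero_add] at h3
  refine h3.congr' ?_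
  filter_upwards [self_mem_nhdsWithin] with s hs
  have : s ≠ 0 := hs
  simp only [g]
  field_simp
  ring

end Pointwise

/-! ### Growth estimates and control of the nonlinear terms by the `H¹` norm. -/

section Bounds

/-- The quantitative consequences of the hypotheses: a bound on `V`, the growth of `f_t` and the
Sobolev inequality, with a common exponent. -/
structure Bounds (n : ℕ) (V : ℝ → ℝ) (f : ℝ → ℝ → ℝ) (p B C K : ℝ) : Prop where
  one_le : 1 ≤ n
  condF1 : CondF1 f
  two_le : 2 ≤ p
  B_nonneg : 0 ≤ B
  C_nonneg : 0 ≤ C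
  K_nonneg : 0 ≤ K
  V_meas : Measurable fun x : Eu n => V ‖x‖
  V_le : ∀ x : Eu n, |V ‖x‖| ≤ B
  growth : ∀ r > 0, ∀ t, |deriv (f r) t| ≤ C * (1 + |t| ^ (p - 2))
  integrable : ∀ u : H1 n, Integrable fun x => |fn u x| ^ p
  sobolev : ∀ u : H1 n, ∫ x, |fn u x| ^ p ≤ K * ‖u‖ ^ p

/-- Since `q ≤ p - 2`, one has `|t|^q ≤ 1 + |t|^(p-2)`. The growth exponent can thus be matched to
the Sobolev exponent at the price of doubling the constant. -/
lemma exists_bounds {n : ℕ} (hn : 1 ≤ n) {V : ℝ → ℝ} {f : ℝ → ℝ → ℝ} (hF1 : CondF1 f)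
    (hF2 : CondF2 V) (hg : Growth n f) : ∃ p B C K, Bounds n V f p B C K := by
  obtain ⟨C, q, hq, hq3, hC⟩ := hg
  obtain ⟨p, hp, K, hK, hs⟩ := exists_sobolev hn hq hq3
  have hVc : Continuous fun x : Eu n => V ‖x‖ :=
    hF2.contDiff.continuousOn.comp_continuous continuous_norm fun x => norm_nonneg x
  obtain ⟨B, hB⟩ : ∃ B, ∀ r ≥ 0, |V r| ≤ B := by
    obtain ⟨R, hR⟩ := eventually_atTop.mp (hF2.tendsto.abs.eventually_le_const
      (show |(0 : ℝ)| < 1 by simp))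
    obtain ⟨B, hB⟩ := (isCompact_Icc (a := (0 : ℝ)) (b := R)).exists_bound_of_continuousOn
      (hF2.contDiff.continuousOn.mono Icc_subset_Ici_self)
    refine ⟨max B 1, fun r hr => ?_⟩
    rcases le_total r R with h | h
    · exact (hB r ⟨hr, h⟩).trans (le_max_left _ _)
    · exact (hR r h).trans (le_max_right _ _)
  -- The growth bound at `t = 0` reads `0 ≤ 2 C` if `q = 0`, because `0 ^ 0 = 1`, and `0 ≤ C`
  -- otherwise.
  have hC0 : 0 ≤ C := by
    have := (abs_nonneg _).trans (hC 1 one_pos 0)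
    rcases hq.eq_or_lt with h | h
    · rw [← h] at this; simp at this; linarith
    · rw [abs_zero, Real.zero_rpow h.ne'] at this; linarith
  refine ⟨p, B, 2 * C, K, hn, hF1, by linarith, (abs_nonneg _).trans (hB 0 le_rfl), by positivity,
    hK, hVc.measurable, fun x => hB _ (norm_nonneg x), fun r hr t => (hC r hr t).trans ?_,
    fun u => (hs u).1, fun u => (hs u).2⟩
  have : |t| ^ q ≤ 1 + |t| ^ (p - 2) := by
    rcases le_total |t| 1 with h | h
    · have := Real.rpow_le_one (abs_nonneg t) h hq
      have := Real.rpow_nonneg (abs_nonneg t) (p - 2)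
      linarith
    · have := Real.rpow_le_rpow_of_exponent_le h (show q ≤ p - 2 by linarith)
      linarith
  have := Real.rpow_nonneg (abs_nonneg t) (p - 2)
  nlinarith

variable {n : ℕ} {V : ℝ → ℝ} {f : ℝ → ℝ → ℝ} {p B C K : ℝ}

/-- The conditions on `f` concern `r > 0` only. The origin, where they say nothing, is a null set
because `n ≥ 1`. -/
lemma Bounds.ae_pos (hb : Bounds n V f p B C K) : ∀ᵐ x : Eu n, 0 < ‖x‖ := by
  have : Nonempty (Fin n) := ⟨⟨0, hb.one_le⟩⟩
  have : Nontrivial (Eu n) := inferInstance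
  filter_upwards [Measure.ae_ne (μ := (volume : Measure (Eu n))) 0] with x hx
  exact norm_pos_iff.mpr hx

lemma Bounds.aestronglyMeasurable_of (hb : Bounds n V f p B C K) {g : ℝ → ℝ → ℝ}
    (hg : ∃ G : ℝ × ℝ → ℝ, Measurable G ∧ ∀ r > 0, ∀ t, G (t, r) = g r t) (u : H1 n) :
    AEStronglyMeasurable (fun x => g ‖x‖ (fn u x)) volume := by
  obtain ⟨G, hG, e⟩ := hg
  have h1 : AEMeasurable (fun x : Eu n => (fn u x, ‖x‖)) volume :=
    (fn_memLp u).1.aemeasurable.prodMk measurable_norm.aemeasurable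
  refine (hG.comp_aemeasurable h1).aestronglyMeasurable.congr ?_
  filter_upwards [hb.ae_pos] with x hx
  exact e _ hx _

lemma Bounds.aesm_f (hb : Bounds n V f p B C K) (u : H1 n) :
    AEStronglyMeasurable (fun x => f ‖x‖ (fn u x)) volume :=
  hb.aestronglyMeasurable_of hb.condF1.exists_measurable u

lemma Bounds.aesm_deriv (hb : Bounds n V f p B C K) (u : H1 n) :
    AEStronglyMeasurable (fun x => deriv (f ‖x‖) (fn u x)) volume :=
  hb.aestronglyMeasurable_of (g := fun r t => deriv (f r) t) hb.condF1.exists_measurable_deriv u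

lemma Bounds.aesm_Fprim (hb : Bounds n V f p B C K) (u : H1 n) :
    AEStronglyMeasurable (fun x => Fprim f ‖x‖ (fn u x)) volume :=
  hb.aestronglyMeasurable_of hb.condF1.exists_measurable_Fprim u

lemma Bounds.rpow_mono (hb : Bounds n V f p B C K) {a b : ℝ} (ha : 0 ≤ a) (hab : a ≤ b) :
    a ^ (p - 2) ≤ b ^ (p - 2) :=
  Real.rpow_le_rpow ha hab (by linarith [hb.two_le])

lemma Bounds.abs_f_sub_le (hb : Bounds n V f p B C K) {r : ℝ} (hr : 0 < r) {s t M : ℝ}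
    (hs : |s| ≤ M) (ht : |t| ≤ M) : |f r s - f r t| ≤ C * (1 + M ^ (p - 2)) * |s - t| := by
  refine Convex.norm_image_sub_le_of_norm_hasDerivWithin_le (s := Metric.closedBall 0 M)
    (f := f r) (f' := deriv (f r)) (x := t) (y := s)
    (fun x _ => (hb.condF1.hasDerivAt hr x).hasDerivWithinAt) (fun x hx => ?_)
    (convex_closedBall _ _) (by simpa using ht) (by simpa using hs)
  have hx' : |x| ≤ M := by simpa using hx
  refine (hb.growth r hr x).trans ?_
  have := hb.rpow_mono (abs_nonneg x) hx'
  have := hb.C_nonneg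
  gcongr

lemma Bounds.abs_f_le (hb : Bounds n V f p B C K) {r : ℝ} (hr : 0 < r) (t : ℝ) :
    |f r t| ≤ C * (1 + |t| ^ (p - 2)) * |t| := by
  have := hb.abs_f_sub_le hr (s := t) (t := 0) le_rfl (by simp)
  simpa [hb.condF1.zero r hr] using this

lemma Bounds.abs_Fprim_sub_le (hb : Bounds n V f p B C K) {r : ℝ} (hr : 0 < r) {t a M : ℝ}
    (hM : |t| + |a| ≤ M) :
    |Fprim f r (t + a) - Fprim f r t - f r t * a| ≤ C * (1 + M ^ (p - 2)) * a ^ 2 := by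
  have key := Convex.norm_image_sub_le_of_norm_hasDerivWithin_le (s := Metric.closedBall t |a|)
    (f := fun s => Fprim f r s - f r t * s) (f' := fun s => f r s - f r t) (x := t) (y := t + a)
    (C := C * (1 + M ^ (p - 2)) * |a|)
    (fun x _ => ?_) (fun x hx => ?_)
    (convex_closedBall _ _) (by simp) (by simp)
  · simp only [Real.norm_eq_abs, add_sub_cancel_left] at key
    have e : Fprim f r (t + a) - f r t * (t + a) - (Fprim f r t - f r t * t)
        = Fprim f r (t + a) - Fprim f r t - f r t * a := by ring
    rw [e, mul_assoc, abs_mul_abs_self, ← sq] at key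
    exact key
  · have := ((hb.condF1.hasDerivAt_Fprim hr x).sub ((hasDerivAt_id x).const_mul (f r t)))
    exact (this.congr_deriv (by simp)).hasDerivWithinAt
  · have hx' : |x - t| ≤ |a| := by simpa [Real.dist_eq] using hx
    have h1 : |x| ≤ M := by
      have : |x| ≤ |x - t| + |t| := by simpa using abs_add_le (x - t) t
      linarith
    have h2 : |t| ≤ M := by linarith [abs_nonneg a]
    refine (hb.abs_f_sub_le hr h1 h2).trans ?_
    have := hb.C_nonneg
    have := Real.rpow_nonneg ((abs_nonneg x).trans h1) (p - 2)
    gcongr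

lemma Bounds.abs_Fprim_le (hb : Bounds n V f p B C K) {r : ℝ} (hr : 0 < r) (t : ℝ) :
    |Fprim f r t| ≤ C * (1 + |t| ^ (p - 2)) * t ^ 2 := by
  have := hb.abs_Fprim_sub_le hr (t := 0) (a := t) (M := |t|) (by simp)
  simpa [hb.condF1.zero r hr, Fprim_zero] using this

/-- With `M` the largest of the three numbers, the left side is at most `M ^ (p - 2) * M² = M ^ p`,
and `M ^ p` is one of the terms on the right. -/
lemma Bounds.young (hb : Bounds n V f p B C K) {a b c : ℝ} (ha : 0 ≤ a) (hB : 0 ≤ b) (hc : 0 ≤ c) :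
    a ^ (p - 2) * (b * c) ≤ a ^ p + b ^ p + c ^ p := by
  set M := max a (max b c) with hM
  have h1 : a ≤ M := le_max_left _ _
  have h2 : b ≤ M := (le_max_left _ _).trans (le_max_right _ _)
  have h3 : c ≤ M := (le_max_right _ _).trans (le_max_right _ _)
  have hM0 : 0 ≤ M := ha.trans h1
  have e : M ^ (p - 2) * (M * M) = M ^ p := by
    rcases hM0.eq_or_lt with h | h
    · rw [← h, Real.zero_rpow (show p ≠ 0 by linarith [hb.two_le])]; simp
    · rw [← sq, ← Real.rpow_natCast, ← Real.rpow_add h]; norm_num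
  have h4 : M ^ p ≤ a ^ p + b ^ p + c ^ p := by
    have := Real.rpow_nonneg ha p
    have := Real.rpow_nonneg hB p
    have := Real.rpow_nonneg hc p
    rcases max_choice a (max b c) with h | h
    · rw [hM, h]; linarith
    · rcases max_choice b c with h' | h' <;> rw [hM, h, h'] <;> linarith
  refine le_trans ?_ (e.le.trans h4)
  have := hb.rpow_mono ha h1
  have := Real.rpow_nonneg hM0 (p - 2)
  gcongr

lemma add_rpow_le_two_rpow {p a b : ℝ} (hp : 0 ≤ p) (ha : 0 ≤ a) (hb : 0 ≤ b) :
    (a + b) ^ p ≤ 2 ^ p * (a ^ p + b ^ p) := by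
  have hm : 0 ≤ max a b := ha.trans (le_max_left _ _)
  calc (a + b) ^ p ≤ (2 * max a b) ^ p := by
        refine Real.rpow_le_rpow (by positivity) ?_ hp
        linarith [le_max_left a b, le_max_right a b]
    _ = 2 ^ p * (max a b) ^ p := Real.mul_rpow (by norm_num) hm
    _ ≤ _ := by
        gcongr
        have := Real.rpow_nonneg ha p
        have := Real.rpow_nonneg hb p
        rcases max_choice a b with h | h <;> rw [h] <;> linarith

/-- The weight that dominates the nonlinear terms. -/
noncomputable def weight (p : ℝ) (u v b c : H1 n) (x : Eu n) : ℝ :=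
  (1 + (|fn u x| + |fn v x|) ^ (p - 2)) * (|fn b x| * |fn c x|)

lemma weight_nonneg (p : ℝ) (u v b c : H1 n) (x : Eu n) : 0 ≤ weight p u v b c x := by
  unfold weight; positivity

lemma aesm_weight (p : ℝ) (u v b c : H1 n) : AEStronglyMeasurable (weight p u v b c) volume := by
  have h : ∀ w : H1 n, AEMeasurable (fun x => |fn w x|) volume :=
    fun w => (fn_memLp w).1.aemeasurable.abs
  exact ((((h u).add (h v)).pow_const _).const_add 1 |>.mul ((h b).mul (h c))).aestronglyMeasurable

lemma integral_abs_mul_abs_le (b c : H1 n) :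
    Integrable (fun x => |fn b x| * |fn c x|) ∧ ∫ x, |fn b x| * |fn c x| ≤ ‖b‖ * ‖c‖ := by
  have hi : Integrable (fun x => |fn b x| * |fn c x|) := by
    simpa [abs_mul] using (integrable_fn_mul b c).abs
  refine ⟨hi, ?_⟩
  have h1 := integral_mul_le_Lp_mul_Lq_of_nonneg (μ := (volume : Measure (Eu n)))
    Real.HolderConjugate.two_two (f := fun x => |fn b x|) (g := fun x => |fn c x|)
    (Eventually.of_forall fun x => abs_nonneg _) (Eventually.of_forall fun x => abs_nonneg _)
    (by simpa using! (fn_memLp b).abs) (by simpa using! (fn_memLp c).abs)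
  have h2 : ∀ w : H1 n, (∫ x, |fn w x| ^ (2 : ℝ)) ^ (1 / (2 : ℝ)) ≤ ‖w‖ := by
    intro w
    rw [← Real.sqrt_eq_rpow]
    refine Real.sqrt_le_iff.mpr ⟨norm_nonneg _, ?_⟩
    simpa using integral_fn_sq_le w
  refine h1.trans (mul_le_mul (h2 b) (h2 c) (by positivity) (norm_nonneg _))

/-- Every nonlinear term is dominated by a weight, so this is where the Sobolev inequality acts.
`Bounds.young` is applied to `b / ‖b‖` and `c / ‖c‖`; the normalisation is what makes the bound
proportional to `‖b‖ ‖c‖`. If one of these norms vanishes, the weight is zero almost everywhere. -/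
lemma Bounds.weight_le (hb : Bounds n V f p B C K) (R : ℝ) : ∃ D, 0 ≤ D ∧ ∀ u v b c : H1 n,
    ‖u‖ ≤ R → ‖v‖ ≤ R →
      Integrable (weight p u v b c) ∧ ∫ x, weight p u v b c x ≤ D * (‖b‖ * ‖c‖) := by
  have hp0 : 0 ≤ p := by linarith [hb.two_le]
  have hK := hb.K_nonneg
  refine ⟨1 + (2 ^ p * (2 * (K * |R| ^ p)) + 2 * K), by positivity, fun u v b c hu hv => ?_⟩
  by_cases hbc : ‖b‖ = 0 ∨ ‖c‖ = 0
  · have hz : weight p u v b c =ᵐ[volume] fun _ => 0 := by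
      rcases hbc with h | h
      · rw [norm_eq_zero] at h
        subst h
        filter_upwards [fn_zero (n := n)] with x hx
        simp [weight, hx]
      · rw [norm_eq_zero] at h
        subst h
        filter_upwards [fn_zero (n := n)] with x hx
        simp [weight, hx]
    refine ⟨(integrable_zero _ _ _).congr hz.symm, ?_⟩
    rw [integral_congr_ae hz]
    rcases hbc with h | h <;> simp [h]
  rw [not_or] at hbc
  have b0 : 0 < ‖b‖ := lt_of_le_of_ne (norm_nonneg _) (Ne.symm hbc.1)
  have c0 : 0 < ‖c‖ := lt_of_le_of_ne (norm_nonneg _) (Ne.symm hbc.2)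
  obtain ⟨i0, l0⟩ := integral_abs_mul_abs_le b c
  let G : Eu n → ℝ := fun x => |fn b x| * |fn c x| + ‖b‖ * ‖c‖ *
    (2 ^ p * (|fn u x| ^ p + |fn v x| ^ p) + |fn b x| ^ p / ‖b‖ ^ p + |fn c x| ^ p / ‖c‖ ^ p)
  have iG2 : Integrable fun x => 2 ^ p * (|fn u x| ^ p + |fn v x| ^ p) :=
    ((hb.integrable u).add (hb.integrable v)).const_mul _
  have iG3 : Integrable fun x => |fn b x| ^ p / ‖b‖ ^ p := (hb.integrable b).div_const _
  have iG4 : Integrable fun x => |fn c x| ^ p / ‖c‖ ^ p := (hb.integrable c).div_const _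
  have iG1 : Integrable fun x => 2 ^ p * (|fn u x| ^ p + |fn v x| ^ p) + |fn b x| ^ p / ‖b‖ ^ p
    + |fn c x| ^ p / ‖c‖ ^ p := (iG2.add iG3).add iG4
  have iG : Integrable G := i0.add (iG1.const_mul _)
  have hle : ∀ x, weight p u v b c x ≤ G x := by
    intro x
    have h1 := hb.young (a := |fn u x| + |fn v x|) (b := |fn b x| / ‖b‖) (c := |fn c x| / ‖c‖)
      (by positivity) (by positivity) (by positivity)
    have h2 := add_rpow_le_two_rpow hp0 (abs_nonneg (fn u x)) (abs_nonneg (fn v x))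
    rw [Real.div_rpow (abs_nonneg _) b0.le, Real.div_rpow (abs_nonneg _) c0.le] at h1
    have e : (|fn u x| + |fn v x|) ^ (p - 2) * (|fn b x| * |fn c x|) = ‖b‖ * ‖c‖ *
        ((|fn u x| + |fn v x|) ^ (p - 2) * (|fn b x| / ‖b‖ * (|fn c x| / ‖c‖))) := by
      field_simp
    simp only [weight, G, add_mul, one_mul]
    rw [e]
    gcongr
    linarith
  have iw : Integrable (weight p u v b c) := by
    refine iG.mono' (aesm_weight p u v b c) (Eventually.of_forall fun x => ?_)
    rw [Real.norm_of_nonneg (weight_nonneg _ _ _ _ _ _)]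
    exact hle x
  refine ⟨iw, (integral_mono iw iG hle).trans ?_⟩
  simp only [G]
  rw [integral_add i0 (iG1.const_mul _), integral_const_mul, integral_add (f := fun x =>
      2 ^ p * (|fn u x| ^ p + |fn v x| ^ p) + |fn b x| ^ p / ‖b‖ ^ p) (iG2.add iG3) iG4,
    integral_add iG2 iG3, integral_const_mul, integral_add (hb.integrable u) (hb.integrable v),
    integral_div, integral_div]
  have s1 : ∀ w : H1 n, ‖w‖ ≤ R → ∫ x, |fn w x| ^ p ≤ K * |R| ^ p := fun w hw =>
    (hb.sobolev w).trans (by gcongr; exact hw.trans (le_abs_self R))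
  have s2 : ∀ w : H1 n, 0 < ‖w‖ → (∫ x, |fn w x| ^ p) / ‖w‖ ^ p ≤ K := fun w hw => by
    rw [div_le_iff₀ (by positivity)]
    exact hb.sobolev w
  have := s1 u hu
  have := s1 v hv
  have := s2 b b0
  have := s2 c c0
  have : 2 ^ p * ((∫ x, |fn u x| ^ p) + ∫ x, |fn v x| ^ p) + (∫ x, |fn b x| ^ p) / ‖b‖ ^ p
      + (∫ x, |fn c x| ^ p) / ‖c‖ ^ p ≤ 2 ^ p * (2 * (K * |R| ^ p)) + 2 * K := by
    have h2 : (0 : ℝ) ≤ 2 ^ p := by positivity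
    nlinarith
  have h0 : 0 ≤ ‖b‖ * ‖c‖ := by positivity
  nlinarith

end Bounds

/-! ### First and second variations of the energy. -/

section Forms

variable {n : ℕ}

/-- The `L²` inner product of the functions underlying two elements of `H¹`. -/
noncomputable def l2 (u v : H1 n) : ℝ := ∫ x, fn u x * fn v x

lemma l2_eq_inner (u v : H1 n) : l2 u v = inner ℝ u.1.fst v.1.fst := by
  rw [L2.inner_def, l2]
  exact integral_congr_ae (Eventually.of_forall fun x => by simp [fn, mul_comm])

lemma l2_add_right (u v w : H1 n) : l2 u (v + w) = l2 u v + l2 u w := by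
  simp only [l2_eq_inner]; exact inner_add_right _ _ _

lemma l2_sub_left (u v w : H1 n) : l2 (u - v) w = l2 u w - l2 v w := by
  simp only [l2_eq_inner]; exact inner_sub_left _ _ _

lemma l2_smul_right (a : ℝ) (u v : H1 n) : l2 u (a • v) = a * l2 u v := by
  simp only [l2_eq_inner]; exact real_inner_smul_right _ _ _

lemma norm_fst_le (u : H1 n) : ‖u.1.fst‖ ≤ ‖u‖ := by
  have e : ‖u‖ ^ 2 = ‖u.1.fst‖ ^ 2 + ‖u.1.snd‖ ^ 2 := WithLp.prod_norm_sq_eq_of_L2 u.1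
  exact abs_le_of_sq_le_sq' (by nlinarith [sq_nonneg ‖u.1.snd‖]) (norm_nonneg u) |>.2

lemma norm_snd_le (u : H1 n) : ‖u.1.snd‖ ≤ ‖u‖ := by
  have e : ‖u‖ ^ 2 = ‖u.1.fst‖ ^ 2 + ‖u.1.snd‖ ^ 2 := WithLp.prod_norm_sq_eq_of_L2 u.1
  exact abs_le_of_sq_le_sq' (by nlinarith [sq_nonneg ‖u.1.fst‖]) (norm_nonneg u) |>.2

lemma abs_l2_le (u v : H1 n) : |l2 u v| ≤ ‖u‖ * ‖v‖ := by
  rw [l2_eq_inner]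
  exact (abs_real_inner_le_norm _ _).trans
    (mul_le_mul (norm_fst_le u) (norm_fst_le v) (norm_nonneg _) (norm_nonneg _))

lemma abs_integral_inner_grad_le (u v : H1 n) :
    |∫ x, (inner ℝ (grad u x) (grad v x) : ℝ)| ≤ ‖u‖ * ‖v‖ := by
  have e : ∫ x, (inner ℝ (grad u x) (grad v x) : ℝ) = inner ℝ u.1.snd v.1.snd :=
    (L2.inner_def _ _).symm
  rw [e]
  exact (abs_real_inner_le_norm _ _).trans
    (mul_le_mul (norm_snd_le u) (norm_snd_le v) (norm_nonneg _) (norm_nonneg _))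

lemma mass_eq (u : H1 n) : mass u = 1 / 2 * l2 u u := by
  simp only [mass, l2, sq]

lemma mass_nonneg (u : H1 n) : 0 ≤ mass u := by
  unfold mass
  have := integral_nonneg (μ := volume) (f := fun x => fn u x ^ 2) fun x => by positivity
  linarith

lemma mass_add (u h : H1 n) : mass (u + h) = mass u + l2 u h + mass h := by
  have := l2_add_right h u h
  simp only [mass_eq, l2_eq_inner] at *
  have e : ((u + h : H1 n) : L2Pair n).fst = u.1.fst + h.1.fst := rfl
  rw [e, inner_add_left, inner_add_right, inner_add_right, real_inner_comm u.1.fst h.1.fst]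
  ring

lemma mass_smul (a : ℝ) (u : H1 n) : mass (a • u) = a ^ 2 * mass u := by
  simp only [mass_eq, l2_eq_inner]
  have e : ((a • u : H1 n) : L2Pair n).fst = a • u.1.fst := rfl
  rw [e, real_inner_smul_left, real_inner_smul_right]
  ring

lemma tendsto_l2_left {u : ℕ → H1 n} {v : H1 n} (h : Tendsto u atTop (𝓝 v)) (w : H1 n) :
    Tendsto (fun k => l2 (u k) w) atTop (𝓝 (l2 v w)) := by
  simp only [l2_eq_inner]
  have hc : Continuous fun w : H1 n => w.1.fst := by fun_prop
  exact ((hc.tendsto v).comp h).inner tendsto_const_nhds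

/-- The linear form `φ ↦ ⟨E'(u), φ⟩`. -/
noncomputable def firstVar (V : ℝ → ℝ) (f : ℝ → ℝ → ℝ) (u φ : H1 n) : ℝ :=
  ∫ x, (inner ℝ (grad u x) (grad φ x) + V ‖x‖ * fn u x * fn φ x - f ‖x‖ (fn u x) * fn φ x)

/-- The quadratic form `ψ ↦ ⟨E''(u) ψ, ψ⟩`. -/
noncomputable def secondVar (V : ℝ → ℝ) (f : ℝ → ℝ → ℝ) (u ψ : H1 n) : ℝ :=
  ∫ x, (‖grad ψ x‖ ^ 2 + V ‖x‖ * fn ψ x ^ 2 - deriv (f ‖x‖) (fn u x) * fn ψ x ^ 2)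

variable {V : ℝ → ℝ} {f : ℝ → ℝ → ℝ} {p B C K : ℝ}

lemma firstVar_smul (a : ℝ) (u φ : H1 n) : firstVar V f u (a • φ) = a * firstVar V f u φ := by
  rw [firstVar, firstVar, ← integral_const_mul]
  refine integral_congr_ae ?_
  filter_upwards [fn_smul a φ, grad_smul a φ] with x h1 h2
  rw [h1, h2, inner_smul_right]
  ring

lemma integrable_of_abs_le_weight {g : Eu n → ℝ} {D : ℝ} {u v b c : H1 n}
    (hg : AEStronglyMeasurable g volume) (hw : Integrable (weight p u v b c))
    (hle : ∀ᵐ x, |g x| ≤ D * weight p u v b c x) :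
    Integrable g ∧ |∫ x, g x| ≤ D * ∫ x, weight p u v b c x := by
  have hi : Integrable g := (hw.const_mul D).mono' hg hle
  refine ⟨hi, ?_⟩
  rw [← integral_const_mul]
  exact (abs_integral_le_integral_abs).trans (integral_mono_ae hi.abs (hw.const_mul D) hle)

lemma Bounds.integrable_weight (hb : Bounds n V f p B C K) (u v b c : H1 n) :
    Integrable (weight p u v b c) := by
  obtain ⟨D, -, h⟩ := hb.weight_le (max ‖u‖ ‖v‖)
  exact (h u v b c (le_max_left _ _) (le_max_right _ _)).1

lemma Bounds.rpow_le_weight (hb : Bounds n V f p B C K) (u v : H1 n) (x : Eu n) :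
    1 + |fn u x| ^ (p - 2) ≤ 1 + (|fn u x| + |fn v x|) ^ (p - 2) := by
  have := hb.rpow_mono (abs_nonneg (fn u x)) (le_add_of_nonneg_right (abs_nonneg (fn v x)))
  linarith

lemma Bounds.integrable_V (hb : Bounds n V f p B C K) (u v : H1 n) :
    Integrable (fun x => V ‖x‖ * fn u x * fn v x) := by
  have h := (integrable_fn_mul u v).bdd_mul (c := B) hb.V_meas.aestronglyMeasurable
    (Eventually.of_forall hb.V_le)
  simpa [mul_assoc] using h

lemma Bounds.abs_integral_V_le (hb : Bounds n V f p B C K) (u v : H1 n) :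
    |∫ x, V ‖x‖ * fn u x * fn v x| ≤ B * (‖u‖ * ‖v‖) := by
  obtain ⟨h1, h2⟩ := integral_abs_mul_abs_le u v
  calc _ ≤ ∫ x, |V ‖x‖ * fn u x * fn v x| := abs_integral_le_integral_abs
    _ ≤ ∫ x, B * (|fn u x| * |fn v x|) := by
        refine integral_mono (hb.integrable_V u v).abs (h1.const_mul B) fun x => ?_
        dsimp only
        rw [abs_mul, abs_mul, mul_assoc]
        exact mul_le_mul_of_nonneg_right (hb.V_le x) (by positivity)
    _ ≤ _ := by
        rw [integral_const_mul]
        exact mul_le_mul_of_nonneg_left h2 hb.B_nonneg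

lemma Bounds.integrable_f (hb : Bounds n V f p B C K) (u φ : H1 n) :
    Integrable (fun x => f ‖x‖ (fn u x) * fn φ x) := by
  refine (integrable_of_abs_le_weight (g := fun x => f ‖x‖ (fn u x) * fn φ x) (D := C)
    ((hb.aesm_f u).mul (fn_memLp φ).1)
    (hb.integrable_weight u u u φ) ?_).1
  filter_upwards [hb.ae_pos] with x hx
  rw [abs_mul, weight, ← mul_assoc, ← mul_assoc]
  have := hb.rpow_le_weight u u x
  have := hb.C_nonneg
  exact mul_le_mul_of_nonneg_right ((hb.abs_f_le hx _).trans (by gcongr)) (abs_nonneg _)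

lemma Bounds.integrable_Fprim (hb : Bounds n V f p B C K) (u : H1 n) :
    Integrable (fun x => Fprim f ‖x‖ (fn u x)) := by
  refine (integrable_of_abs_le_weight (D := C) (hb.aesm_Fprim u)
    (hb.integrable_weight u u u u) ?_).1
  filter_upwards [hb.ae_pos] with x hx
  have := hb.rpow_le_weight u u x
  have := hb.C_nonneg
  rw [weight, ← mul_assoc, abs_mul_abs_self, ← sq]
  exact (hb.abs_Fprim_le hx _).trans (by gcongr)

lemma Bounds.abs_deriv_mul_le (hb : Bounds n V f p B C K) (u : H1 n) {x : Eu n} (hx : 0 < ‖x‖) :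
    |deriv (f ‖x‖) (fn u x)| ≤ C * (1 + (|fn u x| + |fn u x|) ^ (p - 2)) := by
  have := hb.rpow_le_weight u u x
  have := hb.C_nonneg
  exact (hb.growth _ hx _).trans (by gcongr)

lemma Bounds.integrable_deriv (hb : Bounds n V f p B C K) (u ψ φ : H1 n) :
    Integrable (fun x => deriv (f ‖x‖) (fn u x) * fn ψ x * fn φ x) := by
  refine (integrable_of_abs_le_weight
    (g := fun x => deriv (f ‖x‖) (fn u x) * fn ψ x * fn φ x) (D := C)
    (((hb.aesm_deriv u).mul (fn_memLp ψ).1).mul (fn_memLp φ).1)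
    (hb.integrable_weight u u ψ φ) ?_).1
  filter_upwards [hb.ae_pos] with x hx
  rw [abs_mul, abs_mul, weight, mul_assoc, ← mul_assoc C]
  exact mul_le_mul_of_nonneg_right (hb.abs_deriv_mul_le u hx) (by positivity)

lemma Bounds.integrable_firstVar (hb : Bounds n V f p B C K) (u φ : H1 n) :
    Integrable fun x => inner ℝ (grad u x) (grad φ x) + V ‖x‖ * fn u x * fn φ x
      - f ‖x‖ (fn u x) * fn φ x :=
  ((integrable_inner_grad u φ).add (hb.integrable_V u φ)).sub (hb.integrable_f u φ)

lemma Bounds.integrable_energy (hb : Bounds n V f p B C K) (w : H1 n) :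
    Integrable fun x => ((1 / 2) * ‖grad w x‖ ^ 2 +
      (1 / 2) * V ‖x‖ * fn w x ^ 2 - Fprim f ‖x‖ (fn w x)) := by
  have := (((integrable_grad_sq w).const_mul (1 / 2)).add
    ((hb.integrable_V w w).const_mul (1 / 2))).sub (hb.integrable_Fprim w)
  refine this.congr (Eventually.of_forall fun x => ?_)
  simp only [Pi.sub_apply, Pi.add_apply]
  ring

/-- The first variation depends on `u` in a locally Lipschitz way. -/
lemma Bounds.abs_firstVar_sub_le (hb : Bounds n V f p B C K) (R : ℝ) : ∃ D, 0 ≤ D ∧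
    ∀ u v φ : H1 n, ‖u‖ ≤ R → ‖v‖ ≤ R →
      |firstVar V f u φ - firstVar V f v φ| ≤ D * (‖u - v‖ * ‖φ‖) := by
  obtain ⟨D, hD, h⟩ := hb.weight_le R
  refine ⟨1 + B + C * D, by have := hb.B_nonneg; have := hb.C_nonneg; positivity,
    fun u v φ hu hv => ?_⟩
  obtain ⟨i, l⟩ := h u v (u - v) φ hu hv
  have i1 := integrable_inner_grad (u - v) φ
  have i2 := hb.integrable_V (u - v) φ
  have i3 : Integrable fun x => f ‖x‖ (fn u x) * fn φ x - f ‖x‖ (fn v x) * fn φ x :=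
    (hb.integrable_f u φ).sub (hb.integrable_f v φ)
  have i12 : Integrable fun x => (inner ℝ (grad (u - v) x) (grad φ x) : ℝ)
      + V ‖x‖ * fn (u - v) x * fn φ x := i1.add i2
  have e : firstVar V f u φ - firstVar V f v φ =
      (∫ x, (inner ℝ (grad (u - v) x) (grad φ x) : ℝ)) + (∫ x, V ‖x‖ * fn (u - v) x * fn φ x)
        - ∫ x, (f ‖x‖ (fn u x) * fn φ x - f ‖x‖ (fn v x) * fn φ x) := by
    rw [firstVar, firstVar, ← integral_sub (hb.integrable_firstVar u φ)
      (hb.integrable_firstVar v φ), ← integral_add i1 i2, ← integral_sub i12 i3]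
    refine integral_congr_ae ?_
    filter_upwards [fn_sub u v, grad_sub u v] with x h1 h2
    rw [h1, h2, inner_sub_left]
    ring
  have b3 := (integrable_of_abs_le_weight (D := C) i3.1 i (by
    filter_upwards [hb.ae_pos, fn_sub u v] with x hx h1
    rw [weight, h1, ← sub_mul, abs_mul, ← mul_assoc, ← mul_assoc]
    exact mul_le_mul_of_nonneg_right (hb.abs_f_sub_le hx (le_add_of_nonneg_right (abs_nonneg _))
      (le_add_of_nonneg_left (abs_nonneg _))) (abs_nonneg _))).2
  have b1 := abs_integral_inner_grad_le (u - v) φ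
  have b2 := hb.abs_integral_V_le (u - v) φ
  rw [e]
  have t1 := abs_sub (∫ x, (inner ℝ (grad (u - v) x) (grad φ x) : ℝ) +
    ∫ x, V ‖x‖ * fn (u - v) x * fn φ x)
    (∫ x, (f ‖x‖ (fn u x) * fn φ x - f ‖x‖ (fn v x) * fn φ x))
  have := mul_le_mul_of_nonneg_left l hb.C_nonneg
  refine (abs_sub _ _).trans ?_
  have t2 := abs_add_le (∫ x, (inner ℝ (grad (u - v) x) (grad φ x) : ℝ))
    (∫ x, V ‖x‖ * fn (u - v) x * fn φ x)
  nlinarith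

lemma Bounds.energy_add_sub (hb : Bounds n V f p B C K) (u h : H1 n) :
    energy V f (u + h) - energy V f u - firstVar V f u h =
      ∫ x, (1 / 2 * ‖grad h x‖ ^ 2 + 1 / 2 * (V ‖x‖ * fn h x * fn h x) -
        (Fprim f ‖x‖ (fn u x + fn h x) - Fprim f ‖x‖ (fn u x) - f ‖x‖ (fn u x) * fn h x)) := by
  have hE : Integrable fun x => ((1 / 2) * ‖grad (u + h) x‖ ^ 2 +
      (1 / 2) * V ‖x‖ * fn (u + h) x ^ 2 - Fprim f ‖x‖ (fn (u + h) x))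
      - ((1 / 2) * ‖grad u x‖ ^ 2 + (1 / 2) * V ‖x‖ * fn u x ^ 2 - Fprim f ‖x‖ (fn u x)) :=
    (hb.integrable_energy _).sub (hb.integrable_energy _)
  rw [energy, energy, firstVar, ← integral_sub (hb.integrable_energy _) (hb.integrable_energy _),
    ← integral_sub hE (hb.integrable_firstVar u h)]
  refine integral_congr_ae ?_
  filter_upwards [fn_add u h, grad_add u h] with x h1 h2
  rw [h1, h2, norm_add_sq_real]
  ring

/-- First order expansion of the energy, with a locally uniform quadratic remainder. -/
lemma Bounds.abs_energy_add_sub_le (hb : Bounds n V f p B C K) (R : ℝ) : ∃ D, 0 ≤ D ∧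
    ∀ u h : H1 n, ‖u‖ ≤ R → ‖h‖ ≤ R →
      |energy V f (u + h) - energy V f u - firstVar V f u h| ≤ D * ‖h‖ ^ 2 := by
  obtain ⟨D, hD, hw⟩ := hb.weight_le R
  refine ⟨1 + B + C * D, by have := hb.B_nonneg; have := hb.C_nonneg; positivity,
    fun u h hu hh => ?_⟩
  obtain ⟨i, l⟩ := hw u h h h hu hh
  have iF : Integrable fun x => Fprim f ‖x‖ (fn u x + fn h x) - Fprim f ‖x‖ (fn u x)
      - f ‖x‖ (fn u x) * fn h x := by
    refine (((hb.integrable_Fprim (u + h)).sub (hb.integrable_Fprim u)).sub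
      (hb.integrable_f u h)).congr ?_
    filter_upwards [fn_add u h] with x h1
    simp only [Pi.sub_apply, h1]
  have b3 := (integrable_of_abs_le_weight (D := C) iF.1 i (by
    filter_upwards [hb.ae_pos] with x hx
    rw [weight, abs_mul_abs_self, ← sq, ← mul_assoc]
    exact hb.abs_Fprim_sub_le hx le_rfl)).2
  have i1 := (integrable_grad_sq h).const_mul (1 / 2)
  have i2 := (hb.integrable_V h h).const_mul (1 / 2)
  have i12 : Integrable fun x => 1 / 2 * ‖grad h x‖ ^ 2 + 1 / 2 * (V ‖x‖ * fn h x * fn h x) :=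
    i1.add i2
  rw [hb.energy_add_sub u h, integral_sub i12 iF, integral_add i1 i2, integral_const_mul,
    integral_const_mul]
  have b1 := integral_grad_sq_le h
  have b1' := integral_nonneg (μ := volume) (f := fun x => ‖grad h x‖ ^ 2) fun x => by positivity
  have b2 := hb.abs_integral_V_le h h
  have := mul_le_mul_of_nonneg_left l hb.C_nonneg
  rw [abs_le] at *
  have := hb.B_nonneg
  constructor <;> nlinarith [sq_nonneg ‖h‖]

/-- Second order expansion of the energy along a line. -/
lemma Bounds.tendsto_energy_add (hb : Bounds n V f p B C K) (u ψ : H1 n) :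
    Tendsto (fun t : ℝ => (energy V f (u + t • ψ) - energy V f u - t * firstVar V f u ψ) / t ^ 2)
      (𝓝[≠] 0) (𝓝 (1 / 2 * secondVar V f u ψ)) := by
  have e : ∀ t : ℝ, t ≠ 0 →
      (energy V f (u + t • ψ) - energy V f u - t * firstVar V f u ψ) / t ^ 2 =
      ∫ x, (1 / 2 * ‖grad ψ x‖ ^ 2 + 1 / 2 * (V ‖x‖ * fn ψ x * fn ψ x) -
        (Fprim f ‖x‖ (fn u x + t * fn ψ x) - Fprim f ‖x‖ (fn u x)
          - t * (f ‖x‖ (fn u x) * fn ψ x)) / t ^ 2) := by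
    intro t ht
    rw [← firstVar_smul, hb.energy_add_sub, ← integral_div]
    refine integral_congr_ae ?_
    filter_upwards [fn_smul t ψ, grad_smul t ψ] with x h1 h2
    rw [h1, h2, norm_smul, mul_pow, Real.norm_eq_abs, sq_abs]
    field_simp
  have e0 : 1 / 2 * secondVar V f u ψ = ∫ x, (1 / 2 * ‖grad ψ x‖ ^ 2 +
      1 / 2 * (V ‖x‖ * fn ψ x * fn ψ x) - 1 / 2 * (deriv (f ‖x‖) (fn u x) * fn ψ x ^ 2)) := by
    rw [secondVar, ← integral_const_mul]
    refine integral_congr_ae (Eventually.of_forall fun x => ?_)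
    ring
  rw [e0]
  have iq : Integrable fun x => 1 / 2 * ‖grad ψ x‖ ^ 2 + 1 / 2 * (V ‖x‖ * fn ψ x * fn ψ x) :=
    ((integrable_grad_sq ψ).const_mul (1 / 2)).add ((hb.integrable_V ψ ψ).const_mul (1 / 2))
  have iw := (hb.integrable_weight u ψ ψ ψ).const_mul C
  have key : Tendsto (fun t : ℝ => ∫ x, (1 / 2 * ‖grad ψ x‖ ^ 2 +
      1 / 2 * (V ‖x‖ * fn ψ x * fn ψ x) - (Fprim f ‖x‖ (fn u x + t * fn ψ x) - Fprim f ‖x‖ (fn u x)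
          - t * (f ‖x‖ (fn u x) * fn ψ x)) / t ^ 2)) (𝓝[≠] 0)
      (𝓝 (∫ x, (1 / 2 * ‖grad ψ x‖ ^ 2 +
      1 / 2 * (V ‖x‖ * fn ψ x * fn ψ x) - 1 / 2 * (deriv (f ‖x‖) (fn u x) * fn ψ x ^ 2)))) := by
    -- For `|t| ≤ 1` the quadratic remainder bound `Bounds.abs_Fprim_sub_le`, divided by `t²`, no
    -- longer depends on `t`; it provides the dominating function.
    refine tendsto_integral_filter_of_dominated_convergence
      (fun x => |1 / 2 * ‖grad ψ x‖ ^ 2 + 1 / 2 * (V ‖x‖ * fn ψ x * fn ψ x)|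
        + C * weight p u ψ ψ ψ x) (Eventually.of_forall fun t => ?_) ?_ (iq.abs.add iw) ?_
    · refine iq.1.sub ?_
      have h1 : AEStronglyMeasurable (fun x => Fprim f ‖x‖ (fn u x + t * fn ψ x)) volume := by
        refine (hb.aesm_Fprim (u + t • ψ)).congr ?_
        filter_upwards [fn_add u (t • ψ), fn_smul t ψ] with x h1 h2
        rw [h1, h2]
      have h2 := ((h1.sub (hb.aesm_Fprim u)).sub
        (((hb.aesm_f u).mul (fn_memLp ψ).1).const_mul t)).mul_const (t ^ 2)⁻¹
      simpa [div_eq_mul_inv] using! h2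
    · have hs : ∀ᶠ t : ℝ in 𝓝[≠] 0, |t| ≤ 1 := by
        refine nhdsWithin_le_nhds ?_
        filter_upwards [Metric.closedBall_mem_nhds (0 : ℝ) one_pos] with t ht
        simpa using ht
      filter_upwards [hs, self_mem_nhdsWithin] with t ht ht0
      filter_upwards [hb.ae_pos] with x hx
      refine (abs_sub _ _).trans (add_le_add le_rfl ?_)
      have ht2 : 0 < t ^ 2 := by
        have : t ≠ 0 := ht0
        positivity
      rw [abs_div, abs_of_pos ht2, div_le_iff₀ ht2]
      have hM : |fn u x| + |t * fn ψ x| ≤ |fn u x| + |fn ψ x| := by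
        rw [abs_mul]; nlinarith [abs_nonneg (fn ψ x)]
      have := hb.abs_Fprim_sub_le hx hM
      rw [weight, abs_mul_abs_self]
      have e1 : t * (f ‖x‖ (fn u x) * fn ψ x) = f ‖x‖ (fn u x) * (t * fn ψ x) := by ring
      rw [e1]
      refine this.trans (le_of_eq (by ring))
    · filter_upwards [hb.ae_pos] with x hx
      exact (hb.condF1.tendsto_Fprim hx (fn u x) (fn ψ x)).const_sub _
  refine key.congr' ?_
  filter_upwards [self_mem_nhdsWithin] with t ht
  exact (e t ht).symm

/-- A weak equation tested with test functions may be tested with elements of `H¹`. -/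
lemma Bounds.weak_eq_of_test (hb : Bounds n V f p B C K) (g a b : H1 n) {w : Eu n → ℝ} {D : ℝ}
    (hw : AEStronglyMeasurable w volume)
    (hle : ∀ᵐ x, |w x| ≤ D * ((1 + (|fn a x| + |fn a x|) ^ (p - 2)) * |fn b x|))
    (h0 : ∀ φ : Eu n → ℝ, IsTest φ → ∫ x, (inner ℝ (grad g x) (gradient φ x) + w x * φ x) = 0)
    (φ : H1 n) : ∫ x, (inner ℝ (grad g x) (grad φ x) + w x * fn φ x) = 0 := by
  have hD : ∀ χ : H1 n, ∀ᵐ x, |w x * fn χ x| ≤ D * weight p a a b χ x := fun χ => by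
    filter_upwards [hle] with x hx
    rw [abs_mul, weight, ← mul_assoc, ← mul_assoc, mul_assoc D]
    exact mul_le_mul_of_nonneg_right hx (abs_nonneg _)
  have hi : ∀ χ : H1 n, Integrable fun x => w x * fn χ x := fun χ =>
    (integrable_of_abs_le_weight (hw.mul (fn_memLp χ).1) (hb.integrable_weight a a b χ) (hD χ)).1
  obtain ⟨D', -, h'⟩ := hb.weight_le ‖a‖
  -- This functional is additive and bounded on `H¹`, and it vanishes on the dense set of test
  -- functions.
  let ℓ : H1 n → ℝ := fun χ => ∫ x, (inner ℝ (grad g x) (grad χ x) + w x * fn χ x)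
  have hb1 : ∀ χ, |ℓ χ| ≤ (‖g‖ + |D| * (D' * ‖b‖)) * ‖χ‖ := by
    intro χ
    have h1 := abs_integral_inner_grad_le g χ
    have h2 := (integrable_of_abs_le_weight (D := |D|) (hw.mul (fn_memLp χ).1)
      (hb.integrable_weight a a b χ) ((hD χ).mono fun x hx => hx.trans
        (mul_le_mul_of_nonneg_right (le_abs_self D) (weight_nonneg _ _ _ _ _ _)))).2
    have h3 := mul_le_mul_of_nonneg_left (h' a a b χ le_rfl le_rfl).2 (abs_nonneg D)
    simp only [ℓ]
    rw [integral_add (integrable_inner_grad g χ) (hi χ)]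
    refine (abs_add_le _ _).trans ?_
    simp only [Pi.mul_apply] at h2
    linarith
  have hsub : ∀ χ χ' : H1 n, ℓ (χ - χ') = ℓ χ - ℓ χ' := by
    intro χ χ'
    have hl : ∀ χ : H1 n, Integrable fun x => inner ℝ (grad g x) (grad χ x) + w x * fn χ x :=
      fun χ => (integrable_inner_grad g χ).add (hi χ)
    simp only [ℓ]
    rw [← integral_sub (hl χ) (hl χ')]
    refine integral_congr_ae ?_
    filter_upwards [fn_sub χ χ', grad_sub χ χ'] with x h1 h2
    simp only [h1, h2, inner_sub_right]
    ring
  obtain ⟨s, hs, ht⟩ := exists_seq_isTest_tendsto φ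
  have hz : ∀ k, ℓ (hs k).toH1 = 0 := fun k => by
    rw [← h0 _ (hs k)]
    refine integral_congr_ae ?_
    filter_upwards [(hs k).fn_toH1, (hs k).grad_toH1] with x h1 h2
    simp only [h1, h2]
  have hl : Tendsto (fun k => (‖g‖ + |D| * (D' * ‖b‖)) * ‖φ - (hs k).toH1‖) atTop (𝓝 0) := by
    have := ((tendsto_const_nhds (x := φ)).sub ht).norm.const_mul (‖g‖ + |D| * (D' * ‖b‖))
    simpa using this
  have : |ℓ φ| ≤ 0 := ge_of_tendsto' hl fun k => by
    have h1 := hb1 (φ - (hs k).toH1)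
    rwa [hsub, hz, sub_zero] at h1
  exact abs_nonpos_iff.mp this

/-- The weak equation with arbitrary `H¹` test functions, needed with `u` itself and with
eigenfunctions of the linearization. -/
lemma Bounds.firstVar_eq (hb : Bounds n V f p B C K) {lam : ℝ} {u : H1 n}
    (h : SolvesEq V f lam u) (φ : H1 n) : firstVar V f u φ = lam * l2 u φ := by
  have key := hb.weak_eq_of_test u u u (w := fun x => V ‖x‖ * fn u x - lam * fn u x
    - f ‖x‖ (fn u x)) (D := B + |lam| + C)
    (((hb.V_meas.aestronglyMeasurable.mul (fn_memLp u).1).sub ((fn_memLp u).1.const_mul lam)).sub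
      (hb.aesm_f u)) ?_ ?_ φ
  · rw [l2, ← integral_const_mul, ← sub_eq_zero, firstVar, ← integral_sub (hb.integrable_firstVar u φ)
      ((integrable_fn_mul u φ).const_mul lam), ← key]
    refine integral_congr_ae (Eventually.of_forall fun x => ?_)
    ring
  · filter_upwards [hb.ae_pos] with x hx
    have h1 := hb.abs_f_le hx (fn u x)
    have h2 := hb.rpow_le_weight u u x
    have h3 : 1 ≤ 1 + (|fn u x| + |fn u x|) ^ (p - 2) := le_add_of_nonneg_right (by positivity)
    have h4 := hb.V_le x
    have h5 := hb.C_nonneg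
    have h6 := hb.B_nonneg
    have h7 := abs_nonneg (fn u x)
    have h8 := abs_nonneg lam
    calc _ ≤ |V ‖x‖ * fn u x| + |lam * fn u x| + |f ‖x‖ (fn u x)| :=
          (abs_sub _ _).trans (add_le_add (abs_sub _ _) le_rfl)
      _ ≤ B * (1 * |fn u x|) + |lam| * (1 * |fn u x|)
          + C * ((1 + |fn u x| ^ (p - 2)) * |fn u x|) := by
          rw [abs_mul, abs_mul, one_mul, ← mul_assoc]
          gcongr
      _ ≤ B * ((1 + (|fn u x| + |fn u x|) ^ (p - 2)) * |fn u x|)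
          + |lam| * ((1 + (|fn u x| + |fn u x|) ^ (p - 2)) * |fn u x|)
          + C * ((1 + (|fn u x| + |fn u x|) ^ (p - 2)) * |fn u x|) := by gcongr
      _ = _ := by ring
  · intro ψ hψ
    rw [← h ψ hψ]
    refine integral_congr_ae (Eventually.of_forall fun x => ?_)
    ring

/-- The eigenvalue equation tested with `ψ`. The operator `L_u` contains `-λ` while `secondVar` does
not, hence `lam + μ`. -/
lemma Bounds.secondVar_eq (hb : Bounds n V f p B C K) {lam μ : ℝ} {u ψ : H1 n}
    (h : LinEigen V f lam u μ ψ) : secondVar V f u ψ = (lam + μ) * l2 ψ ψ := by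
  have key := hb.weak_eq_of_test ψ u ψ (w := fun x => V ‖x‖ * fn ψ x - (lam + μ) * fn ψ x
    - deriv (f ‖x‖) (fn u x) * fn ψ x) (D := B + |lam + μ| + C)
    (((hb.V_meas.aestronglyMeasurable.mul (fn_memLp ψ).1).sub
      ((fn_memLp ψ).1.const_mul (lam + μ))).sub ((hb.aesm_deriv u).mul (fn_memLp ψ).1)) ?_ ?_ ψ
  · rw [l2, ← integral_const_mul, ← sub_eq_zero, secondVar, ← integral_sub, ← key]
    · refine integral_congr_ae (Eventually.of_forall fun x => ?_)
      simp only [real_inner_self_eq_norm_sq]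
      ring
    · simp only [sq (fn ψ _), ← mul_assoc]
      exact ((integrable_grad_sq ψ).add (hb.integrable_V ψ ψ)).sub (hb.integrable_deriv u ψ ψ)
    · exact (integrable_fn_mul ψ ψ).const_mul _
  · filter_upwards [hb.ae_pos] with x hx
    have h1 := hb.abs_deriv_mul_le u hx
    have h3 : 1 ≤ 1 + (|fn u x| + |fn u x|) ^ (p - 2) := le_add_of_nonneg_right (by positivity)
    have h4 := hb.V_le x
    have h5 := hb.C_nonneg
    have h6 := hb.B_nonneg
    have h7 := abs_nonneg (fn ψ x)
    have h8 := abs_nonneg (lam + μ)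
    calc _ ≤ |V ‖x‖ * fn ψ x| + |(lam + μ) * fn ψ x| + |deriv (f ‖x‖) (fn u x) * fn ψ x| :=
          (abs_sub _ _).trans (add_le_add (abs_sub _ _) le_rfl)
      _ ≤ B * (1 * |fn ψ x|) + |lam + μ| * (1 * |fn ψ x|)
          + C * (1 + (|fn u x| + |fn u x|) ^ (p - 2)) * |fn ψ x| := by
          rw [abs_mul, abs_mul, abs_mul, one_mul]
          gcongr
      _ ≤ B * ((1 + (|fn u x| + |fn u x|) ^ (p - 2)) * |fn ψ x|)
          + |lam + μ| * ((1 + (|fn u x| + |fn u x|) ^ (p - 2)) * |fn ψ x|)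
          + C * (1 + (|fn u x| + |fn u x|) ^ (p - 2)) * |fn ψ x| := by gcongr
      _ = _ := by ring
  · intro φ hφ
    have h1 := h φ hφ
    have i : Integrable fun x => μ * fn ψ x * φ x := by
      refine (((integrable_fn_mul ψ hφ.toH1).const_mul μ)).congr ?_
      filter_upwards [hφ.fn_toH1] with x hx
      rw [hx]; ring
    have i2 : Integrable fun x => inner ℝ (grad ψ x) (gradient φ x) + V ‖x‖ * fn ψ x * φ x
        - lam * fn ψ x * φ x - deriv (f ‖x‖) (fn u x) * fn ψ x * φ x := by
      refine ((((integrable_inner_grad ψ hφ.toH1).add (hb.integrable_V ψ hφ.toH1)).sub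
        ((integrable_fn_mul ψ hφ.toH1).const_mul lam)).sub
          (hb.integrable_deriv u ψ hφ.toH1)).congr ?_
      filter_upwards [hφ.fn_toH1, hφ.grad_toH1] with x hx hx'
      simp only [Pi.sub_apply, Pi.add_apply, hx, hx', mul_assoc]
    rw [← sub_eq_zero, ← integral_sub i2 i] at h1
    rw [← h1]
    refine integral_congr_ae (Eventually.of_forall fun x => ?_)
    ring

end Forms

/-! ### Invariance under translations and sign change. -/

section Symmetry

variable {n : ℕ} {V : ℝ → ℝ} {f : ℝ → ℝ → ℝ} {p B C K : ℝ} {u w : H1 n} {y : Eu n}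

lemma IsTest.comp_add_right {φ : Eu n → ℝ} (h : IsTest φ) (y : Eu n) :
    IsTest fun x => φ (x + y) :=
  ⟨h.1.comp (contDiff_id.add contDiff_const), h.2.comp_homeomorph (Homeomorph.addRight y)⟩

lemma gradient_comp_add_right (φ : Eu n → ℝ) (y x : Eu n) :
    gradient (fun x => φ (x + y)) x = gradient φ (x + y) := by
  refine ext_inner_left ℝ fun e => ?_
  rw [inner_gradient, inner_gradient, fderiv_comp_add_right]

lemma IsTranslate.grad_eq (h : IsTranslate u w y) :
    grad w =ᵐ[volume] fun x => grad u (x + y) := by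
  have hm : MemLp (fun x => grad u (x + y)) 2 volume :=
    (grad_memLp u).comp_measurePreserving (measurePreserving_add_right volume y)
  refine (isWeakGrad w).unique ?_ ((grad_memLp w).locallyIntegrable (by norm_num))
    (hm.locallyIntegrable (by norm_num))
  intro φ hφ
  have e := isWeakGrad u _ (hφ.comp_add_right (-y))
  rw [← integral_add_right_eq_self _ y, ← integral_add_right_eq_self (fun x => φ (x + -y) • _) y]
    at e
  simp only [gradient_comp_add_right, add_neg_cancel_right] at e
  rw [← e]
  refine integral_congr_ae ?_
  filter_upwards [h] with x hx
  rw [hx]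

lemma IsTranslate.mass_eq (h : IsTranslate u w y) : mass w = mass u := by
  rw [mass, mass, ← integral_add_right_eq_self (fun x => fn u x ^ 2) y]
  congr 1
  refine integral_congr_ae ?_
  filter_upwards [h] with x hx
  rw [hx]

lemma TransEquiv.mass_eq (h : TransEquiv V f u w) : mass w = mass u := by
  obtain ⟨y, -, h⟩ := h
  exact h.mass_eq

/-- Reduces invariance statements to genuine translations in the autonomous case, where the
dependence on `‖x‖` can be removed. -/
lemma TransEquiv.eq_or (h : TransEquiv V f u w) :
    w = u ∨ ∃ y, Autonomous V f ∧ IsTranslate u w y := by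
  obtain ⟨y, h1, h2⟩ := h
  by_cases hy : y = 0
  · left
    refine H1.ext ?_
    filter_upwards [h2] with x hx
    rw [hx, hy, add_zero]
  · exact Or.inr ⟨y, h1 hy, h2⟩

lemma Autonomous.eq_one (ha : Autonomous V f) {r : ℝ} (hr : 0 < r) : f r = f 1 := by
  funext t; exact ha.2 r hr 1 one_pos t

lemma Bounds.energy_transEquiv (hb : Bounds n V f p B C K) (h : TransEquiv V f u w) :
    energy V f w = energy V f u := by
  rcases h.eq_or with rfl | ⟨y, ha, ht⟩
  · rfl
  have e : ∀ v : H1 n, energy V f v = ∫ x, ((1 / 2) * ‖grad v x‖ ^ 2 - Fprim f 1 (fn v x)) := by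
    intro v
    refine integral_congr_ae ?_
    filter_upwards [hb.ae_pos] with x hx
    rw [ha.1 _ hx, Fprim, Fprim, ha.eq_one hx]
    ring
  rw [e, e, ← integral_add_right_eq_self (fun x => (1 / 2) * ‖grad u x‖ ^ 2 - _) y]
  refine integral_congr_ae ?_
  filter_upwards [ht, ht.grad_eq] with x h1 h2
  rw [h1, h2]

lemma Bounds.solvesEq_transEquiv (hb : Bounds n V f p B C K) (h : TransEquiv V f u w) {lam : ℝ}
    (hs : SolvesEq V f lam u) : SolvesEq V f lam w := by
  rcases h.eq_or with rfl | ⟨y, ha, ht⟩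
  · exact hs
  intro φ hφ
  have e := hs _ (hφ.comp_add_right (-y))
  rw [← integral_add_right_eq_self _ y] at e
  rw [← e]
  simp only [gradient_comp_add_right, add_neg_cancel_right]
  refine integral_congr_ae ?_
  filter_upwards [ht, ht.grad_eq, hb.ae_pos,
    (measurePreserving_add_right volume y).quasiMeasurePreserving.ae hb.ae_pos] with x h1 h2 h3 h4
  rw [h1, h2, ha.1 _ h3, ha.1 _ h4, ha.eq_one h3, ha.eq_one h4]

lemma Bounds.transEquiv_mem_S (hb : Bounds n V f p B C K) (h : TransEquiv V f u w) {c : ℝ}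
    (hu : u ∈ S n V f c) : w ∈ S n V f c :=
  ⟨h.mass_eq.trans hu.1, (hb.energy_transEquiv h).trans hu.2⟩

lemma Bounds.neg_mem_S (hb : Bounds n V f p B C K) {c : ℝ} (hu : u ∈ S n V f c) :
    -u ∈ S n V f c := by
  refine ⟨?_, ?_⟩
  · have := mass_smul (-1) u
    rw [neg_one_smul] at this
    change mass (-u) = c
    rw [this, show mass u = c from hu.1]; ring
  · rw [← hu.2]
    refine integral_congr_ae ?_
    filter_upwards [fn_neg u, grad_neg u, hb.ae_pos] with x h1 h2 h3
    rw [h1, h2, hb.condF1.Fprim_neg h3, norm_neg, neg_sq]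

lemma Bounds.neg_solvesEq (hb : Bounds n V f p B C K) {lam : ℝ} (hu : SolvesEq V f lam u) :
    SolvesEq V f lam (-u) := by
  intro φ hφ
  rw [← neg_zero, ← hu φ hφ, ← integral_neg]
  refine integral_congr_ae ?_
  filter_upwards [fn_neg u, grad_neg u, hb.ae_pos] with x h1 h2 h3
  rw [h1, h2, hb.condF1.odd _ h3, inner_neg_left]
  ring

lemma Bounds.solvesEq_of_firstVar (hb : Bounds n V f p B C K) {lam : ℝ}
    (h : ∀ φ, firstVar V f u φ = lam * l2 u φ) : SolvesEq V f lam u := by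
  intro φ hφ
  have e := h hφ.toH1
  rw [← sub_eq_zero, l2, firstVar, ← integral_const_mul,
    ← integral_sub (hb.integrable_firstVar u _) ((integrable_fn_mul u _).const_mul lam)] at e
  rw [← e]
  refine integral_congr_ae ?_
  filter_upwards [hφ.fn_toH1, hφ.grad_toH1] with x h1 h2
  rw [h1, h2]
  ring

lemma mass_pos_of_ne_zero (hu : u ≠ 0) : 0 < mass u := by
  refine lt_of_le_of_ne (mass_nonneg u) fun h => hu (H1.ext ?_)
  have h1 : ∫ x, fn u x ^ 2 = 0 := by
    unfold mass at h; linarith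
  rw [integral_eq_zero_iff_of_nonneg (fun x => by positivity) (integrable_fn_sq u)] at h1
  filter_upwards [h1, fn_zero (n := n)] with x hx h0
  rw [h0]
  simpa using hx

lemma Bounds.ne_zero_of_posRadDecr (hb : Bounds n V f p B C K) (h : PosRadDecr u) : u ≠ 0 := by
  rintro rfl
  obtain ⟨g, hg, -, he⟩ := h
  obtain ⟨x, h1, h2, h3⟩ := (he.and ((fn_zero (n := n)).and hb.ae_pos)).exists
  rw [h2] at h1
  exact (hg _ h3).ne h1

end Symmetry

/-! ### Multipliers, one-sided derivatives and local strict concavity of the minimal energy. -/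

section MinimalEnergy

variable {n : ℕ} {V : ℝ → ℝ} {f : ℝ → ℝ → ℝ} {p B C K : ℝ} {I : Set ℝ}

/-- Positivity is not imposed on the interval. It follows because some ground state is a positive
function, hence nonzero. -/
lemma Bounds.mass_pos (hb : Bounds n V f p B C K) (hA1 : CondA1 n V f I) {c : ℝ} (hc : c ∈ I) :
    0 < c := by
  obtain ⟨u, hu⟩ := hA1.nonempty c hc
  obtain ⟨w, hw, h⟩ := hA1.posRadDecr c hc u hu
  have hp := mass_pos_of_ne_zero (hb.ne_zero_of_posRadDecr hw)
  have : w ∈ S n V f c := by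
    rcases h with h | h
    · exact hb.transEquiv_mem_S h hu
    · exact hb.transEquiv_mem_S h (hb.neg_mem_S hu)
  rwa [show mass w = c from this.1] at hp

lemma l2_self_of_mem_S {c : ℝ} {u : H1 n} (hu : u ∈ S n V f c) : l2 u u = 2 * c := by
  have := mass_eq u
  rw [show mass u = c from hu.1] at this
  linarith

/-- The Lagrange multiplier of a ground state is unique. -/
lemma Bounds.multiplier_unique (hb : Bounds n V f p B C K) (hA1 : CondA1 n V f I) {c : ℝ}
    (hc : c ∈ I) {u : H1 n} (hu : u ∈ S n V f c) {lam lam' : ℝ} (h : SolvesEq V f lam u)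
    (h' : SolvesEq V f lam' u) : lam = lam' := by
  have e := (hb.firstVar_eq h u).symm.trans (hb.firstVar_eq h' u)
  rw [l2_self_of_mem_S hu] at e
  exact mul_right_cancel₀ (by have := hb.mass_pos hA1 hc; positivity) e

/-- (A1) provides some multiplier below `Λ₀ ≤ 0`; uniqueness identifies it with the given one. -/
lemma Bounds.multiplier_neg (hb : Bounds n V f p B C K) (hA1 : CondA1 n V f I) {c : ℝ}
    (hc : c ∈ I) {lam : ℝ} (h : lam ∈ T n V f c) : lam < 0 := by
  obtain ⟨u, hu, hs⟩ := h
  obtain ⟨lam', h1, h2, h3, -⟩ := hA1.multiplier c hc u hu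
  rw [hb.multiplier_unique hA1 hc hu hs h3]
  linarith

lemma CondA1.T_nonempty (hA1 : CondA1 n V f I) {c : ℝ} (hc : c ∈ I) : (T n V f c).Nonempty := by
  obtain ⟨u, hu⟩ := hA1.nonempty c hc
  obtain ⟨lam, -, -, h3, -⟩ := hA1.multiplier c hc u hu
  exact ⟨lam, u, hu, h3⟩

lemma CondA1.m_le (hA1 : CondA1 n V f I) {u : H1 n} (h : mass u ∈ I) :
    m n V f (mass u) ≤ energy V f u :=
  csInf_le (hA1.bddBelow _ h) ⟨u, rfl, rfl⟩

/-- Positive radial decreasing ground states with a given multiplier. -/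
lemma Bounds.exists_posRadDecr (hb : Bounds n V f p B C K) (hA1 : CondA1 n V f I) {c : ℝ}
    (hc : c ∈ I) {lam : ℝ} (h : lam ∈ T n V f c) :
    ∃ u ∈ S n V f c, PosRadDecr u ∧ SolvesEq V f lam u := by
  obtain ⟨u, hu, hs⟩ := h
  obtain ⟨w, hw, h | h⟩ := hA1.posRadDecr c hc u hu
  · exact ⟨w, hb.transEquiv_mem_S h hu, hw, hb.solvesEq_transEquiv h hs⟩
  · exact ⟨w, hb.transEquiv_mem_S h (hb.neg_mem_S hu), hw,
      hb.solvesEq_transEquiv h (hb.neg_solvesEq hs)⟩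

/-- Dilating a ground state gives a supporting parabola of `m`. -/
lemma Bounds.m_le_of_mem_S (hb : Bounds n V f p B C K) (hA1 : CondA1 n V f I) (R : ℝ) {c₀ : ℝ}
    (hc₀ : 0 < c₀) : ∃ D, 0 ≤ D ∧ ∀ (c lam t : ℝ) (u : H1 n), c₀ ≤ c → u ∈ S n V f c →
      SolvesEq V f lam u → ‖u‖ ≤ R → |lam| ≤ R → t ∈ I → |t - c| ≤ c →
      m n V f t ≤ m n V f c + lam * (t - c) + D * (t - c) ^ 2 := by
  obtain ⟨D, hD, h⟩ := hb.abs_energy_add_sub_le R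
  -- With `t = c s²` one has `t - c = 2 c (s - 1) + c (s - 1)²`. The first summand absorbs `λ c (s -
  -- 1)²`, the second the quadratic remainder of the energy at the increment `(s - 1) u`.
  refine ⟨|R| / c₀ + D * R ^ 2 / c₀ ^ 2, by positivity,
    fun c lam t u hc hu hs huR hlR ht htc => ?_⟩
  have hcp : 0 < c := hc₀.trans_le hc
  have htp := hb.mass_pos hA1 ht
  set s := Real.sqrt (t / c) with hs_def
  have hs2 : s ^ 2 = t / c := Real.sq_sqrt (by positivity)
  have hs0 : 0 ≤ s := Real.sqrt_nonneg _
  have ht_eq : t = c * s ^ 2 := by rw [hs2]; field_simp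
  -- Since `t - c = (s - 1) (s + 1) c` and `s + 1 ≥ 1`. Together with `|t - c| ≤ c` this gives `|s -
  -- 1| ≤ 1`, so the increment stays in the ball of radius `R`.
  have h1 : |s - 1| * c ≤ |t - c| := by
    have : t - c = (s - 1) * ((s + 1) * c) := by rw [ht_eq]; ring
    rw [this, abs_mul, abs_of_nonneg (show 0 ≤ (s + 1) * c by positivity)]
    have := abs_nonneg (s - 1)
    nlinarith [mul_nonneg (mul_nonneg this hs0) hcp.le]
  have h2 : |s - 1| ≤ 1 := by
    have := h1.trans htc
    nlinarith
  have h3 : ‖(s - 1) • u‖ ≤ R := by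
    rw [norm_smul, Real.norm_eq_abs]
    nlinarith [norm_nonneg u]
  have hsu : u + (s - 1) • u = s • u := by rw [sub_smul, one_smul]; abel
  have hmass : mass (s • u) = t := by
    rw [mass_smul, show mass u = c from hu.1, ht_eq]; ring
  have h4 := h u ((s - 1) • u) huR h3
  rw [firstVar_smul, hb.firstVar_eq hs, l2_self_of_mem_S hu, hsu, hu.2] at h4
  have h5 : m n V f t ≤ energy V f (s • u) := by
    have := hA1.m_le (u := s • u) (by rwa [hmass])
    rwa [hmass] at this
  have h6 : (s - 1) ^ 2 * c ^ 2 ≤ (t - c) ^ 2 := by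
    have := pow_le_pow_left₀ (by positivity) h1 2
    rwa [mul_pow, sq_abs, sq_abs] at this
  have h7 := (abs_le.mp h4).2
  have h8 : ‖(s - 1) • u‖ ^ 2 ≤ (s - 1) ^ 2 * R ^ 2 := by
    rw [norm_smul, mul_pow, Real.norm_eq_abs, sq_abs]
    gcongr
  have h9 : (s - 1) ^ 2 * c ≤ (t - c) ^ 2 / c₀ := by
    rw [le_div_iff₀ hc₀]
    refine le_trans ?_ h6
    rw [mul_assoc, sq c]
    gcongr
  have h10 : (s - 1) ^ 2 ≤ (t - c) ^ 2 / c₀ ^ 2 := by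
    rw [le_div_iff₀ (by positivity)]
    refine le_trans ?_ h6
    gcongr
  have h11 : -lam * ((s - 1) ^ 2 * c) ≤ |R| * ((t - c) ^ 2 / c₀) := by
    have : -lam ≤ |R| := (neg_le_abs lam).trans (hlR.trans (le_abs_self R))
    exact mul_le_mul this h9 (by positivity) (abs_nonneg R)
  have h12 : D * ‖(s - 1) • u‖ ^ 2 ≤ D * R ^ 2 * ((t - c) ^ 2 / c₀ ^ 2) := by
    have h0 := mul_le_mul_of_nonneg_left h8 hD
    have h0' := mul_le_mul_of_nonneg_left h10 (show 0 ≤ D * R ^ 2 by positivity)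
    linarith
  have e : lam * (t - c) = (s - 1) * (lam * (2 * c)) + lam * ((s - 1) ^ 2 * c) := by
    rw [ht_eq]; ring
  have e2 : (|R| / c₀ + D * R ^ 2 / c₀ ^ 2) * (t - c) ^ 2
      = |R| * ((t - c) ^ 2 / c₀) + D * R ^ 2 * ((t - c) ^ 2 / c₀ ^ 2) := by ring
  rw [e2, e]
  linarith

/-- Compactness of ground states and their multipliers. -/
lemma Bounds.exists_subseq (hb : Bounds n V f p B C K) (hA1 : CondA1 n V f I)
    (hA3 : CondA3 n V f I) {c : ℝ} (hc : c ∈ I) {t lam : ℕ → ℝ} (htI : ∀ k, t k ∈ I)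
    (ht : Tendsto t atTop (𝓝 c)) (hlam : ∀ k, lam k ∈ T n V f (t k)) :
    ∃ σ : ℕ → ℕ, StrictMono σ ∧ ∃ w : ℕ → H1 n, (∀ k, w k ∈ S n V f (t (σ k))) ∧
      (∀ k, SolvesEq V f (lam (σ k)) (w k)) ∧ ∃ u ∈ S n V f c, ∃ l, Tendsto w atTop (𝓝 u) ∧
        SolvesEq V f l u ∧ Tendsto (fun k => lam (σ k)) atTop (𝓝 l) := by
  choose v hv hs using hlam
  have hm : Tendsto (fun k => m n V f (t k)) atTop (𝓝 (m n V f c)) :=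
    (hA1.continuousOn c hc).tendsto.comp
      (tendsto_nhdsWithin_iff.mpr ⟨ht, Eventually.of_forall htI⟩)
  -- By continuity of `m`, ground states at the masses `t k` satisfy `E (v k) = m (t k) → m c`, so
  -- the compactness at mass `c` applies to them.
  obtain ⟨σ, hσ, w, hw, u, hu, hwu⟩ := hA3 c hc v
    (by simpa only [show ∀ k, mass (v k) = t k from fun k => (hv k).1] using ht)
    (by simpa only [show ∀ k, energy V f (v k) = m n V f (t k) from fun k => (hv k).2] using hm)
  have hwS : ∀ k, w k ∈ S n V f (t (σ k)) := fun k => hb.transEquiv_mem_S (hw k) (hv _)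
  have hws : ∀ k, SolvesEq V f (lam (σ k)) (w k) := fun k => hb.solvesEq_transEquiv (hw k) (hs _)
  have hfv : ∀ φ, Tendsto (fun k => firstVar V f (w k) φ) atTop (𝓝 (firstVar V f u φ)) := by
    intro φ
    obtain ⟨R, hR⟩ := hwu.norm.bddAbove_range
    obtain ⟨D, hD, h⟩ := hb.abs_firstVar_sub_le (max R ‖u‖)
    rw [tendsto_iff_norm_sub_tendsto_zero]
    refine squeeze_zero (fun _ => norm_nonneg _) (fun k => h (w k) u φ
      ((hR (mem_range_self k)).trans (le_max_left _ _)) (le_max_right _ _)) ?_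
    have := ((tendsto_iff_norm_sub_tendsto_zero.mp hwu).mul_const ‖φ‖).const_mul D
    simpa using this
  have hl0 : l2 u u ≠ 0 := by
    rw [l2_self_of_mem_S hu]
    have := hb.mass_pos hA1 hc
    positivity
  have hl2 : Tendsto (fun k => l2 (w k) u) atTop (𝓝 (l2 u u)) := tendsto_l2_left hwu u
  -- Testing the equation of `w k` with the limit `u` expresses its multiplier as a quotient that
  -- converges.
  have hlam : Tendsto (fun k => lam (σ k)) atTop (𝓝 (firstVar V f u u / l2 u u)) := by
    refine ((hfv u).div hl2 hl0).congr' ?_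
    filter_upwards [hl2.eventually_ne hl0] with k hk
    rw [Pi.div_apply, hb.firstVar_eq (hws k), mul_div_cancel_right₀ _ hk]
  refine ⟨σ, hσ, w, hwS, hws, u, hu, _, hwu, hb.solvesEq_of_firstVar fun φ => ?_, hlam⟩
  refine tendsto_nhds_unique (hfv φ) ?_
  simp only [fun k => hb.firstVar_eq (hws k) φ]
  exact hlam.mul (tendsto_l2_left hwu φ)

/-- The two inequalities behind the one-sided differentiability of `m`. -/
lemma Bounds.exists_subseq_le (hb : Bounds n V f p B C K) (hA1 : CondA1 n V f I)
    (hA3 : CondA3 n V f I) {c : ℝ} (hc : c ∈ I) {t lam : ℕ → ℝ} (htI : ∀ k, t k ∈ I)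
    (ht : Tendsto t atTop (𝓝 c)) (hlam : ∀ k, lam k ∈ T n V f (t k)) :
    ∃ σ : ℕ → ℕ, StrictMono σ ∧ ∃ l ∈ T n V f c, Tendsto (fun k => lam (σ k)) atTop (𝓝 l) ∧
      (∃ D, ∀ᶠ k in atTop, m n V f c ≤ m n V f (t (σ k)) + lam (σ k) * (c - t (σ k))
        + D * (c - t (σ k)) ^ 2) ∧
      ∀ ν ∈ T n V f c, ∃ D, ∀ᶠ k in atTop, m n V f (t (σ k)) ≤ m n V f c
        + ν * (t (σ k) - c) + D * (t (σ k) - c) ^ 2 := by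
  obtain ⟨σ, hσ, w, hwS, hws, u, hu, l, hwu, hul, hlam'⟩ :=
    hb.exists_subseq hA1 hA3 hc htI ht hlam
  have hcp := hb.mass_pos hA1 hc
  have hts : Tendsto (fun k => t (σ k)) atTop (𝓝 c) := ht.comp hσ.tendsto_atTop
  have hd : Tendsto (fun k => |t (σ k) - c|) atTop (𝓝 0) := by
    simpa using (hts.sub_const c).abs
  refine ⟨σ, hσ, l, ⟨u, hu, hul⟩, hlam', ?_, ?_⟩
  -- The parabola based at `t (σ k)` and evaluated at `c`. Its constant is uniform in `k`: the
  -- ground states and multipliers converge, and the masses are eventually at least `c / 2`.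
  · obtain ⟨R₁, hR₁⟩ := hwu.norm.bddAbove_range
    obtain ⟨R₂, hR₂⟩ := hlam'.abs.bddAbove_range
    obtain ⟨D, -, h⟩ := hb.m_le_of_mem_S hA1 (max R₁ R₂) (half_pos hcp)
    refine ⟨D, ?_⟩
    filter_upwards [hts.eventually_const_le (half_lt_self hcp),
      hd.eventually_le_const (half_pos hcp)] with k h1 h2
    exact h _ _ _ (w k) h1 (hwS k) (hws k) ((hR₁ (mem_range_self k)).trans (le_max_left _ _))
      ((hR₂ (mem_range_self k)).trans (le_max_right _ _)) hc
      (by rw [abs_sub_comm]; exact h2.trans h1)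
  · rintro ν ⟨v, hv, hvs⟩
    obtain ⟨D, -, h⟩ := hb.m_le_of_mem_S hA1 (max ‖v‖ |ν|) hcp
    refine ⟨D, ?_⟩
    filter_upwards [hd.eventually_le_const hcp] with k h2
    exact h _ _ _ v le_rfl hv hvs (le_max_left _ _) (le_max_right _ _) (htI _) h2

/-- The two parabolas give `sel t - D (t - c) ≤ slope ≤ ν + D' (t - c)` for every multiplier `ν` at
`c`. Hence the limit `l` of `sel t` is at most every `ν`; as it is itself a multiplier, taking `ν =
l` squeezes the slope. -/
lemma Bounds.exists_seq_right (hb : Bounds n V f p B C K) (hA1 : CondA1 n V f I)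
    (hA3 : CondA3 n V f I) (hI : IsOpen I) {c : ℝ} (hc : c ∈ I) {sel : ℝ → ℝ}
    (hsel : ∀ t ∈ I, sel t ∈ T n V f t) {t : ℕ → ℝ} (ht : Tendsto t atTop (𝓝[>] c)) :
    ∃ (ms : ℕ → ℕ) (l : ℝ), IsLeast (T n V f c) l ∧ Tendsto (fun k => sel (t (ms k))) atTop (𝓝 l) ∧
      Tendsto (fun k => slope (m n V f) c (t (ms k))) atTop (𝓝 l) := by
  obtain ⟨ht1, ht2⟩ := tendsto_nhdsWithin_iff.mp ht
  obtain ⟨N, hN⟩ := eventually_atTop.mp (ht2.and (ht1.eventually (hI.mem_nhds hc)))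
  have htN : Tendsto (fun k => t (k + N)) atTop (𝓝 c) := ht1.comp (tendsto_add_atTop_nat N)
  obtain ⟨σ, hσ, l, hl, hlim, ⟨D, hD⟩, hup⟩ := hb.exists_subseq_le hA1 hA3 hc
    (fun k => (hN (k + N) (by omega)).2) htN fun k => hsel _ (hN (k + N) (by omega)).2
  have hpos : ∀ k, 0 < t (σ k + N) - c := fun k => sub_pos.mpr (hN (σ k + N) (by omega)).1
  have hts : Tendsto (fun k => t (σ k + N) - c) atTop (𝓝 0) := by
    simpa using (htN.comp hσ.tendsto_atTop).sub_const c
  have hlo : ∀ᶠ k in atTop, sel (t (σ k + N)) - D * (t (σ k + N) - c) ≤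
      slope (m n V f) c (t (σ k + N)) := by
    filter_upwards [hD] with k hk
    rw [slope_def_field, le_div_iff₀ (hpos k)]
    nlinarith
  have hlo_t : Tendsto (fun k => sel (t (σ k + N)) - D * (t (σ k + N) - c)) atTop (𝓝 l) := by
    simpa using hlim.sub (hts.const_mul D)
  have hup' : ∀ ν ∈ T n V f c, ∃ D, ∀ᶠ k in atTop, slope (m n V f) c (t (σ k + N)) ≤
      ν + D * (t (σ k + N) - c) := by
    intro ν hν
    obtain ⟨D', hD'⟩ := hup ν hν
    refine ⟨D', ?_⟩
    filter_upwards [hD'] with k hk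
    rw [slope_def_field, div_le_iff₀ (hpos k)]
    nlinarith
  have hup_t : ∀ ν D, Tendsto (fun k => ν + D * (t (σ k + N) - c)) atTop (𝓝 ν) := by
    intro ν D
    simpa using (hts.const_mul D).const_add ν
  refine ⟨fun k => σ k + N, l, ⟨hl, fun ν hν => ?_⟩, hlim, ?_⟩
  · obtain ⟨D', hD'⟩ := hup' ν hν
    exact le_of_tendsto_of_tendsto hlo_t (hup_t ν D') (hlo.mp (hD'.mono fun k h1 h2 => h2.trans h1))
  · obtain ⟨D', hD'⟩ := hup' l hl
    exact tendsto_of_tendsto_of_tendsto_of_le_of_le' hlo_t (hup_t l D') hlo hD'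

/-- Now `t - c < 0`, so division reverses both inequalities and the limit becomes the greatest
multiplier. -/
lemma Bounds.exists_seq_left (hb : Bounds n V f p B C K) (hA1 : CondA1 n V f I)
    (hA3 : CondA3 n V f I) (hI : IsOpen I) {c : ℝ} (hc : c ∈ I) {sel : ℝ → ℝ}
    (hsel : ∀ t ∈ I, sel t ∈ T n V f t) {t : ℕ → ℝ} (ht : Tendsto t atTop (𝓝[<] c)) :
    ∃ (ms : ℕ → ℕ) (l : ℝ), IsGreatest (T n V f c) l ∧
      Tendsto (fun k => sel (t (ms k))) atTop (𝓝 l) ∧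
      Tendsto (fun k => slope (m n V f) c (t (ms k))) atTop (𝓝 l) := by
  obtain ⟨ht1, ht2⟩ := tendsto_nhdsWithin_iff.mp ht
  obtain ⟨N, hN⟩ := eventually_atTop.mp (ht2.and (ht1.eventually (hI.mem_nhds hc)))
  have htN : Tendsto (fun k => t (k + N)) atTop (𝓝 c) := ht1.comp (tendsto_add_atTop_nat N)
  obtain ⟨σ, hσ, l, hl, hlim, ⟨D, hD⟩, hup⟩ := hb.exists_subseq_le hA1 hA3 hc
    (fun k => (hN (k + N) (by omega)).2) htN fun k => hsel _ (hN (k + N) (by omega)).2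
  have hneg : ∀ k, t (σ k + N) - c < 0 := fun k => sub_neg.mpr (hN (σ k + N) (by omega)).1
  have hts : Tendsto (fun k => t (σ k + N) - c) atTop (𝓝 0) := by
    simpa using (htN.comp hσ.tendsto_atTop).sub_const c
  have hlo : ∀ᶠ k in atTop, slope (m n V f) c (t (σ k + N)) ≤
      sel (t (σ k + N)) - D * (t (σ k + N) - c) := by
    filter_upwards [hD] with k hk
    rw [slope_def_field, div_le_iff_of_neg (hneg k)]
    nlinarith
  have hlo_t : Tendsto (fun k => sel (t (σ k + N)) - D * (t (σ k + N) - c)) atTop (𝓝 l) := by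
    simpa using hlim.sub (hts.const_mul D)
  have hup' : ∀ ν ∈ T n V f c, ∃ D, ∀ᶠ k in atTop, ν + D * (t (σ k + N) - c) ≤
      slope (m n V f) c (t (σ k + N)) := by
    intro ν hν
    obtain ⟨D', hD'⟩ := hup ν hν
    refine ⟨D', ?_⟩
    filter_upwards [hD'] with k hk
    rw [slope_def_field, le_div_iff_of_neg (hneg k)]
    nlinarith
  have hup_t : ∀ ν D, Tendsto (fun k => ν + D * (t (σ k + N) - c)) atTop (𝓝 ν) := by
    intro ν D
    simpa using (hts.const_mul D).const_add ν
  refine ⟨fun k => σ k + N, l, ⟨hl, fun ν hν => ?_⟩, hlim, ?_⟩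
  · obtain ⟨D', hD'⟩ := hup' ν hν
    exact le_of_tendsto_of_tendsto (hup_t ν D') hlo_t (hlo.mp (hD'.mono fun k h1 h2 => h1.trans h2))
  · obtain ⟨D', hD'⟩ := hup' l hl
    exact tendsto_of_tendsto_of_tendsto_of_le_of_le' (hup_t l D') hlo_t hD' hlo

/-- The minimum is attained as a limit of arbitrarily chosen multipliers at masses decreasing to
`c`. -/
lemma Bounds.isLeast_lamMin (hb : Bounds n V f p B C K) (hA1 : CondA1 n V f I)
    (hA3 : CondA3 n V f I) (hI : IsOpen I) {c : ℝ} (hc : c ∈ I) :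
    IsLeast (T n V f c) (lamMin n V f c) := by
  obtain ⟨t, ht⟩ := exists_seq_tendsto (𝓝[>] c)
  obtain ⟨sel, hsel⟩ : ∃ sel : ℝ → ℝ, ∀ t ∈ I, sel t ∈ T n V f t := by
    choose! sel hsel using fun t (h : t ∈ I) => hA1.T_nonempty h
    exact ⟨sel, hsel⟩
  obtain ⟨-, l, hl, -⟩ := hb.exists_seq_right hA1 hA3 hI hc hsel ht
  rwa [lamMin, hl.csInf_eq]

lemma Bounds.isGreatest_lamMax (hb : Bounds n V f p B C K) (hA1 : CondA1 n V f I)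
    (hA3 : CondA3 n V f I) (hI : IsOpen I) {c : ℝ} (hc : c ∈ I) :
    IsGreatest (T n V f c) (lamMax n V f c) := by
  obtain ⟨t, ht⟩ := exists_seq_tendsto (𝓝[<] c)
  obtain ⟨sel, hsel⟩ : ∃ sel : ℝ → ℝ, ∀ t ∈ I, sel t ∈ T n V f t := by
    choose! sel hsel using fun t (h : t ∈ I) => hA1.T_nonempty h
    exact ⟨sel, hsel⟩
  obtain ⟨-, l, hl, -⟩ := hb.exists_seq_left hA1 hA3 hI hc hsel ht
  rwa [lamMax, hl.csSup_eq]

/-- The selection is arbitrary, so `lamMin` and `lamMax` are covered alike. Every sequence has a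
subsequence along which the limit is the same least multiplier, which gives full convergence. -/
lemma Bounds.tendsto_right (hb : Bounds n V f p B C K) (hA1 : CondA1 n V f I)
    (hA3 : CondA3 n V f I) (hI : IsOpen I) {c : ℝ} (hc : c ∈ I) {sel : ℝ → ℝ}
    (hsel : ∀ t ∈ I, sel t ∈ T n V f t) :
    Tendsto sel (𝓝[>] c) (𝓝 (lamMin n V f c)) ∧
      HasDerivWithinAt (m n V f) (lamMin n V f c) (Ioi c) c := by
  have hleast := hb.isLeast_lamMin hA1 hA3 hI hc
  refine ⟨tendsto_of_subseq_tendsto fun t ht => ?_,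
    (hasDerivWithinAt_iff_tendsto_slope' self_notMem_Ioi).mpr <|
      tendsto_of_subseq_tendsto fun t ht => ?_⟩
  all_goals
    obtain ⟨ms, l, hl, h1, h2⟩ := hb.exists_seq_right hA1 hA3 hI hc hsel ht
    obtain rfl := hl.unique hleast
    exact ⟨ms, by assumption⟩

lemma Bounds.tendsto_left (hb : Bounds n V f p B C K) (hA1 : CondA1 n V f I)
    (hA3 : CondA3 n V f I) (hI : IsOpen I) {c : ℝ} (hc : c ∈ I) {sel : ℝ → ℝ}
    (hsel : ∀ t ∈ I, sel t ∈ T n V f t) :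
    Tendsto sel (𝓝[<] c) (𝓝 (lamMax n V f c)) ∧
      HasDerivWithinAt (m n V f) (lamMax n V f c) (Iio c) c := by
  have hgreatest := hb.isGreatest_lamMax hA1 hA3 hI hc
  refine ⟨tendsto_of_subseq_tendsto fun t ht => ?_,
    (hasDerivWithinAt_iff_tendsto_slope' self_notMem_Iio).mpr <|
      tendsto_of_subseq_tendsto fun t ht => ?_⟩
  all_goals
    obtain ⟨ms, l, hl, h1, h2⟩ := hb.exists_seq_left hA1 hA3 hI hc hsel ht
    obtain rfl := hl.unique hgreatest
    exact ⟨ms, by assumption⟩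

/-- At every mass, `m` lies strictly below a line through its graph, locally. -/
lemma Bounds.eventually_m_lt (hb : Bounds n V f p B C K) (hA1 : CondA1 n V f I)
    (hA3 : CondA3 n V f I) (hI : IsOpen I) {c : ℝ} (hc : c ∈ I) :
    ∀ᶠ t in 𝓝[≠] c, m n V f t < m n V f c + lamMin n V f c * (t - c) := by
  obtain ⟨u, hu, hs⟩ := (hb.isLeast_lamMin hA1 hA3 hI hc).1
  obtain ⟨lam', -, -, hs', μ, hμ, ψ, hψ, hψe, -⟩ := hA1.multiplier c hc u hu
  obtain rfl := hb.multiplier_unique hA1 hc hu hs' hs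
  set lam := lamMin n V f c with hlam
  have hQ : 0 < mass ψ := mass_pos_of_ne_zero hψ
  have hsel : ∀ t ∈ I, lamMin n V f t ∈ T n V f t := fun t ht =>
    (hb.isLeast_lamMin hA1 hA3 hI ht).1
  have hlim := hb.tendsto_energy_add u ψ
  have hsv : 1 / 2 * secondVar V f u ψ = (lam + μ) * mass ψ := by
    rw [hb.secondVar_eq hψe, mass_eq]; ring
  rw [hsv, hb.firstVar_eq hs, hu.2] at hlim
  have hmass : ∀ t : ℝ, mass (u + t • ψ) = c + (t * l2 u ψ + t ^ 2 * mass ψ) := fun t => by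
    rw [mass_add, l2_smul_right, mass_smul, show mass u = c from hu.1]; ring
  have hct : Tendsto (fun t : ℝ => c + (t * l2 u ψ + t ^ 2 * mass ψ)) (𝓝 0) (𝓝 c) := by
    have : Continuous fun t : ℝ => c + (t * l2 u ψ + t ^ 2 * mass ψ) := by fun_prop
    simpa using this.tendsto 0
  have hle : ∀ᶠ t : ℝ in 𝓝 0, m n V f (c + (t * l2 u ψ + t ^ 2 * mass ψ)) ≤
      energy V f (u + t • ψ) := by
    filter_upwards [hct.eventually (hI.mem_nhds hc)] with t ht
    rw [← hmass]
    exact hA1.m_le (by rwa [hmass])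
  -- Otherwise `u + tψ` has mass `c + t² Q(ψ)`, and its energy forces the right derivative of `m` to
  -- be at most `lam + μ < lam`. That derivative equals `lam` because `u` was taken with the least
  -- multiplier.
  have hne : l2 u ψ ≠ 0 := by
    intro h0
    simp only [h0, mul_zero, zero_add, sub_zero] at hlim hle hct
    have hr := (hasDerivWithinAt_iff_tendsto_slope' self_notMem_Ioi).mp
      (hb.tendsto_right hA1 hA3 hI hc hsel).2
    have hcw : Tendsto (fun t : ℝ => c + t ^ 2 * mass ψ) (𝓝[≠] 0) (𝓝[>] c) := by
      refine tendsto_nhdsWithin_iff.mpr ⟨hct.mono_left nhdsWithin_le_nhds, ?_⟩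
      filter_upwards [self_mem_nhdsWithin] with t ht
      have : t ≠ 0 := ht
      have : 0 < t ^ 2 * mass ψ := by positivity
      exact lt_add_of_pos_right c this
    have h1 := (hr.comp hcw).mul_const (mass ψ)
    have : lam * mass ψ ≤ (lam + μ) * mass ψ := by
      refine le_of_tendsto_of_tendsto h1 hlim ?_
      filter_upwards [nhdsWithin_le_nhds hle, self_mem_nhdsWithin] with t ht ht0
      have ht2 : 0 < t ^ 2 := by
        have : t ≠ 0 := ht0
        positivity
      rw [Function.comp_apply, slope_def_field, add_sub_cancel_left, div_mul_eq_mul_div,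
        mul_div_mul_right _ _ hQ.ne']
      gcongr
    nlinarith
  have hlt : ∀ᶠ t : ℝ in 𝓝 0, t ≠ 0 → m n V f (c + (t * l2 u ψ + t ^ 2 * mass ψ)) <
      m n V f c + lam * (t * l2 u ψ + t ^ 2 * mass ψ) := by
    have h1 : ∀ᶠ t : ℝ in 𝓝[≠] 0, _ := hlim.eventually_lt_const
      (show (lam + μ) * mass ψ < lam * mass ψ by nlinarith)
    rw [eventually_nhdsWithin_iff] at h1
    filter_upwards [h1, hle] with t h1 h2 ht0
    have h3 := h1 ht0
    have ht2 : 0 < t ^ 2 := by positivity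
    rw [div_lt_iff₀ ht2] at h3
    linarith
  -- A nonzero strict derivative makes the mass map neighbourhoods of `0` onto neighbourhoods of
  -- `c`, so every mass near `c` is reached by some `u + tψ`.
  have hstrict : HasStrictDerivAt (fun t : ℝ => c + (t * l2 u ψ + t ^ 2 * mass ψ)) (l2 u ψ) 0 := by
    have h1 : HasStrictDerivAt (fun t : ℝ => t) 1 0 := hasStrictDerivAt_id 0
    have h2 := (((h1.mul_const (l2 u ψ)).add ((h1.pow 2).mul_const (mass ψ))).const_add c)
    refine h2.congr_deriv ?_
    simp
  have hmap := hstrict.map_nhds_eq hne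
  simp only [zero_mul, ne_eq, OfNat.ofNat_ne_zero, not_false_eq_true, zero_pow, add_zero] at hmap
  rw [eventually_nhdsWithin_iff, ← hmap, eventually_map]
  filter_upwards [hlt] with t ht htc
  have ht0 : t ≠ 0 := by
    rintro rfl
    simp at htc
  simpa using ht ht0

end MinimalEnergy

/-! ### Concave functions of one variable and their one-sided derivatives. -/

section RealAnalysis

variable {I : Set ℝ} {h a b : ℝ → ℝ}

/-- A continuous function that lies strictly below a line through each point of its graph, locally,
is strictly concave. -/
theorem strictConcaveOn_of_eventually_lt (hI : Convex ℝ I) (hc : ContinuousOn h I)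
    (hs : ∀ c ∈ I, ∃ l : ℝ, ∀ᶠ t in 𝓝[≠] c, h t < h c + l * (t - c)) :
    StrictConcaveOn ℝ I h := by
  refine LinearOrder.strictConcaveOn_of_lt hI fun x hx y hy hxy α β hα hβ hαβ => ?_
  have hIcc : Icc x y ⊆ I := hI.ordConnected.out hx hy
  set k := (h y - h x) / (y - x) with hk
  have hyx : 0 < y - x := sub_pos.mpr hxy
  have hkk : k * (y - x) = h y - h x := by rw [hk]; field_simp
  let g : ℝ → ℝ := fun t => h t - (h x + k * (t - x))
  have hgc : ContinuousOn g (Icc x y) := (hc.mono hIcc).sub (by fun_prop)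
  -- At `w ± δ / 2` the linear terms cancel, so `g (w + δ / 2) + g (w - δ / 2) < 2 g w`. The minimum
  -- of `g`, the height above the chord, is therefore at an endpoint and equals `0`; a zero inside
  -- would be another minimum.
  have hno : ∀ w ∈ Ioo x y, ¬ IsMinOn g (Icc x y) w := by
    intro w hw hmin
    obtain ⟨l, hl⟩ := hs w (hIcc (Ioo_subset_Icc_self hw))
    rw [eventually_nhdsWithin_iff] at hl
    obtain ⟨δ, hδ, hb⟩ := Metric.eventually_nhds_iff.mp (hl.and (Ioo_mem_nhds hw.1 hw.2))
    have h1 := hb (y := w + δ / 2) (by simp [abs_of_pos hδ, hδ])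
    have h2 := hb (y := w - δ / 2) (by simp [abs_of_pos hδ, hδ])
    have h1' := h1.1 (by simpa using hδ.ne')
    have h2' := h2.1 (by simpa using hδ.ne')
    have h3 := isMinOn_iff.mp hmin _ (Ioo_subset_Icc_self h1.2)
    have h4 := isMinOn_iff.mp hmin _ (Ioo_subset_Icc_self h2.2)
    simp only [g] at h3 h4
    linarith
  obtain ⟨w, hw, hmin⟩ := isCompact_Icc.exists_isMinOn (nonempty_Icc.mpr hxy.le) hgc
  have hgx : g x = 0 := by simp [g]
  have hgy : g y = 0 := by simp only [g]; linarith
  have hg0 : g w = 0 := by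
    by_contra hne
    refine hno w ⟨lt_of_le_of_ne hw.1 ?_, lt_of_le_of_ne hw.2 ?_⟩ hmin
    · rintro rfl; exact hne hgx
    · rintro rfl; exact hne hgy
  have hz : α • x + β • y ∈ Ioo x y := by
    have : α = 1 - β := by linarith
    subst this
    simp only [smul_eq_mul]
    constructor <;> nlinarith
  have hpos : 0 < g (α • x + β • y) := by
    have h1 := isMinOn_iff.mp hmin _ (Ioo_subset_Icc_self hz)
    rw [hg0] at h1
    refine lt_of_le_of_ne h1 fun h2 => hno _ hz ?_
    rw [isMinOn_iff]
    intro t ht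
    rw [← h2, ← hg0]
    exact isMinOn_iff.mp hmin t ht
  have : α = 1 - β := by linarith
  subst this
  simp only [g, smul_eq_mul] at hpos ⊢
  have e : k * ((1 - β) * x + β * y - x) = β * (h y - h x) := by rw [← hkk]; ring
  linarith

lemma StrictConcaveOn.left_lt_right (hh : StrictConcaveOn ℝ I h)
    (hR : ∀ c ∈ I, HasDerivWithinAt h (a c) (Ioi c) c)
    (hL : ∀ c ∈ I, HasDerivWithinAt h (b c) (Iio c) c) {x y : ℝ} (hx : x ∈ I) (hy : y ∈ I)
    (hxy : x < y) : b y < a x :=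
  (hh.lt_slope_of_hasDerivWithinAt_Iio hx hy hxy (hL y hy)).trans
    (hh.slope_lt_of_hasDerivWithinAt_Ioi hx hy hxy (hR x hx))

/-- A monotone right derivative is bounded by its values at the endpoints, and the mean value
inequality needs only right derivatives. -/
lemma exists_lipschitzOnWith_of_antitoneOn (hI : Convex ℝ I) (hc : ContinuousOn h I)
    (hR : ∀ c ∈ I, HasDerivWithinAt h (a c) (Ioi c) c) (ha : AntitoneOn a I) {x y : ℝ}
    (hx : x ∈ I) (hy : y ∈ I) : ∃ K, LipschitzOnWith K h (Icc x y) := by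
  have hIcc : Icc x y ⊆ I := hI.ordConnected.out hx hy
  refine ⟨Real.toNNReal (max |a x| |a y|), LipschitzOnWith.of_dist_le_mul fun s hs t ht => ?_⟩
  rw [Real.coe_toNNReal _ ((abs_nonneg _).trans (le_max_left _ _))]
  have key : ∀ s ∈ Icc x y, ∀ t ∈ Icc x y, s ≤ t →
      dist (h t) (h s) ≤ max |a x| |a y| * dist t s := by
    intro s hs t ht hst
    have hsub : Icc s t ⊆ Icc x y := Icc_subset_Icc hs.1 ht.2
    have := norm_image_sub_le_of_norm_deriv_right_le_segment (C := max |a x| |a y|)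
      (hc.mono (hsub.trans hIcc)) (fun r hr =>
        hasDerivWithinAt_Ioi_iff_Ici.mp (hR r (hIcc (hsub (Ico_subset_Icc_self hr)))))
      (fun r hr => ?_) t (right_mem_Icc.mpr hst)
    · rwa [dist_eq_norm, Real.dist_eq, abs_of_nonneg (sub_nonneg.mpr hst)]
    · have hr' := hsub (Ico_subset_Icc_self hr)
      exact abs_le_max_abs_abs (ha (hIcc hr') hy hr'.2) (ha hx (hIcc hr') hr'.1) |>.trans
        (le_of_eq (max_comm _ _))
  rcases le_total s t with hst | hst
  · rw [dist_comm, dist_comm s]; exact key s hs t ht hst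
  · exact key t ht s hs hst

/-- Where the right derivative of `h` is differentiable, `h` is twice differentiable. -/
lemma twiceDiffAt_of_differentiableAt (hI : IsOpen I) (hc : ContinuousOn h I)
    (hR : ∀ c ∈ I, HasDerivWithinAt h (a c) (Ioi c) c)
    (hL : ∀ c ∈ I, HasDerivWithinAt h (b c) (Iio c) c) {c : ℝ} (hcI : c ∈ I)
    (hlim : Tendsto a (𝓝[<] c) (𝓝 (b c))) (hd : DifferentiableAt ℝ a c) : TwiceDiffAt h c := by
  -- The left limit of `a` at `c` is `b c` by hypothesis and `a c` by continuity, so the one-sided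
  -- derivatives of `h` agree.
  have hab : b c = a c :=
    tendsto_nhds_unique hlim (hd.continuousAt.tendsto.mono_left nhdsWithin_le_nhds)
  have hder : HasDerivAt h (a c) c := by
    have h1 := hasDerivWithinAt_Ioi_iff_Ici.mp (hR c hcI)
    have h2 := hasDerivWithinAt_Iio_iff_Iic.mp (hL c hcI)
    rw [hab] at h2
    have := h2.union h1
    rwa [Iic_union_Ici, hasDerivWithinAt_univ] at this
  have heq : ∀ x ∈ I, DifferentiableAt ℝ h x → deriv h x = a x := fun x hx hdx =>
    (uniqueDiffWithinAt_Ioi x).eq_deriv _ hdx.hasDerivAt.hasDerivWithinAt (hR x hx)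
  refine ⟨hder.differentiableAt, deriv a c, ?_, ?_⟩
  · refine hd.hasDerivAt.hasDerivWithinAt.congr_of_eventuallyEq ?_ hder.deriv
    filter_upwards [self_mem_nhdsWithin, nhdsWithin_le_nhds (hI.mem_nhds hcI)] with x hx hxI
    exact heq x hxI hx
  · rw [hder.deriv]
    have ho := hasDerivAt_iff_isLittleO_nhds_zero.mp hd.hasDerivAt
    rw [Asymptotics.isLittleO_iff] at ho ⊢
    intro ε hε
    have hcI' : ∀ᶠ s in 𝓝 (0 : ℝ), c + s ∈ I := by
      have : Tendsto (fun s => c + s) (𝓝 0) (𝓝 c) := by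
        have hcont : Continuous fun s : ℝ => c + s := by fun_prop
        simpa using hcont.tendsto 0
      exact this.eventually (hI.mem_nhds hcI)
    obtain ⟨δ, hδ, hb⟩ := Metric.eventually_nhds_iff.mp ((ho hε).and hcI')
    refine Metric.eventually_nhds_iff.mpr ⟨δ, hδ, fun t ht => ?_⟩
    -- The Taylor remainder. Near `c` the function `h` has only right derivatives, so the one-sided
    -- mean value inequality is used, always from left to right: on `[0, t]` if `t ≥ 0` and on `[t,
    -- 0]` if `t ≤ 0`.
    let g : ℝ → ℝ := fun s => h (c + s) - h c - a c * s - deriv a c / 2 * s ^ 2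
    have hsmall : ∀ s, |s| ≤ |t| → c + s ∈ I ∧ |a (c + s) - a c - s * deriv a c| ≤ ε * |t| := by
      intro s hs
      have ht' : |t| < δ := by simpa using ht
      obtain ⟨h1, h2⟩ := hb (y := s) (by simpa using hs.trans_lt ht')
      refine ⟨h2, ?_⟩
      simp only [smul_eq_mul, Real.norm_eq_abs] at h1
      exact h1.trans (by gcongr)
    have hg : ∀ s, |s| ≤ |t| → HasDerivWithinAt g (a (c + s) - a c - s * deriv a c) (Ici s) s := by
      intro s hs
      have h1 := hasDerivWithinAt_Ioi_iff_Ici.mp (hR (c + s) (hsmall s hs).1)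
      have h2 : HasDerivWithinAt (fun r => c + r) 1 (Ici s) s :=
        ((hasDerivAt_id s).const_add c).hasDerivWithinAt
      have h3 := h1.comp s h2 fun r hr => add_le_add_right hr c
      have h4 := (((h3.sub_const (h c)).sub ((hasDerivWithinAt_id s _).const_mul (a c))).sub
        (((hasDerivWithinAt_id s _).pow 2).const_mul (deriv a c / 2)))
      refine h4.congr_deriv ?_
      simp only [id]
      push_cast
      ring
    have hgc : ContinuousOn g {s | |s| ≤ |t|} := by
      have : ContinuousOn (fun s => h (c + s)) {s | |s| ≤ |t|} :=
        hc.comp (by fun_prop) fun s hs => (hsmall s hs).1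
      exact ((this.sub (by fun_prop)).sub (by fun_prop)).sub (by fun_prop)
    have hg0 : g 0 = 0 := by simp [g]
    have hfin : ‖g t‖ ≤ ε * |t| * |t| := by
      rcases le_total 0 t with h0 | h0
      · have hsub : ∀ s ∈ Icc 0 t, |s| ≤ |t| := fun s hs => abs_le_abs_of_nonneg hs.1 hs.2
        have := norm_image_sub_le_of_norm_deriv_right_le_segment (C := ε * |t|) (hgc.mono hsub)
          (fun r hr => hg r (hsub r (Ico_subset_Icc_self hr)))
          (fun r hr => (hsmall r (hsub r (Ico_subset_Icc_self hr))).2) t (right_mem_Icc.mpr h0)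
        rw [hg0, sub_zero, sub_zero] at this
        rwa [abs_of_nonneg h0] at this ⊢
      · have hsub : ∀ s ∈ Icc t 0, |s| ≤ |t| := fun s hs => abs_le_abs_of_nonpos hs.2 hs.1
        have := norm_image_sub_le_of_norm_deriv_right_le_segment (C := ε * |t|) (hgc.mono hsub)
          (fun r hr => hg r (hsub r (Ico_subset_Icc_self hr)))
          (fun r hr => (hsmall r (hsub r (Ico_subset_Icc_self hr))).2) 0 (right_mem_Icc.mpr h0)
        rw [hg0, zero_sub, zero_sub, norm_neg] at this
        rwa [abs_of_nonpos h0] at this ⊢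
    rw [Real.norm_eq_abs (t ^ 2), abs_pow, sq |t|, ← mul_assoc]
    exact hfin

lemma AntitoneOn.ae_differentiableAt (hI : IsOpen I) (ha : AntitoneOn a I) :
    ∀ᵐ c : ℝ, c ∈ I → DifferentiableAt ℝ a c := by
  filter_upwards [(show MonotoneOn (fun x => -a x) I from ha.neg).ae_differentiableWithinAt_of_mem]
    with c h1 hc
  simpa using ((h1 hc).differentiableAt (hI.mem_nhds hc)).neg

end RealAnalysis

/-! ### Lower bounds for the Dini derivatives of the extremal multipliers. -/

section Dini

variable {n : ℕ} {V : ℝ → ℝ} {f : ℝ → ℝ → ℝ} {p B C K : ℝ} {I : Set ℝ}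

/-- Multipliers of ground states depend on the ground state in a Lipschitz way. -/
lemma Bounds.eventually_abs_multiplier_sub_le (hb : Bounds n V f p B C K) {c : ℝ} (hc : 0 < c)
    {u : H1 n} {lam : ℝ} (hu : u ∈ S n V f c) (hs : SolvesEq V f lam u) {v : ℕ → H1 n}
    {l : ℕ → ℝ} (hv : ∀ k, SolvesEq V f (l k) (v k)) (ht : Tendsto v atTop (𝓝 u)) :
    ∃ D, 0 ≤ D ∧ ∀ᶠ k in atTop, |l k - lam| ≤ D * ‖v k - u‖ := by
  obtain ⟨R, hR⟩ := ht.norm.bddAbove_range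
  obtain ⟨D, hD, h⟩ := hb.abs_firstVar_sub_le (max R ‖u‖)
  -- Both equations are tested with `u`. The denominator comes from `l2 (v k) u → 2 c`, which is
  -- eventually at least `c`.
  refine ⟨(D + |lam|) * ‖u‖ / c, by positivity, ?_⟩
  have hl := tendsto_l2_left ht u
  rw [l2_self_of_mem_S hu] at hl
  filter_upwards [hl.eventually_const_le (show c < 2 * c by linarith)] with k hk
  have h1 := h (v k) u u ((hR (mem_range_self k)).trans (le_max_left _ _)) (le_max_right _ _)
  rw [hb.firstVar_eq (hv k), hb.firstVar_eq hs] at h1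
  have h2 := abs_l2_le (v k - u) u
  rw [l2_sub_left] at h2
  have h3 : |l k - lam| * l2 (v k) u ≤ (D + |lam|) * (‖v k - u‖ * ‖u‖) := by
    rw [← abs_of_pos (hc.trans_le hk), ← abs_mul]
    have e : (l k - lam) * l2 (v k) u = (l k * l2 (v k) u - lam * l2 u u)
        - lam * (l2 (v k) u - l2 u u) := by ring
    rw [e]
    refine (abs_sub _ _).trans ?_
    rw [abs_mul lam]
    have := mul_le_mul_of_nonneg_left h2 (abs_nonneg lam)
    linarith
  have h4 : |l k - lam| * c ≤ |l k - lam| * l2 (v k) u := by gcongr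
  rw [div_mul_eq_mul_div, le_div_iff₀ hc]
  linarith

/-- Lipschitz dependence of ground states excludes infinite Dini derivatives. -/
lemma Bounds.false_of_lt (hb : Bounds n V f p B C K) {c : ℝ} (hc : 0 < c) {lam : ℝ} {ε : ℕ → ℝ}
    {u : ℕ → H1 n} {l : ℕ → ℝ} (hε : ∀ k, 0 < ε k) (hu : ∀ k, SolvesEq V f (l k) (u k))
    (hlt : ∀ k : ℕ, (k : ℝ) * ε k < |l k - lam|)
    (h : ∃ σ : ℕ → ℕ, StrictMono σ ∧ ∃ uc ∈ S n V f c, SolvesEq V f lam uc ∧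
      Tendsto (fun k => u (σ k)) atTop (𝓝 uc) ∧
      limsup (fun k => ((‖(ε (σ k))⁻¹ • (u (σ k) - uc)‖ : ℝ) : EReal)) atTop < ⊤) : False := by
  obtain ⟨σ, hσ, uc, huc, hs, ht, hlim⟩ := h
  obtain ⟨M, hM, -⟩ := EReal.lt_iff_exists_real_btwn.mp hlim
  obtain ⟨D, hD, hD'⟩ := hb.eventually_abs_multiplier_sub_le hc huc hs (fun k => hu (σ k)) ht
  -- The bounds `σ k * ε < |l - lam| ≤ D ‖u - uc‖ ≤ D M ε` at the index `σ k` are incompatible once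
  -- `σ k > D M`.
  have hk : ∀ᶠ k : ℕ in atTop, D * M < (σ k : ℝ) :=
    (tendsto_natCast_atTop_atTop.comp hσ.tendsto_atTop).eventually_gt_atTop _
  obtain ⟨k, h1, h2, h3⟩ := ((eventually_lt_of_limsup_lt hM).and (hD'.and hk)).exists
  rw [EReal.coe_lt_coe_iff, norm_smul, norm_inv, Real.norm_of_nonneg (hε _).le,
    inv_mul_lt_iff₀ (hε _)] at h1
  have h4 := hlt (σ k)
  have h5 := mul_le_mul_of_nonneg_left h1.le hD
  have h6 := mul_lt_mul_of_pos_right h3 (hε (σ k))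
  linarith

lemma exists_seq_of_liminf_eq_bot {g : ℝ → ℝ} {F : Filter ℝ}
    (h : ¬ ⊥ < liminf (fun x => (g x : EReal)) F) {P : ℕ → ℝ → Prop}
    (hP : ∀ k, ∀ᶠ x in F, P k x) : ∃ t : ℕ → ℝ, ∀ k, g (t k) < -k ∧ P k (t k) := by
  rw [not_bot_lt_iff] at h
  have : ∀ k : ℕ, ∃ x, g x < -k ∧ P k x := by
    intro k
    have h1 : liminf (fun x => (g x : EReal)) F < ((-(k : ℝ) : ℝ) : EReal) := by
      rw [h]; exact EReal.bot_lt_coe _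
    obtain ⟨x, hx1, hx2⟩ := ((frequently_lt_of_liminf_lt (by isBoundedDefault) h1).and_eventually
      (hP k)).exists
    exact ⟨x, EReal.coe_lt_coe_iff.mp hx1, hx2⟩
  choose t ht using this
  exact ⟨t, ht⟩

/-- If the bound failed, there would be masses `t k` within `1 / (k + 1)` of `c` with quotient below
`-k`. By (A1) the least multipliers there belong to positive radial decreasing ground states, to
which (D1) applies. -/
lemma Bounds.bot_lt_liminf_right (hb : Bounds n V f p B C K) (hA1 : CondA1 n V f I)
    (hA3 : CondA3 n V f I) (hI : IsOpen I) {c : ℝ} (hc : c ∈ I) (hD : CondD1 n V f I c) :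
    ⊥ < liminf (fun c' : ℝ =>
        (((lamMin n V f c' - lamMin n V f c) / (c' - c) : ℝ) : EReal)) (𝓝[>] c) := by
  by_contra hcon
  obtain ⟨t, ht⟩ := exists_seq_of_liminf_eq_bot hcon
    (P := fun k x => (x ∈ I ∧ c < x) ∧ x < c + 1 / ((k : ℝ) + 1)) fun k => by
      filter_upwards [nhdsWithin_le_nhds (hI.mem_nhds hc), self_mem_nhdsWithin,
        nhdsWithin_le_nhds (Iio_mem_nhds (show c < c + 1 / ((k : ℝ) + 1) by
          have : (0 : ℝ) < 1 / ((k : ℝ) + 1) := by positivity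
          linarith))] with x h1 h2 h3
      exact ⟨⟨h1, h2⟩, h3⟩
  have hε : ∀ k, 0 < t k - c := fun k => sub_pos.mpr (ht k).2.1.2
  have hε0 : Tendsto (fun k => t k - c) atTop (𝓝 0) :=
    squeeze_zero (fun k => (hε k).le) (fun k => by linarith [(ht k).2.2])
      tendsto_one_div_add_atTop_nhds_zero_nat
  have hex : ∀ k, ∃ u : H1 n, u ∈ S n V f (t k) ∧ PosRadDecr u ∧
      SolvesEq V f (lamMin n V f (t k)) u := fun k =>
    hb.exists_posRadDecr hA1 (ht k).2.1.1 (hb.isLeast_lamMin hA1 hA3 hI (ht k).2.1.1).1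
  choose u hu1 hu2 hu3 using hex
  have hconv := hD (fun k => t k - c) u hε hε0 fun k => ?_
  · refine hb.false_of_lt (lam := lamMin n V f c) (ε := fun k => t k - c)
      (l := fun k => lamMin n V f (t k)) (hb.mass_pos hA1 hc) hε hu3 (fun k => ?_) hconv
    have h1 := (ht k).1
    rw [div_lt_iff₀ (hε k)] at h1
    have := neg_abs_le (lamMin n V f (t k) - lamMin n V f c)
    linarith
  · rw [add_sub_cancel]
    exact ⟨(ht k).2.1.1, hu1 k, hu2 k, hu3 k⟩

lemma Bounds.bot_lt_liminf_left (hb : Bounds n V f p B C K) (hA1 : CondA1 n V f I)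
    (hA3 : CondA3 n V f I) (hI : IsOpen I) {c : ℝ} (hc : c ∈ I) (hD : CondD2 n V f I c) :
    ⊥ < liminf (fun c' : ℝ =>
        (((lamMax n V f c' - lamMax n V f c) / (c' - c) : ℝ) : EReal)) (𝓝[<] c) := by
  by_contra hcon
  obtain ⟨t, ht⟩ := exists_seq_of_liminf_eq_bot hcon
    (P := fun k x => (x ∈ I ∧ x < c) ∧ c - 1 / ((k : ℝ) + 1) < x) fun k => by
      filter_upwards [nhdsWithin_le_nhds (hI.mem_nhds hc), self_mem_nhdsWithin,
        nhdsWithin_le_nhds (Ioi_mem_nhds (show c - 1 / ((k : ℝ) + 1) < c by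
          have : (0 : ℝ) < 1 / ((k : ℝ) + 1) := by positivity
          linarith))] with x h1 h2 h3
      exact ⟨⟨h1, h2⟩, h3⟩
  have hε : ∀ k, 0 < c - t k := fun k => sub_pos.mpr (ht k).2.1.2
  have hε0 : Tendsto (fun k => c - t k) atTop (𝓝 0) :=
    squeeze_zero (fun k => (hε k).le) (fun k => by linarith [(ht k).2.2])
      tendsto_one_div_add_atTop_nhds_zero_nat
  have hex : ∀ k, ∃ u : H1 n, u ∈ S n V f (t k) ∧ PosRadDecr u ∧
      SolvesEq V f (lamMax n V f (t k)) u := fun k =>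
    hb.exists_posRadDecr hA1 (ht k).2.1.1 (hb.isGreatest_lamMax hA1 hA3 hI (ht k).2.1.1).1
  choose u hu1 hu2 hu3 using hex
  have hconv := hD (fun k => c - t k) u hε hε0 fun k => ?_
  · refine hb.false_of_lt (lam := lamMax n V f c) (ε := fun k => c - t k)
      (l := fun k => lamMax n V f (t k)) (hb.mass_pos hA1 hc) hε hu3 (fun k => ?_) hconv
    have h1 := (ht k).1
    rw [div_lt_iff_of_neg (by linarith [hε k])] at h1
    have := le_abs_self (lamMax n V f (t k) - lamMax n V f c)
    linarith
  · rw [sub_sub_cancel]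
    exact ⟨(ht k).2.1.1, hu1 k, hu2 k, hu3 k⟩

end Dini

/-! ### The mass interval and the conclusion. -/

lemma isOpen_massInterval (cl cu : EReal) : IsOpen (massInterval cl cu) :=
  (isOpen_Ioi.preimage continuous_coe_real_ereal).inter
    (isOpen_Iio.preimage continuous_coe_real_ereal)

lemma convex_massInterval (cl cu : EReal) : Convex ℝ (massInterval cl cu) := by
  refine OrdConnected.convex ⟨fun x hx y hy z hz => ?_⟩
  exact ⟨hx.1.trans_le (EReal.coe_le_coe_iff.mpr hz.1),
    (EReal.coe_le_coe_iff.mpr hz.2).trans_lt hy.2⟩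

end NGSS

theorem mainTheorem7 (n : ℕ) (hn : 1 ≤ n) (V : ℝ → ℝ) (f : ℝ → ℝ → ℝ)
    (hF1 : CondF1 f) (hF2 : CondF2 V) (hgrowth : Growth n f)
    (cl cu : EReal) (I : Set ℝ) (hI : I = massInterval cl cu)
    (hA1 : CondA1 n V f I) (hA3 : CondA3 n V f I) :
    -- extremal multipliers exist and are the one-sided derivatives of `m`
    (∀ c ∈ I, IsLeast (T n V f c) (lamMin n V f c) ∧ IsGreatest (T n V f c) (lamMax n V f c) ∧
      HasDerivWithinAt (m n V f) (lamMin n V f c) (Ioi c) c ∧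
      HasDerivWithinAt (m n V f) (lamMax n V f c) (Iio c) c) ∧
    -- one-sided limits of the extremal multipliers
    (∀ c ∈ I, Tendsto (lamMin n V f) (𝓝[>] c) (𝓝 (lamMin n V f c)) ∧
      Tendsto (lamMax n V f) (𝓝[>] c) (𝓝 (lamMin n V f c)) ∧
      Tendsto (lamMin n V f) (𝓝[<] c) (𝓝 (lamMax n V f c)) ∧
      Tendsto (lamMax n V f) (𝓝[<] c) (𝓝 (lamMax n V f c))) ∧
    -- `m` is decreasing, Lipschitz on compact subintervals, differentiable a.e.
    StrictAntiOn (m n V f) I ∧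
    (∀ a ∈ I, ∀ b ∈ I, ∃ K, LipschitzOnWith K (m n V f) (Icc a b)) ∧
    (∀ᵐ c : ℝ, c ∈ I → DifferentiableAt ℝ (m n V f) c) ∧
    -- `m` is strictly concave and twice differentiable a.e.
    StrictConcaveOn ℝ I (m n V f) ∧
    (∀ᵐ c : ℝ, c ∈ I → TwiceDiffAt (m n V f) c) ∧
    -- strict ordering of the multipliers
    (∀ c₁ ∈ I, ∀ c₂ ∈ I, c₂ < c₁ →
      lamMin n V f c₁ ≤ lamMax n V f c₁ ∧ lamMax n V f c₁ < lamMin n V f c₂ ∧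
      lamMin n V f c₂ ≤ lamMax n V f c₂) ∧
    -- lower Dini derivatives
    (∀ c ∈ I, CondD1 n V f I c →
      ⊥ < liminf (fun c' : ℝ =>
        (((lamMin n V f c' - lamMin n V f c) / (c' - c) : ℝ) : EReal)) (𝓝[>] c)) ∧
    (∀ c ∈ I, CondD2 n V f I c →
      ⊥ < liminf (fun c' : ℝ =>
        (((lamMax n V f c' - lamMax n V f c) / (c' - c) : ℝ) : EReal)) (𝓝[<] c)) := by
  obtain ⟨p, B, C, K, hb⟩ := exists_bounds hn hF1 hF2 hgrowth
  have hIo : IsOpen I := hI ▸ isOpen_massInterval cl cu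
  have hIc : Convex ℝ I := hI ▸ convex_massInterval cl cu
  have hmin := fun c (hc : c ∈ I) => hb.isLeast_lamMin hA1 hA3 hIo hc
  have hmax := fun c (hc : c ∈ I) => hb.isGreatest_lamMax hA1 hA3 hIo hc
  have hminT : ∀ t ∈ I, lamMin n V f t ∈ T n V f t := fun t ht => (hmin t ht).1
  have hmaxT : ∀ t ∈ I, lamMax n V f t ∈ T n V f t := fun t ht => (hmax t ht).1
  have hR := fun c (hc : c ∈ I) => (hb.tendsto_right hA1 hA3 hIo hc hminT).2
  have hL := fun c (hc : c ∈ I) => (hb.tendsto_left hA1 hA3 hIo hc hminT).2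
  have hconc : StrictConcaveOn ℝ I (m n V f) :=
    strictConcaveOn_of_eventually_lt hIc hA1.continuousOn fun c hc =>
      ⟨_, hb.eventually_m_lt hA1 hA3 hIo hc⟩
  have hle : ∀ c ∈ I, lamMin n V f c ≤ lamMax n V f c := fun c hc => (hmin c hc).2 (hmaxT c hc)
  -- For `x < y`, `λ_min(y) ≤ λ_max(y) < λ_min(x)`, the last step by strict concavity. A monotone
  -- function is differentiable almost everywhere, which drives `htwice`.
  have hanti : AntitoneOn (lamMin n V f) I := by
    intro x hx y hy hxy
    rcases hxy.eq_or_lt with rfl | hxy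
    · exact le_rfl
    · exact (hle y hy).trans (hconc.left_lt_right hR hL hx hy hxy).le
  have htwice : ∀ᵐ c : ℝ, c ∈ I → TwiceDiffAt (m n V f) c := by
    filter_upwards [hanti.ae_differentiableAt hIo] with c h1 hc
    exact twiceDiffAt_of_differentiableAt hIo hA1.continuousOn hR hL hc
      (hb.tendsto_left hA1 hA3 hIo hc hminT).1 (h1 hc)
  refine ⟨fun c hc => ⟨hmin c hc, hmax c hc, hR c hc, hL c hc⟩,
    fun c hc => ⟨(hb.tendsto_right hA1 hA3 hIo hc hminT).1,
      (hb.tendsto_right hA1 hA3 hIo hc hmaxT).1, (hb.tendsto_left hA1 hA3 hIo hc hminT).1,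
      (hb.tendsto_left hA1 hA3 hIo hc hmaxT).1⟩, ?_,
    fun x hx y hy => exists_lipschitzOnWith_of_antitoneOn hIc hA1.continuousOn hR hanti hx hy,
    htwice.mono fun c h hc => (h hc).1, hconc, htwice,
    fun c₁ h₁ c₂ h₂ h => ⟨hle c₁ h₁, hconc.left_lt_right hR hL h₂ h₁ h, hle c₂ h₂⟩,
    fun c hc hD => hb.bot_lt_liminf_right hA1 hA3 hIo hc hD,
    fun c hc hD => hb.bot_lt_liminf_left hA1 hA3 hIo hc hD⟩
  intro x hx y hy hxy
  -- By concavity a chord slope is below the right derivative at its left end, which is a negative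
  -- multiplier.
  have h1 := hconc.slope_lt_of_hasDerivWithinAt_Ioi hx hy hxy (hR x hx)
  have h2 := h1.trans (hb.multiplier_neg hA1 hx (hminT x hx))
  rw [slope_def_field, div_lt_iff₀ (sub_pos.mpr hxy)] at h2
  linarith
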